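/- Let $X$ be a simply connected (topological or smooth) $4$-manifold without boundary, and let $\Sigma=\Sigma_1\cup\Sigma_2\subset X$ be a configuration of two surfaces: $\Sigma_1,\Sigma_2$ are closed connected (locally flatly) embedded surfaces that meet in finitely many points. Fix a transverse intersection point of $\Sigma_1$ and $\Sigma_2$ and a neighbourhood of it, identified with $\mathbb C^2$, in which $\Sigma_1$ and $\Sigma_2$ are the coordinate axes $\{w=0\}$ and $\{z=0\}$. Let $B^4$ be the unit ball of $\mathbb C^2$, let $\mathbf T=\{|z|=|w|=\tfrac12\}=\mu_1\times\mu_2$ be the double point torus, where $\mu_1$ (the $w$-circle) and $\mu_2$ (the $z$-circle) are meridians of $\Sigma_1$ and $\Sigma_2$, and let $\mathbf T\times D^2\subset \operatorname{int} B^4$ be its standard tubular neighbourhood, disjoint from $\Sigma$. Put $X'=X-\operatorname{int}B^4$, $\Sigma'=\Sigma\cap X'$, and let $T\times I=\partial B^4-\Sigma$ (the complement of a Hopf link in $S^3$). For a knot $K\subset S^3$ with exterior $E(K)$, meridian $\mu_K$ and preferred (null-homologous) longitude $\lambda_K$, and for $k\in\mathbb Z$, the $k$-twisted double point surgery on $\Sigma$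 at this point is the pair $(X_K,\Sigma_K)$, where $$X_K=(X-\mathbf T\times\operatorname{int}D^2)\cup_{\phi_k}\bigl(E(K)\times S^1\bigr),\qquad \phi_k:\ \mu_1\mapsto\mu_K,\quad \mu_2\mapsto k\mu_K+[S^1],\quad \partial D^2\mapsto\lambda_K,$$ and $\Sigma_K$ is the image of $\Sigma$ in $X_K$; if $X_K$ is identified with another manifold (such as $X$) by a homeomorphism, $\Sigma_K$ is regarded as a subset of that manifold, and $X-\Sigma_K$ denotes the complement of $\Sigma_K$. Suppose that $\pi_1(X-\Sigma)$ is abelian. Then the homomorphism $i_2:\pi_1(T\times I)\to\pi_1(X'-\Sigma')$ induced by inclusion is surjective. Moreover, for every knot $K$ and every integer $k$: 1. If $\pi_1(X-\Sigma)$ is infinite cyclic, generated by $\mu_2$, and $k=0$, then $\pi_1(X-\Sigma_K)\cong\mathbb Z$. 2. If $\pi_1(X-\Sigma)$ is a finite cyclic group $\mathbb Z_q$ generated by $\mu_1$, with $\mu_1^p\mu_2=1$ for an integer $p$, and $\gcd(p+k,q)=1$, then $\pi_1(X-\Sigma_K)\cong\mathbb Z_q$. 3. If $\pi_1(X-\Sigma)\cong\mathbb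 Z_m\oplus\mathbb Z_n$ by an isomorphism that takes $\mu_1$ to a generator of $\mathbb Z_m$ and $\mu_2$ to a generator of $\mathbb Z_n$, and $\gcd(m,kn)=1$, then $\pi_1(X-\Sigma_K)\cong\mathbb Z_m\oplus\mathbb Z_n$. -/

import Mathlib

open Topology

noncomputable section

namespace DoublePointSurgery

/-! ### Loops -/

/-- The loop `t ↦ f (exp (2π i t))` defined by a map `f` from the circle. -/
def circleLoop {Y : Type*} [TopologicalSpace Y] (f : C(Circle, Y)) : Path (f 1) (f 1) where
  toFun t := f (Circle.exp (2 * Real.pi * (t : ℝ)))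
  continuous_toFun := by fun_prop
  source' := by simp
  target' := by simp

/-- The class in the fundamental group of the loop defined by a map from the circle. -/
def circleClass {Y : Type*} [TopologicalSpace Y] (f : C(Circle, Y)) : FundamentalGroup Y (f 1) :=
  FundamentalGroup.fromPath (Path.Homotopic.Quotient.mk (circleLoop f))

/-! ### Knots in the 3-sphere and their exteriors -/

/-- The unit sphere in Euclidean 4-space. -/
abbrev ThreeSphere : Type := Metric.sphere (0 : EuclideanSpace ℝ (Fin 4)) 1

/-- The exterior of the solid torus `S¹ × D²` (`D²` the unit disk in `ℂ`) under a map of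
`S¹ × ℂ` to the 3-sphere: the complement of the image of `S¹ × int D²`. -/
def tubeExterior (N : Circle × ℂ → ThreeSphere) : Set ThreeSphere :=
  (N '' {q | ‖q.2‖ < 1})ᶜ

theorem boundary_mem_tubeExterior {N : Circle × ℂ → ThreeSphere} (hN : IsOpenEmbedding N)
    (a b : Circle) : N (a, (b : ℂ)) ∈ tubeExterior N := by
  rintro ⟨q, hq, hqe⟩
  have h := hN.injective hqe
  subst h
  exact (lt_irrefl (1 : ℝ)) ((Circle.norm_coe b) ▸ hq)

/-- The longitude `N (S¹ × {1})`, as a map of the circle to the exterior. -/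
def longitudeMap {N : Circle × ℂ → ThreeSphere} (hN : IsOpenEmbedding N) :
    C(Circle, tubeExterior N) where
  toFun a := ⟨N (a, ((1 : Circle) : ℂ)), boundary_mem_tubeExterior hN a 1⟩
  continuous_toFun := Continuous.subtype_mk (hN.continuous.comp (by fun_prop)) _

/-- A (tame) knot in the 3-sphere, given with a tubular neighbourhood that is trivialized by the
preferred longitude. The knot is `tube (S¹ × {0})`, its tubular neighbourhood is
`tube (S¹ × D²)`, its meridian is `tube ({1} × ∂D²)`, and its longitude `tube (S¹ × {1})`
is null-homologous in the exterior, i.e. its class is trivial in the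
abelianization of the fundamental group of the exterior. -/
structure Knot where
  tube : Circle × ℂ → ThreeSphere
  isOpenEmbedding_tube : IsOpenEmbedding tube
  longitude_null_homologous :
    Abelianization.of (circleClass (longitudeMap isOpenEmbedding_tube)) = 1

/-- The exterior `E(K)` of a knot. -/
def Knot.exterior (K : Knot) : Set ThreeSphere := tubeExterior K.tube

/-! ### Configurations -/

variable {X : Type*} [TopologicalSpace X]

/-- A closed connected surface embedded, locally flatly, in the 4-manifold `X`. -/
structure IsEmbeddedSurface (S : Set X) : Prop where
  isCompact : IsCompact S
  isConnected : IsConnected S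
  locally_flat : ∀ x ∈ S, ∃ c : ℂ × ℂ → X,
    IsOpenEmbedding c ∧ c (0, 0) = x ∧ c ⁻¹' S = {p | p.2 = 0}

/-- A configuration of two surfaces: the components are embedded, the singularities are isolated
(finitely many, as the surfaces are compact). -/
structure IsConfiguration (S₁ S₂ : Set X) : Prop where
  left : IsEmbeddedSurface S₁
  right : IsEmbeddedSurface S₂
  finite_inter : (S₁ ∩ S₂).Finite

/-- A local model at a transverse double point of `S₁` and `S₂`: a neighbourhood of the point
is identified with `ℂ²`, the two surfaces becoming the two coordinate axes. -/
structure DoublePointChart (S₁ S₂ : Set X) where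
  toFun : ℂ × ℂ → X
  isOpenEmbedding : IsOpenEmbedding toFun
  preimage_left : toFun ⁻¹' S₁ = {p | p.2 = 0}
  preimage_right : toFun ⁻¹' S₂ = {p | p.1 = 0}

namespace DoublePointChart

variable {S₁ S₂ : Set X} (c : DoublePointChart S₁ S₂)

theorem apply_mem_compl {p : ℂ × ℂ} (h₁ : p.1 ≠ 0) (h₂ : p.2 ≠ 0) :
    c.toFun p ∈ (S₁ ∪ S₂)ᶜ := by
  rintro (h | h)
  · exact h₂ (by simpa using (c.preimage_left ▸ h : p ∈ {p : ℂ × ℂ | p.2 = 0}))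
  · exact h₁ (by simpa using (c.preimage_right ▸ h : p ∈ {p : ℂ × ℂ | p.1 = 0}))

/-- The double point torus `{|z| = |w| = 1/2}`, parametrized by `S¹ × S¹`. The first circle is a
meridian of the disk `B₁` in the `z`-axis, the second one of the disk `B₂` in the `w`-axis. -/
def torus (m : Circle × Circle) : ↥(S₁ ∪ S₂)ᶜ :=
  ⟨c.toFun ((1 / 2 : ℂ) * (m.2 : ℂ), (1 / 2 : ℂ) * (m.1 : ℂ)),
    c.apply_mem_compl (by simp) (by simp)⟩

theorem continuous_torus : Continuous c.torus :=
  Continuous.subtype_mk (c.isOpenEmbedding.continuous.comp (by fun_prop)) _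

/-- The base point on the double point torus. -/
def basePoint : ↥(S₁ ∪ S₂)ᶜ := c.torus (1, 1)

/-- The group of the configuration, with base point on the double point torus. -/
abbrev Group : Type _ := FundamentalGroup ↥(S₁ ∪ S₂)ᶜ c.basePoint

/-- The meridian `μ₁` of the first surface. -/
def meridian₁ : c.Group :=
  circleClass ⟨fun m => c.torus (m, 1), c.continuous_torus.comp (by fun_prop)⟩

/-- The meridian `μ₂` of the second surface. -/
def meridian₂ : c.Group :=
  circleClass ⟨fun m => c.torus (1, m), c.continuous_torus.comp (by fun_prop)⟩

/-! ### The complement of the ball around the double point -/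

/-- `X' - Σ'`: the complement of the configuration in the complement `X'` of the (open) unit
ball around the double point. -/
def ballExterior : Set X :=
  (c.toFun '' {p | ‖p.1‖ ^ 2 + ‖p.2‖ ^ 2 < 1})ᶜ \ (S₁ ∪ S₂)

/-- The thickened torus `T × I`: the complement of the Hopf link `∂B₁ ∪ ∂B₂` in the boundary
3-sphere of the ball. -/
def thickTorus : Set X :=
  c.toFun '' {p | ‖p.1‖ ^ 2 + ‖p.2‖ ^ 2 = 1 ∧ p.1 ≠ 0 ∧ p.2 ≠ 0}

theorem thickTorus_subset : c.thickTorus ⊆ c.ballExterior := by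
  rintro _ ⟨p, ⟨hp, h₁, h₂⟩, rfl⟩
  refine ⟨?_, c.apply_mem_compl h₁ h₂⟩
  rintro ⟨q, hq, hqe⟩
  have h := c.isOpenEmbedding.injective hqe
  subst h
  exact (ne_of_lt hq) hp

/-- The inclusion of `T × I` in `X' - Σ'`. -/
def thickTorusInclusion : C(c.thickTorus, c.ballExterior) :=
  ⟨Set.inclusion c.thickTorus_subset, continuous_inclusion c.thickTorus_subset⟩

/-! ### Twisted double point surgery -/

/-- The tubular neighbourhood `μ₁ × μ₂ × D²` of the double point torus, where `D²` is the unit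
disk in `ℂ`. -/
def torusTube (m₁ m₂ : Circle) (d : ℂ) : X :=
  c.toFun (((1 / 2 + d.re / 8 : ℝ) : ℂ) * (m₂ : ℂ), ((1 / 2 + d.im / 8 : ℝ) : ℂ) * (m₁ : ℂ))

/-- The complement of the open tubular neighbourhood of the double point torus. -/
def torusExterior : Set X :=
  {x | ∃ m₁ m₂ : Circle, ∃ d : ℂ, ‖d‖ < 1 ∧ c.torusTube m₁ m₂ d = x}ᶜ

/-- The gluing of `∂(T × D²)` to `∂(E(K) × S¹)` by
`μ₁ ↦ μ_K`, `μ₂ ↦ k μ_K + [S¹]`, `∂D² ↦ λ_K`. -/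
def Glue (K : Knot) (k : ℤ) :
    c.torusExterior ⊕ (K.exterior × Circle) → c.torusExterior ⊕ (K.exterior × Circle) → Prop
  | Sum.inl x, Sum.inr (e, s) => ∃ m₁ m₂ d : Circle,
      (x : X) = c.torusTube m₁ m₂ (d : ℂ) ∧
      (e : ThreeSphere) = K.tube (d, ((m₁ * m₂ ^ k : Circle) : ℂ)) ∧ s = m₂
  | _, _ => False

/-- The manifold `(X - T × int D²) ∪ (E(K) × S¹)`, with the quotient topology. -/
abbrev Surgered (K : Knot) (k : ℤ) : Type _ := Quot (c.Glue K k)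

/-- The surfaces, as a subset of the surgered manifold. -/
def surgeredSurfaces (K : Knot) (k : ℤ) : Set (c.Surgered K k) :=
  {y | ∃ x : c.torusExterior, (x : X) ∈ S₁ ∪ S₂ ∧ Quot.mk _ (Sum.inl x) = y}

/-- `(Y, S)` is the pair obtained from `(X, S₁ ∪ S₂)` by `k`-twisted double point surgery along
the knot `K` at the given double point. (`Y` is `X` itself when the surgered manifold is
identified with `X`.) -/
def IsTwistedSurgery (K : Knot) (k : ℤ) {Y : Type*} [TopologicalSpace Y] (S : Set Y) : Prop :=
  ∃ h : c.Surgered K k ≃ₜ Y, h '' c.surgeredSurfaces K k = S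

end DoublePointChart

end DoublePointSurgery

end

/-! The complements of surfaces are studied through holonomies: functors from the fundamental
groupoid of a space to a group. A holonomy on the complement of a closed set that does not
separate locally, and that is trivial on small loops around that set, extends over the set
(`Holonomy.isTrivial_of_locally`), hence is trivial if the ambient space is simply connected. This
serves two purposes.

For the configuration, a holonomy that is trivial on the double point torus is trivial near the
double point, and so near every point of the two connected surfaces. Hence it is trivial
(`DoublePointChart.isTrivial_of_torus`). As `π₁(X - Σ)` is abelian, this means that it is generated
by loops on the double point torus, which can be moved to `T × I`; and the radial push out of the
unit ball identifies `X - Σ` with `X' - Σ'` up to homotopy. So `i₂` is surjective. For a knot `K`,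
the same argument in the 3-sphere shows that the group of `K` is normally generated by a meridian
(`Knot.normalClosure_meridian`).

Next, let `Ω` be the complement of the surfaces in the surgered manifold. The surgery does
not affect the exterior of the ball, so there is a map `X - Σ → Ω`: push out of the ball, then
include (`DoublePointChart.surgeryMap`). It is injective on fundamental groups for every `K` and
`k`, as it has a left inverse up to homotopy: the exterior `E(K)` can be mapped to a solid torus by
an extension of the identification of the boundaries (`DoublePointChart.exists_collapse`). The
nontrivial ingredient here is a map from `E(K)` to the circle that is the angle along a meridian; it
comes from a section of a line bundle over the 3-sphere without a point, whose clutching function on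
the boundary of the tube is that angle (`Knot.exists_angle`).

The map is surjective on fundamental groups if `μ₁` is a power of `y = μ₁⁻ᵏ μ₂`: by the
Seifert–van Kampen theorem `π₁(Ω)` is generated by the image of `π₁(X - Σ)` and that of
`π₁(E(K) × S¹)`. In the latter `μ₁` is the meridian of the knot and `y` is the factor `S¹`, which is
central. So then the meridian is central in the image, the image of the knot group consists of its
powers, and nothing new is generated (`Knot.val_mem_zpowers`,
`DoublePointChart.surjective_map_surgeryMap`). Under each of the three hypotheses `μ₁` is a power of
`y`, by arithmetic. -/

namespace DoublePointSurgery

open scoped unitInterval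

section

/-! ### Holonomies -/

/-- A holonomy on `Y` with values in the group `A`: a functor from the fundamental groupoid of `Y`
to `A`, given by its values on paths. It plays the role of a flat `A`-bundle on `Y` that is
trivialized (discontinuously) over the points of `Y`. -/
structure Holonomy (Y : Type*) [TopologicalSpace Y] (A : Type*) [Group A] where
  val : ∀ {x y : Y}, Path x y → A
  val_eq_of_homotopic : ∀ {x y : Y} {p q : Path x y}, p.Homotopic q → val p = val q
  val_trans : ∀ {x y z : Y} (p : Path x y) (q : Path y z), val (p.trans q) = val p * val q

namespace Holonomy

variable {Y Z A B : Type*} [TopologicalSpace Y] [TopologicalSpace Z] [Group A] [Group B]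
  (ρ : Holonomy Y A)

theorem val_congr {x y x' y' : Y} (p : Path x y) (q : Path x' y') (h : ∀ t, p t = q t) :
    ρ.val p = ρ.val q := by
  obtain rfl : x = x' := by simpa using h 0
  obtain rfl : y = y' := by simpa using h 1
  congr 1
  ext t
  exact h t

theorem val_refl (x : Y) : ρ.val (Path.refl x) = 1 := by
  have h := ρ.val_trans (Path.refl x) (Path.refl x)
  rw [Path.refl_trans_refl] at h
  exact (mul_eq_left (b := ρ.val (Path.refl x))).1 h.symm

theorem val_symm {x y : Y} (p : Path x y) : ρ.val p.symm = (ρ.val p)⁻¹ := by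
  rw [eq_inv_iff_mul_eq_one, ← ρ.val_trans, ← ρ.val_refl y]
  exact ρ.val_eq_of_homotopic ⟨(Path.Homotopy.reflSymmTrans p).symm⟩

/-- The pullback of a holonomy by a continuous map. -/
def comap (f : C(Z, Y)) : Holonomy Z A where
  val p := ρ.val (p.map f.continuous)
  val_eq_of_homotopic h := ρ.val_eq_of_homotopic (h.map f)
  val_trans p q := by rw [Path.map_trans, ρ.val_trans]

theorem comap_val (f : C(Z, Y)) {x y : Z} (p : Path x y) :
    (ρ.comap f).val p = ρ.val (p.map f.continuous) := rfl

/-- The composition of a holonomy with a homomorphism of groups. -/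
def mapHom (φ : A →* B) : Holonomy Y B where
  val p := φ (ρ.val p)
  val_eq_of_homotopic h := by rw [ρ.val_eq_of_homotopic h]
  val_trans p q := by rw [ρ.val_trans, map_mul]

/-- Triviality on all loops. -/
def IsTrivial : Prop := ∀ (y : Y) (p : Path y y), ρ.val p = 1

variable {ρ}

theorem IsTrivial.val_eq (h : ρ.IsTrivial) {x y : Y} (p q : Path x y) : ρ.val p = ρ.val q := by
  have := h x (p.trans q.symm)
  rwa [ρ.val_trans, ρ.val_symm, mul_inv_eq_one] at this

variable (ρ)

theorem isTrivial_of_simplyConnected [SimplyConnectedSpace Y] : ρ.IsTrivial := fun y p => by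
  rw [← ρ.val_refl y]
  exact ρ.val_eq_of_homotopic (SimplyConnectedSpace.paths_homotopic _ _)

theorem val_map_mul_evalAt {f g : C(Z, Y)} (F : f.Homotopy g) {x y : Z} (p : Path x y) :
    ρ.val (p.map f.continuous) * ρ.val (F.evalAt y) =
      ρ.val (F.evalAt x) * ρ.val (p.map g.continuous) := by
  rw [← ρ.val_trans, ← ρ.val_trans]
  exact ρ.val_eq_of_homotopic (Path.Homotopic.map_trans_evalAt F p)

theorem val_map_eq {f g : C(Z, Y)} (F : f.Homotopy g) {x y : Z} (p : Path x y) :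
    ρ.val (p.map f.continuous) =
      ρ.val (F.evalAt x) * ρ.val (p.map g.continuous) * (ρ.val (F.evalAt y))⁻¹ := by
  rw [← val_map_mul_evalAt, mul_inv_cancel_right]

variable {ρ}

theorem isTrivial_comap_of_homotopic {f g : C(Z, Y)} (F : f.Homotopic g)
    (h : (ρ.comap g).IsTrivial) : (ρ.comap f).IsTrivial := fun y p => by
  obtain ⟨F⟩ := F
  have := h y p
  rw [comap_val] at this
  rw [comap_val, ρ.val_map_eq F, this, mul_one, mul_inv_cancel]

theorem isTrivial_comap_of_eq_comp {W : Type*} [TopologicalSpace W] {f : C(Z, Y)} {g : C(W, Y)}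
    (k : C(Z, W)) (hk : ∀ z, f z = g (k z)) (h : (ρ.comap g).IsTrivial) :
    (ρ.comap f).IsTrivial := fun y p => by
  rw [← h _ (p.map k.continuous)]
  exact ρ.val_congr _ _ fun t => hk _

/-- A loop that runs in the range of an embedding `f` has trivial holonomy if the pullback of the
holonomy by `f` is trivial. -/
theorem IsTrivial.val_eq_one_of_range {f : C(Z, Y)} (h : (ρ.comap f).IsTrivial)
    (hf : IsEmbedding f) {y : Y} (p : Path y y) (hp : ∀ t, p t ∈ Set.range f) : ρ.val p = 1 := by
  obtain ⟨z, rfl⟩ : y ∈ Set.range f := by simpa using hp 0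
  choose q hq using hp
  have hqc : Continuous q := hf.continuous_iff.2 (by
    have : ⇑f ∘ q = p := funext hq
    rw [this]; exact p.continuous)
  let q' : Path z z := ⟨⟨q, hqc⟩, hf.injective (by simp [hq]), hf.injective (by simp [hq])⟩
  rw [← h z q', comap_val]
  exact ρ.val_congr _ _ fun t => (hq t).symm

variable (ρ)

/-! ### Subdivision of paths -/

/-- If every point has a neighbourhood such that the paths in it have property `P`, and `P` is
closed under homotopy and concatenation, then every path has property `P`. -/
theorem _root_.DoublePointSurgery.path_induction {ι : Type*} {U : ι → Set Y}
    (hU : ∀ i, IsOpen (U i)) (hcov : ∀ y, ∃ i, y ∈ U i)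
    (P : ∀ {x y : Y}, Path x y → Prop)
    (hhom : ∀ {x y : Y} {p q : Path x y}, p.Homotopic q → P p → P q)
    (htrans : ∀ {x y z : Y} (p : Path x y) (q : Path y z), P p → P q → P (p.trans q))
    (hrefl : ∀ x, P (Path.refl x))
    (hP : ∀ i {x y : Y} (p : Path x y), (∀ t, p t ∈ U i) → P p)
    {x y : Y} (p : Path x y) : P p := by
  obtain ⟨t, ht0, htm, ⟨n, hn⟩, ht⟩ := exists_monotone_Icc_subset_open_cover_unitInterval
    (c := fun i => p ⁻¹' U i) (fun i => (hU i).preimage p.continuous)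
    (fun s _ => by simpa using hcov (p s))
  have key : ∀ m, P (p.subpath (t 0) (t m)) := by
    intro m
    induction m with
    | zero => rw [Path.subpath_self]; exact hrefl _
    | succ m ih =>
      refine hhom ⟨Path.Homotopy.subpathTransSubpath p (t 0) (t m) (t (m + 1))⟩
        (htrans _ _ ih ?_)
      obtain ⟨i, hi⟩ := ht m
      refine hP i _ fun s => ?_
      have hs : p.subpath (t m) (t (m + 1)) s ∈ Set.range (p.subpath (t m) (t (m + 1))) := ⟨s, rfl⟩
      rw [Path.range_subpath_of_le _ _ _ (htm m.le_succ)] at hs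
      obtain ⟨r, hr, hrs⟩ := hs
      exact hrs ▸ hi hr
  have h := key n
  rw [hn n le_rfl, ht0] at h
  have hcast : ∀ {a b : Y} (hx : a = x) (hy : b = y), P (p.cast hx hy) → P p := by
    rintro _ _ rfl rfl h; exact h
  rw [Path.subpath_zero_one] at h
  exact hcast _ _ h

/-- The generation half of the Seifert–van Kampen theorem. Suppose that, after a gauge
transformation `u i` over each of the open sets `U i`, a holonomy takes values in the subgroup `M`
over `U i`, and that the gauge transformations agree modulo `M`. Then the holonomy takes
values in `M` after a gauge transformation. -/
theorem gauge_of_cover {U₁ U₂ : Set Y} (h₁ : IsOpen U₁) (h₂ : IsOpen U₂)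
    (hcov : ∀ y, y ∈ U₁ ∨ y ∈ U₂) (M : Subgroup A) (u₁ u₂ : Y → A)
    (hu₁ : ∀ {x y : Y} (p : Path x y), (∀ t, p t ∈ U₁) → (u₁ x)⁻¹ * ρ.val p * u₁ y ∈ M)
    (hu₂ : ∀ {x y : Y} (p : Path x y), (∀ t, p t ∈ U₂) → (u₂ x)⁻¹ * ρ.val p * u₂ y ∈ M)
    (h₁₂ : ∀ x ∈ U₁, x ∈ U₂ → (u₁ x)⁻¹ * u₂ x ∈ M)
    {x y : Y} (hx : x ∈ U₁) (hy : y ∈ U₁) (p : Path x y) : (u₁ x)⁻¹ * ρ.val p * u₁ y ∈ M := by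
  classical
  let u : Y → A := fun x => if x ∈ U₁ then u₁ x else u₂ x
  have hu1 : ∀ x ∈ U₁, u x = u₁ x := fun x hx => if_pos hx
  have hu2 : ∀ x ∈ U₂, (u x)⁻¹ * u₂ x ∈ M := fun x hx => by
    by_cases h : x ∈ U₁
    · rw [hu1 x h]; exact h₁₂ x h hx
    · simp only [u, if_neg h, inv_mul_cancel]; exact M.one_mem
  have key : (u x)⁻¹ * ρ.val p * u y ∈ M := by
    refine path_induction (U := fun b : Bool => if b then U₁ else U₂) ?_ ?_
      (fun {x y} p => (u x)⁻¹ * ρ.val p * u y ∈ M) ?_ ?_ ?_ ?_ p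
    · rintro (_ | _) <;> simpa
    · intro y; rcases hcov y with h | h
      · exact ⟨true, by simpa⟩
      · exact ⟨false, by simpa⟩
    · intro x y p q h hp; rwa [← ρ.val_eq_of_homotopic h]
    · intro x y z p q hp hq
      have := M.mul_mem hp hq
      rw [ρ.val_trans]; convert! this using 1; group
    · intro x; rw [ρ.val_refl]; simp
    · rintro (_ | _) x y p hp
      · simp only [Bool.false_eq_true, if_false] at hp
        have h := M.mul_mem (M.mul_mem (hu2 x (by simpa using hp 0)) (hu₂ p hp))
          (M.inv_mem (hu2 y (by simpa using hp 1)))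
        convert! h using 1; group
      · simp only [if_true] at hp
        rw [hu1 x (by simpa using hp 0), hu1 y (by simpa using hp 1)]
        exact hu₁ p hp
  rwa [hu1 x hx, hu1 y hy] at key

/-- Over a path connected set in which all loops have trivial holonomy, the holonomy of a path is
the quotient of the values of a function (a potential) at its ends. -/
theorem exists_potential {U : Set Y} (hU : IsPathConnected U)
    (ht : ∀ (y : Y) (p : Path y y), (∀ t, p t ∈ U) → ρ.val p = 1) :
    ∃ u : Y → A, ∀ {x y : Y} (p : Path x y), (∀ t, p t ∈ U) → ρ.val p = u x * (u y)⁻¹ := by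
  classical
  obtain ⟨b, hbU⟩ := hU.nonempty
  let u : Y → A := fun x => if h : x ∈ U then ρ.val (hU.joinedIn x h b hbU).somePath else 1
  refine ⟨u, fun {x y} p hp => ?_⟩
  have hx : x ∈ U := by simpa using hp 0
  have hy : y ∈ U := by simpa using hp 1
  have := ht x ((p.trans (hU.joinedIn y hy b hbU).somePath).trans
    (hU.joinedIn x hx b hbU).somePath.symm) (fun t => by
      have : ((p.trans (hU.joinedIn y hy b hbU).somePath).trans
        (hU.joinedIn x hx b hbU).somePath.symm) t ∈ Set.range ((p.trans
          (hU.joinedIn y hy b hbU).somePath).trans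
            (hU.joinedIn x hx b hbU).somePath.symm) := ⟨t, rfl⟩
      rw [Path.trans_range, Path.trans_range, Path.symm_range] at this
      rcases this with (⟨s, hs⟩ | ⟨s, hs⟩) | ⟨s, hs⟩
      · exact hs ▸ hp s
      · exact hs ▸ JoinedIn.somePath_mem _ s
      · exact hs ▸ JoinedIn.somePath_mem _ s)
  rw [ρ.val_trans, ρ.val_trans, ρ.val_symm, mul_inv_eq_one] at this
  simp only [u, dif_pos hx, dif_pos hy]
  rw [← this, mul_inv_cancel_right]

/-- A holonomy that is trivial on the loops in each of two open sets with path connected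
intersection is trivial. -/
theorem isTrivial_of_cover {U₁ U₂ : Set Y} (h₁ : IsOpen U₁) (h₂ : IsOpen U₂)
    (hcov : ∀ y, y ∈ U₁ ∨ y ∈ U₂) (c₁ : IsPathConnected U₁) (c₂ : IsPathConnected U₂)
    (c₁₂ : IsPathConnected (U₁ ∩ U₂))
    (t₁ : ∀ (y : Y) (p : Path y y), (∀ t, p t ∈ U₁) → ρ.val p = 1)
    (t₂ : ∀ (y : Y) (p : Path y y), (∀ t, p t ∈ U₂) → ρ.val p = 1) : ρ.IsTrivial := by
  classical
  obtain ⟨b, hb⟩ := c₁₂.nonempty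
  obtain ⟨u₁, hu₁⟩ := ρ.exists_potential c₁ t₁
  obtain ⟨u₂, hu₂⟩ := ρ.exists_potential c₂ t₂
  -- normalize the potentials at the base point
  have key : ∀ {x y : Y}, x ∈ U₁ → y ∈ U₁ → ∀ p : Path x y,
      (u₁ x * (u₁ b)⁻¹)⁻¹ * ρ.val p * (u₁ y * (u₁ b)⁻¹) ∈ (⊥ : Subgroup A) := by
    intro x y hx hy p
    refine ρ.gauge_of_cover h₁ h₂ hcov ⊥ (fun x => u₁ x * (u₁ b)⁻¹) (fun x => u₂ x * (u₂ b)⁻¹)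
      ?_ ?_ ?_ hx hy p
    · intro x y p hp; rw [hu₁ p hp, Subgroup.mem_bot]; group
    · intro x y p hp; rw [hu₂ p hp, Subgroup.mem_bot]; group
    · intro x hx₁ hx₂
      obtain ⟨q, hq⟩ := c₁₂.joinedIn x ⟨hx₁, hx₂⟩ b hb
      rw [← hu₁ q fun t => (hq t).1, ← hu₂ q fun t => (hq t).2, Subgroup.mem_bot, inv_mul_cancel]
  have key' : ∀ (p : Path b b), ρ.val p = 1 := fun p => by
    have := key hb.1 hb.1 p
    rw [Subgroup.mem_bot] at this
    simpa using this
  intro y p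
  obtain ⟨q⟩ : Nonempty (Path b y) := by
    rcases hcov y with h | h
    · exact ⟨(c₁.joinedIn b hb.1 y h).somePath⟩
    · exact ⟨(c₂.joinedIn b hb.2 y h).somePath⟩
  have := key' ((q.trans p).trans q.symm)
  rw [ρ.val_trans, ρ.val_trans, ρ.val_symm] at this
  rwa [conj_eq_one_iff] at this

/-! ### Holonomies and homomorphisms -/

variable {y₀ : Y}

/-- The holonomy with values in the fundamental group itself, defined by paths `β y` from
the base point to all points. The inverse turns the multiplication of `FundamentalGroup`, which is
that of endomorphisms, into concatenation. -/
noncomputable def tautological (β : ∀ y, Path y₀ y) : Holonomy Y (FundamentalGroup Y y₀) where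
  val {x y} p := (FundamentalGroup.fromPath (Path.Homotopic.Quotient.mk (((β x).trans p).trans (β y).symm)))⁻¹
  val_eq_of_homotopic h := by
    congr 2
    exact Path.Homotopic.Quotient.eq.2 (((Path.Homotopic.refl _).hcomp h).hcomp (Path.Homotopic.refl _))
  val_trans {x y z} p q := by
    rw [← mul_inv_rev, inv_inj, FundamentalGroup.mul_def]
    simp only [Path.Homotopic.Quotient.mk_trans, Path.Homotopic.Quotient.mk_symm]
    simp only [Path.Homotopic.Quotient.trans_assoc]
    rw [← Path.Homotopic.Quotient.trans_assoc (Path.Homotopic.Quotient.symm _),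
      Path.Homotopic.Quotient.symm_trans, Path.Homotopic.Quotient.refl_trans]

variable [PathConnectedSpace Y]

open Classical in
/-- Paths from the base point to all points; the constant path at the base point. -/
noncomputable def _root_.DoublePointSurgery.basePath (y₀ y : Y) : Path y₀ y :=
  if h : y₀ = y then (Path.refl y₀).cast rfl h.symm else PathConnectedSpace.somePath y₀ y

theorem _root_.DoublePointSurgery.basePath_self (y₀ : Y) : basePath y₀ y₀ = Path.refl y₀ := by
  simp [basePath]

theorem tautological_val (p : Path y₀ y₀) : (tautological (basePath y₀)).val p =
    (FundamentalGroup.fromPath (Path.Homotopic.Quotient.mk p))⁻¹ := by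
  simp only [tautological, basePath_self, Path.Homotopic.Quotient.mk_trans,
    Path.Homotopic.Quotient.mk_symm]
  simp only [Path.Homotopic.Quotient.mk_refl, Path.Homotopic.Quotient.refl_trans]
  rw [← Path.Homotopic.Quotient.mk_refl, ← Path.Homotopic.Quotient.mk_symm, Path.refl_symm,
    Path.Homotopic.Quotient.mk_refl, Path.Homotopic.Quotient.trans_refl]

theorem tautological_val_of_eq {x y : Y} (p : Path x y) (q : Path y₀ y₀) (h : ∀ t, p t = q t) :
    (tautological (basePath y₀)).val p =
      (FundamentalGroup.fromPath (Path.Homotopic.Quotient.mk q))⁻¹ :=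
  (val_congr _ _ _ h).trans (tautological_val q)

/-- If, for a homomorphism `φ` of the fundamental group, the induced holonomy is trivial, then `φ`
is trivial. -/
theorem eq_one_of_isTrivial (φ : FundamentalGroup Y y₀ →* A)
    (h : ((tautological (basePath y₀)).mapHom φ).IsTrivial) : φ = 1 := by
  ext g
  induction g using Path.Homotopic.Quotient.ind with
  | mk p =>
  have := h y₀ p
  change φ _ = 1 at this
  rw [tautological_val, map_inv, inv_eq_one] at this
  exact this

end Holonomy

end

section

/-! ### Extending holonomies over thin sets -/

/-- Every point of the target of `j` has arbitrarily small neighbourhoods with (nonempty and) path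
connected preimage. For the inclusion of the complement of a closed set `Z`, this says that
`Z` is nowhere dense and does not separate locally. -/
def LocallyNonseparating {X Y : Type*} [TopologicalSpace X] (j : Y → X) [TopologicalSpace Y] :
    Prop :=
  ∀ x, ∀ O ∈ 𝓝 x, ∃ U ⊆ O, IsOpen U ∧ x ∈ U ∧ IsPathConnected (j ⁻¹' U)

variable {X Y A : Type*} [TopologicalSpace X] [TopologicalSpace Y] [Group A]

theorem LocallyNonseparating.pathConnectedSpace [ConnectedSpace X] {j : Y → X}
    (hj : LocallyNonseparating j) : PathConnectedSpace Y := by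
  obtain ⟨x₀⟩ : Nonempty X := inferInstance
  obtain ⟨U₀, -, hU₀o, hx₀, hU₀⟩ := hj x₀ Set.univ Filter.univ_mem
  obtain ⟨y₀, hy₀⟩ := hU₀.nonempty
  refine ⟨⟨y₀⟩, ?_⟩
  -- the points near which the complement lies in the path component of `y₀`
  let T : Set X := {x | ∃ U, IsOpen U ∧ x ∈ U ∧ j ⁻¹' U ⊆ pathComponent y₀}
  have hTo : IsOpen T := by
    refine isOpen_iff_forall_mem_open.2 ?_
    rintro x ⟨U, hU, hx, h⟩
    exact ⟨U, fun x' hx' => ⟨U, hU, hx', h⟩, hU, hx⟩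
  have hTc : IsOpen Tᶜ := by
    refine isOpen_iff_forall_mem_open.2 fun x hx => ?_
    obtain ⟨U, -, hU, hxU, hUc⟩ := hj x Set.univ Filter.univ_mem
    refine ⟨U, ?_, hU, hxU⟩
    rintro x' hx' ⟨V, hV, hxV, hVC⟩
    obtain ⟨W, hW, -, hxW, hWc⟩ := hj x' (U ∩ V) ((hU.inter hV).mem_nhds ⟨hx', hxV⟩)
    obtain ⟨y, hy⟩ := hWc.nonempty
    refine hx ⟨U, hU, hxU, fun z hz => ?_⟩
    exact (mem_pathComponent_iff.1 (hVC (hW hy).2)).trans (hUc.joinedIn y (hW hy).1 z hz).joined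
  have hT : T = Set.univ := by
    refine IsClopen.eq_univ ⟨⟨hTc⟩, hTo⟩ ⟨x₀, U₀, ?_, hx₀, fun z hz => ?_⟩
    · exact hU₀o
    · exact (hU₀.joinedIn y₀ hy₀ z hz).joined
  have key : ∀ y, Joined y₀ y := fun y => by
    obtain ⟨U, -, hy, h⟩ : j y ∈ T := hT ▸ Set.mem_univ _
    exact h hy
  exact fun y z => (key y).symm.trans (key z)

/-- A holonomy on `Y` that is trivial on the loops whose images in the simply connected space `X`
are small is trivial, if `Y` is locally connected over `X`: the flat bundle extends to a covering of
`X`, which has a section. -/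
theorem Holonomy.isTrivial_of_locally [SimplyConnectedSpace X] [LocallyPathConnectedSpace X]
    (ρ : Holonomy Y A) (j : C(Y, X)) (hj : LocallyNonseparating j)
    (ht : ∀ x, ∃ O ∈ 𝓝 x, ∀ (y : Y) (p : Path y y), (∀ t, j (p t) ∈ O) → ρ.val p = 1) :
    ρ.IsTrivial := by
  classical
  have hpot : ∀ x, ∃ U : Set X, IsOpen U ∧ x ∈ U ∧ ∃ u : Y → A,
      ∀ {y z : Y} (p : Path y z), (∀ t, p t ∈ j ⁻¹' U) → ρ.val p = u y * (u z)⁻¹ := by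
    intro x
    obtain ⟨O, hO, h⟩ := ht x
    obtain ⟨U, hUO, hU, hx, hUc⟩ := hj x O hO
    exact ⟨U, hU, hx, ρ.exists_potential hUc fun y p hp => h y p fun t => hUO (hp t)⟩
  choose U hU hxU u hu using hpot
  -- the transition functions
  have htrans : ∀ a b x, x ∈ U a → x ∈ U b → ∃ k : A, ∃ W : Set X, IsOpen W ∧ x ∈ W ∧
      ∀ y, j y ∈ W → (u b y)⁻¹ * u a y = k := by
    intro a b x hxa hxb
    obtain ⟨W, hWO, hW, hxW, hWc⟩ := hj x (U a ∩ U b) (((hU a).inter (hU b)).mem_nhds ⟨hxa, hxb⟩)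
    obtain ⟨y₀, hy₀⟩ := hWc.nonempty
    refine ⟨(u b y₀)⁻¹ * u a y₀, W, hW, hxW, fun y hy => ?_⟩
    obtain ⟨p, hp⟩ := hWc.joinedIn y hy y₀ hy₀
    have h₁ := hu a p fun t => (hWO (hp t)).1
    have h₂ := hu b p fun t => (hWO (hp t)).2
    rw [h₁] at h₂
    have h₃ : u a y = u b y * (u b y₀)⁻¹ * u a y₀ := by rw [← h₂, inv_mul_cancel_right]
    rw [h₃]; group
  let k : X → X → X → A := fun a b x =>
    if h : x ∈ U a ∧ x ∈ U b then (htrans a b x h.1 h.2).choose else 1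
  have hk : ∀ a b x, x ∈ U a → x ∈ U b → ∃ W : Set X, IsOpen W ∧ x ∈ W ∧
      ∀ y, j y ∈ W → (u b y)⁻¹ * u a y = k a b x := by
    intro a b x ha hb
    have := (htrans a b x ha hb).choose_spec
    simp only [k, dif_pos (And.intro ha hb)]
    exact this
  have hkj : ∀ a b y, j y ∈ U a → j y ∈ U b → k a b (j y) = (u b y)⁻¹ * u a y := by
    intro a b y ha hb
    obtain ⟨W, -, hxW, h⟩ := hk a b _ ha hb
    exact (h y hxW).symm
  -- values at points of `Y` near a point determine the transition functions there
  have hnear : ∀ x, ∀ W : Set X, IsOpen W → x ∈ W → ∃ y, j y ∈ W := by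
    intro x W hW hx
    obtain ⟨V, hVW, -, -, hVc⟩ := hj x W (hW.mem_nhds hx)
    exact ⟨_, hVW hVc.nonempty.some_mem⟩
  have hkloc : ∀ a b x, x ∈ U a → x ∈ U b → ∃ W : Set X, IsOpen W ∧ x ∈ W ∧ W ⊆ U a ∩ U b ∧
      ∀ x' ∈ W, k a b x' = k a b x := by
    intro a b x ha hb
    obtain ⟨W, hW, hxW, h⟩ := hk a b x ha hb
    refine ⟨W ∩ (U a ∩ U b), hW.inter ((hU a).inter (hU b)), ⟨hxW, ha, hb⟩, fun _ h => h.2, ?_⟩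
    intro x' hx'
    obtain ⟨W', hW', hxW', h'⟩ := hk a b x' hx'.2.1 hx'.2.2
    obtain ⟨y, hy⟩ := hnear x' (W ∩ W') (hW.inter hW') ⟨hx'.1, hxW'⟩
    rw [← h y hy.1, h' y hy.2]
  let _ : TopologicalSpace A := ⊥
  have _ : DiscreteTopology A := ⟨rfl⟩
  let C : FiberBundleCore X X A :=
    { baseSet := U
      isOpen_baseSet := hU
      indexAt := id
      mem_baseSet_at := hxU
      coordChange := fun a b x c => k a b x * c
      coordChange_self := by
        intro a x hx c
        obtain ⟨W, hW, hxW, h⟩ := hk a a x hx hx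
        obtain ⟨y, hy⟩ := hnear x W hW hxW
        rw [← h y hy, inv_mul_cancel, one_mul]
      continuousOn_coordChange := by
        intro a b
        rintro ⟨x, c⟩ ⟨⟨hxa, hxb⟩, -⟩
        obtain ⟨W, hW, hxW, -, h⟩ := hkloc a b x hxa hxb
        apply ContinuousAt.continuousWithinAt
        have hc : ContinuousAt (fun p : X × A => k a b x * p.2) (x, c) :=
          (continuous_of_discreteTopology (f := fun c : A => k a b x * c)).continuousAt.comp
            continuousAt_snd
        refine hc.congr ?_
        filter_upwards [(hW.preimage continuous_fst).mem_nhds (x := (x, c)) hxW] with p hp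
        rw [h p.1 hp]
      coordChange_comp := by
        intro a b d x hx c
        obtain ⟨W₁, hW₁, hx₁, h₁⟩ := hk a b x hx.1.1 hx.1.2
        obtain ⟨W₂, hW₂, hx₂, h₂⟩ := hk b d x hx.1.2 hx.2
        obtain ⟨W₃, hW₃, hx₃, h₃⟩ := hk a d x hx.1.1 hx.2
        obtain ⟨y, hy⟩ := hnear x (W₁ ∩ (W₂ ∩ W₃)) (hW₁.inter (hW₂.inter hW₃)) ⟨hx₁, hx₂, hx₃⟩
        rw [← h₁ y hy.1, ← h₂ y hy.2.1, ← h₃ y hy.2.2]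
        group }
  have hcov : IsCoveringMap (Bundle.TotalSpace.proj : Bundle.TotalSpace A C.Fiber → X) :=
    FiberBundle.isCoveringMap
  obtain ⟨x₀⟩ : Nonempty X := inferInstance
  obtain ⟨s, ⟨-, hs⟩, -⟩ := hcov.existsUnique_continuousMap_lifts (ContinuousMap.id X)
    (a₀ := x₀) (e₀ := ⟨x₀, (1 : A)⟩) rfl
  -- the section in the coordinates over `U a`
  let τ : X → X → A := fun a x => ((C.localTriv a) (s x)).2
  have hsx : ∀ x, (s x).proj = x := fun x => congrFun hs x
  have hτc : ∀ a, ∀ x ∈ U a, ∃ W : Set X, IsOpen W ∧ x ∈ W ∧ W ⊆ U a ∧ ∀ x' ∈ W, τ a x' = τ a x := by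
    intro a x hx
    have hcont : ContinuousAt (τ a) x := by
      refine continuousAt_snd.comp (ContinuousAt.comp ?_ s.continuous.continuousAt)
      refine (C.localTriv a).continuousAt ?_
      rw [(C.localTriv a).mem_source]
      change (s x).proj ∈ U a
      rwa [hsx]
    have h1 := hcont.eventually_mem ((isOpen_discrete {τ a x}).mem_nhds rfl)
    obtain ⟨W, hW, hWo, hxW⟩ := mem_nhds_iff.1 (Filter.inter_mem h1 ((hU a).mem_nhds hx))
    exact ⟨W, hWo, hxW, fun _ h => (hW h).2, fun x' h => (hW h).1⟩
  let f : X → A := fun x => (s x).2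
  have hτ : ∀ a x, τ a x = k x a x * f x := by
    intro a x
    change k (s x).proj a (s x).proj * f x = _
    rw [hsx]
  -- the global potential
  let v : Y → A := fun y => u (j y) y * f (j y)
  have hv : ∀ a y, j y ∈ U a → v y = u a y * τ a (j y) := by
    intro a y hy
    rw [hτ, hkj _ _ _ (hxU _) hy]
    simp only [v]
    group
  have key : ∀ {y z : Y} (p : Path y z), ρ.val p = v y * (v z)⁻¹ := by
    choose W hW hxW hWU hWτ using fun x => hτc x x (hxU x)
    intro y z p
    refine path_induction (U := fun x => j ⁻¹' W x) (fun x => (hW x).preimage j.continuous)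
      (fun y => ⟨j y, hxW _⟩) (fun {y z} p => ρ.val p = v y * (v z)⁻¹) ?_ ?_ ?_ ?_ p
    · intro y z p q h hp; rw [← ρ.val_eq_of_homotopic h, hp]
    · intro x y z p q hp hq; rw [ρ.val_trans, hp, hq]; group
    · intro y; rw [ρ.val_refl, mul_inv_cancel]
    · intro x y z p hp
      have hy : j y ∈ W x := by simpa using hp 0
      have hz : j z ∈ W x := by simpa using hp 1
      change ρ.val p = v y * (v z)⁻¹
      rw [hu x p fun t => hWU x (hp t), hv x y (hWU x hy), hv x z (hWU x hz),
        hWτ x _ hy, hWτ x _ hz]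
      group
  intro y p
  rw [key p, mul_inv_cancel]

end

section

/-! ### Holonomies on simple spaces -/

section SimplyConnected

universe u

variable {Y : Type u} [TopologicalSpace Y]

theorem simplyConnectedSpace_of_isTrivial [PathConnectedSpace Y]
    (h : ∀ (A : Type u) [Group A] (ρ : Holonomy Y A), ρ.IsTrivial) : SimplyConnectedSpace Y := by
  refine simply_connected_iff_loops_nullhomotopic.2 ⟨inferInstance, fun y p => ?_⟩
  have := h _ (Holonomy.tautological (basePath y)) y p
  rw [Holonomy.tautological_val, inv_eq_one] at this
  exact Path.Homotopic.Quotient.exact this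

theorem simplyConnectedSpace_of_retract {Z : Type*} [TopologicalSpace Z] [SimplyConnectedSpace Z]
    (s : C(Y, Z)) (r : C(Z, Y)) (h : ∀ y, r (s y) = y) : SimplyConnectedSpace Y := by
  have : PathConnectedSpace Y :=
    (show Function.Surjective r from fun y => ⟨_, h y⟩).pathConnectedSpace r.continuous
  refine simplyConnectedSpace_of_isTrivial fun A _ ρ y p => ?_
  have := (ρ.comap r).isTrivial_of_simplyConnected _ (p.map s.continuous)
  rw [← this]
  exact ρ.val_congr _ _ fun t => (h _).symm

end SimplyConnected

/-- The punctured complex plane. -/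
abbrev CStar : Type := {z : ℂ // z ≠ 0}

instance : PathConnectedSpace CStar :=
  isPathConnected_iff_pathConnectedSpace.1
    (isPathConnected_compl_singleton_of_one_lt_rank (by simp) (0 : ℂ))

/-- The point `z / |z|` of the circle. -/
noncomputable def CStar.unitPart (z : CStar) : Circle :=
  ⟨(z : ℂ) / ‖(z : ℂ)‖, by
    have := z.2
    simp [Submonoid.unitSphere, this]⟩

theorem CStar.coe_unitPart (z : CStar) : (z.unitPart : ℂ) = (z : ℂ) / ‖(z : ℂ)‖ := rfl

theorem CStar.continuous_unitPart : Continuous CStar.unitPart := by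
  refine Continuous.subtype_mk (Continuous.div (by fun_prop) (by fun_prop) fun z => ?_) _
  simpa using z.2

theorem CStar.norm_mul_unitPart (z : CStar) : (‖(z : ℂ)‖ : ℂ) * z.unitPart = z := by
  rw [coe_unitPart, mul_div_cancel₀]
  simpa using z.2

namespace Holonomy

variable {A : Type*} [Group A]

theorem isTrivial_puncturedPlane (ρ : Holonomy {p : ℂ × ℂ // p ≠ 0} A) : ρ.IsTrivial := by
  let f₁ : C(CStar × ℂ, {p : ℂ × ℂ // p ≠ 0}) :=
    ⟨fun q => ⟨(q.1, q.2), fun h => q.1.2 (congrArg Prod.fst h)⟩, by fun_prop⟩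
  let f₂ : C(ℂ × CStar, {p : ℂ × ℂ // p ≠ 0}) :=
    ⟨fun q => ⟨(q.1, q.2), fun h => q.2.2 (congrArg Prod.snd h)⟩, by fun_prop⟩
  let f₁₂ : C(CStar × CStar, {p : ℂ × ℂ // p ≠ 0}) :=
    ⟨fun q => ⟨(q.1, q.2), fun h => q.1.2 (congrArg Prod.fst h)⟩, by fun_prop⟩
  have r₁ : {p : {p : ℂ × ℂ // p ≠ 0} | p.1.1 ≠ 0} = Set.range f₁ := by
    ext p; constructor
    · intro h; exact ⟨(⟨p.1.1, h⟩, p.1.2), rfl⟩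
    · rintro ⟨q, rfl⟩; exact q.1.2
  have r₂ : {p : {p : ℂ × ℂ // p ≠ 0} | p.1.2 ≠ 0} = Set.range f₂ := by
    ext p; constructor
    · intro h; exact ⟨(p.1.1, ⟨p.1.2, h⟩), rfl⟩
    · rintro ⟨q, rfl⟩; exact q.2.2
  have r₁₂ : {p : {p : ℂ × ℂ // p ≠ 0} | p.1.1 ≠ 0} ∩ {p | p.1.2 ≠ 0} = Set.range f₁₂ := by
    ext p; constructor
    · intro h; exact ⟨(⟨p.1.1, h.1⟩, ⟨p.1.2, h.2⟩), rfl⟩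
    · rintro ⟨q, rfl⟩; exact ⟨q.1.2, q.2.2⟩
  have e₁ : IsEmbedding f₁ := by
    refine IsEmbedding.of_comp f₁.continuous continuous_subtype_val ?_
    exact IsEmbedding.subtypeVal.prodMap IsEmbedding.id
  have e₂ : IsEmbedding f₂ := by
    refine IsEmbedding.of_comp f₂.continuous continuous_subtype_val ?_
    exact IsEmbedding.id.prodMap IsEmbedding.subtypeVal
  have t₁ : (ρ.comap f₁).IsTrivial := by
    let g : C(ℂ, {p : ℂ × ℂ // p ≠ 0}) :=
      ⟨fun z => ⟨(z, 1), fun h => one_ne_zero (congrArg Prod.snd h)⟩, by fun_prop⟩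
    let k : C(CStar × ℂ, ℂ) := ⟨fun q => q.1, by fun_prop⟩
    refine isTrivial_comap_of_homotopic (g := g.comp k) ⟨⟨⟨fun q =>
      ⟨(q.2.1, (1 - (q.1 : ℝ)) * q.2.2 + (q.1 : ℝ)), fun h => q.2.1.2 (congrArg Prod.fst h)⟩,
      by fun_prop⟩, ?_, ?_⟩⟩ ?_
    · intro q; simp [f₁]
    · intro q; simp [g, k]
    · exact isTrivial_comap_of_eq_comp k (fun _ => rfl) ((ρ.comap g).isTrivial_of_simplyConnected)
  have t₂ : (ρ.comap f₂).IsTrivial := by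
    let g : C(ℂ, {p : ℂ × ℂ // p ≠ 0}) :=
      ⟨fun z => ⟨(1, z), fun h => one_ne_zero (congrArg Prod.fst h)⟩, by fun_prop⟩
    let k : C(ℂ × CStar, ℂ) := ⟨fun q => q.2, by fun_prop⟩
    refine isTrivial_comap_of_homotopic (g := g.comp k) ⟨⟨⟨fun q =>
      ⟨((1 - (q.1 : ℝ)) * q.2.1 + (q.1 : ℝ), q.2.2), fun h => q.2.2.2 (congrArg Prod.snd h)⟩,
      by fun_prop⟩, ?_, ?_⟩⟩ ?_
    · intro q; simp [f₂]
    · intro q; simp [g, k]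
    · exact isTrivial_comap_of_eq_comp k (fun _ => rfl) ((ρ.comap g).isTrivial_of_simplyConnected)
  refine ρ.isTrivial_of_cover (U₁ := {p | p.1.1 ≠ 0}) (U₂ := {p | p.1.2 ≠ 0}) ?_ ?_ ?_ ?_ ?_ ?_
    ?_ ?_
  · exact isOpen_ne_fun (by fun_prop) (by fun_prop)
  · exact isOpen_ne_fun (by fun_prop) (by fun_prop)
  · rintro ⟨⟨z, w⟩, h⟩
    by_contra! h'
    exact h (Prod.ext (by simpa using h'.1) (by simpa using h'.2))
  · rw [r₁]; exact isPathConnected_range f₁.continuous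
  · rw [r₂]; exact isPathConnected_range f₂.continuous
  · rw [r₁₂]; exact isPathConnected_range f₁₂.continuous
  · intro y p hp
    exact IsTrivial.val_eq_one_of_range t₁ e₁ p fun t => r₁ ▸ hp t
  · intro y p hp
    exact IsTrivial.val_eq_one_of_range t₂ e₂ p fun t => r₂ ▸ hp t

instance _root_.DoublePointSurgery.simplyConnectedSpace_puncturedPlane :
    SimplyConnectedSpace {p : ℂ × ℂ // p ≠ 0} := by
  have : PathConnectedSpace {p : ℂ × ℂ // p ≠ 0} :=
    isPathConnected_iff_pathConnectedSpace.1
      (isPathConnected_compl_singleton_of_one_lt_rank (by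
        rw [← Module.finrank_eq_rank]; simp) (0 : ℂ × ℂ))
  exact simplyConnectedSpace_of_isTrivial fun A _ ρ => ρ.isTrivial_puncturedPlane

/-- Euclidean 4-space is `ℂ²`. -/
noncomputable def _root_.DoublePointSurgery.euclideanEquiv :
    EuclideanSpace ℝ (Fin 4) ≃L[ℝ] ℂ × ℂ :=
  ContinuousLinearEquiv.ofFinrankEq (by simp)

instance _root_.DoublePointSurgery.simplyConnectedSpace_threeSphere :
    SimplyConnectedSpace ThreeSphere := by
  let s : C(ThreeSphere, {p : ℂ × ℂ // p ≠ 0}) :=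
    ⟨fun x => ⟨euclideanEquiv x, fun h => by
      have hx : ‖(x : EuclideanSpace ℝ (Fin 4))‖ = 1 := by simp
      rw [(map_eq_zero_iff _ euclideanEquiv.injective).1 h] at hx
      simp at hx⟩, by fun_prop⟩
  have h0 : ∀ p : {p : ℂ × ℂ // p ≠ 0}, ‖euclideanEquiv.symm p.1‖ ≠ 0 := fun p => by
    rw [norm_ne_zero_iff]
    exact (map_ne_zero_iff _ euclideanEquiv.symm.injective).2 p.2
  let r : C({p : ℂ × ℂ // p ≠ 0}, ThreeSphere) :=
    ⟨fun p => ⟨(‖euclideanEquiv.symm p.1‖)⁻¹ • euclideanEquiv.symm p.1, by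
      simp [norm_smul, inv_mul_cancel₀ (h0 p)]⟩, by
      refine Continuous.subtype_mk (Continuous.smul (Continuous.inv₀ (by fun_prop) h0)
        (by fun_prop)) _⟩
  refine simplyConnectedSpace_of_retract s r fun x => Subtype.ext ?_
  have hx : ‖(x : EuclideanSpace ℝ (Fin 4))‖ = 1 := by simp
  simp [r, s, hx]

/-! ### Holonomies on the circle and the torus -/

/-- The loop once around the circle. -/
noncomputable abbrev _root_.DoublePointSurgery.stdLoop : Path (1 : Circle) 1 :=
  circleLoop (ContinuousMap.id Circle)

/-- The holonomy of every loop in the circle is a power of that of the standard loop. -/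
theorem exists_val_eq_zpow_circle (ρ : Holonomy Circle A) (p : Path (1 : Circle) 1) :
    ∃ n : ℤ, ρ.val p = ρ.val stdLoop ^ n := by
  let e : C(ℝ, Circle) := ⟨fun s => Circle.exp (2 * Real.pi * s), by fun_prop⟩
  have htriv := (ρ.comap e).isTrivial_of_simplyConnected
  let seg : ∀ a b : ℝ, Path a b := fun a b =>
    ⟨⟨fun t => a + t * (b - a), by fun_prop⟩, by simp, by simp⟩
  have hone : ∀ n : ℤ, (ρ.comap e).val (seg n (n + 1)) = ρ.val stdLoop := fun n => by
    refine ρ.val_congr _ _ fun t => ?_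
    change Circle.exp (2 * Real.pi * (n + t * ((n + 1) - n))) = Circle.exp (2 * Real.pi * t)
    rw [add_sub_cancel_left, mul_one, mul_add, Circle.exp_add, Circle.exp_two_pi_mul_int, one_mul]
  have hpow : ∀ n : ℤ, (ρ.comap e).val (seg 0 n) = ρ.val stdLoop ^ n := by
    have step : ∀ n : ℤ, (ρ.comap e).val (seg 0 (n + 1)) =
        (ρ.comap e).val (seg 0 n) * ρ.val stdLoop := fun n => by
      rw [← hone n, ← val_trans]
      exact htriv.val_eq _ _
    intro n
    induction n using Int.induction_on with
    | zero =>
      rw [zpow_zero]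
      rw [← (ρ.comap e).val_refl 0]
      exact val_congr _ _ _ fun t => by simp [seg]
    | succ n ih =>
      rw [zpow_add_one, ← ih, ← step]
      exact val_congr _ _ _ fun t => by simp [seg]
    | pred n ih =>
      rw [zpow_sub_one, ← ih, eq_mul_inv_iff_mul_eq, ← step]
      exact val_congr _ _ _ fun t => by simp [seg]
  obtain ⟨Γ, hΓ, hΓ0⟩ := Circle.isCoveringMap_exp.exists_path_lifts p.toContinuousMap 0 (by simp)
  have hΓ' : ∀ t, Circle.exp (Γ t) = p t := fun t => congrFun hΓ t
  obtain ⟨n, hn⟩ := Circle.exp_eq_one.1 ((hΓ' 1).trans p.target)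
  refine ⟨n, ?_⟩
  have h2 : (2 * Real.pi) ≠ 0 := by positivity
  let q : Path (0 : ℝ) n := ⟨⟨fun t => Γ t / (2 * Real.pi), by fun_prop⟩, by simp [hΓ0], by
    simp only [hn]; field_simp⟩
  rw [← hpow, htriv.val_eq (seg 0 n) q]
  refine ρ.val_congr _ _ fun t => ?_
  change p t = Circle.exp (2 * Real.pi * (Γ t / (2 * Real.pi)))
  rw [mul_div_cancel₀ _ h2, hΓ']

theorem val_loop_eq_one_of_basePoint {Y : Type*} [TopologicalSpace Y] [PathConnectedSpace Y]
    {ρ : Holonomy Y A} (y₀ : Y) (h : ∀ p : Path y₀ y₀, ρ.val p = 1) : ρ.IsTrivial := by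
  intro y p
  have := h (((basePath y₀ y).trans p).trans (basePath y₀ y).symm)
  rw [val_trans, val_trans, val_symm] at this
  exact conj_eq_one_iff.1 this

theorem isTrivial_circle {ρ : Holonomy Circle A} (h : ρ.val stdLoop = 1) : ρ.IsTrivial :=
  val_loop_eq_one_of_basePoint 1 fun p => by
    obtain ⟨n, hn⟩ := ρ.exists_val_eq_zpow_circle p
    rw [hn, h, one_zpow]

/-- The holonomy on a product is determined by the holonomies on the factors. -/
theorem val_prod {Y Z : Type*} [TopologicalSpace Y] [TopologicalSpace Z]
    (ρ : Holonomy (Y × Z) A) {y y' : Y} {z z' : Z} (p : Path y y') (q : Path z z') :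
    ρ.val (p.prod q) = ρ.val (p.prod (Path.refl z)) * ρ.val ((Path.refl y').prod q) := by
  rw [← val_trans, Path.trans_prod_eq_prod_trans]
  refine ρ.val_eq_of_homotopic ?_
  exact ⟨(Path.Homotopic.prodHomotopy (Path.Homotopy.transRefl p) (Path.Homotopy.reflTrans q)).symm⟩

theorem isTrivial_torus {ρ : Holonomy (Circle × Circle) A}
    (h₁ : ρ.val (stdLoop.prod (Path.refl (1 : Circle))) = 1)
    (h₂ : ρ.val ((Path.refl (1 : Circle)).prod stdLoop) = 1) : ρ.IsTrivial := by
  refine val_loop_eq_one_of_basePoint (1, 1) fun p => ?_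
  have hp : ρ.val p = ρ.val ((p.map continuous_fst).prod (p.map continuous_snd)) :=
    ρ.val_congr _ _ fun t => rfl
  rw [hp, val_prod]
  have i₁ : (ρ.comap ⟨fun a : Circle => (a, (1 : Circle)), by fun_prop⟩).IsTrivial :=
    isTrivial_circle (by rw [← h₁]; exact ρ.val_congr _ _ fun t => rfl)
  have i₂ : (ρ.comap ⟨fun a : Circle => ((1 : Circle), a), by fun_prop⟩).IsTrivial :=
    isTrivial_circle (by rw [← h₂]; exact ρ.val_congr _ _ fun t => rfl)
  have j₁ := i₁ 1 (p.map continuous_fst)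
  have j₂ := i₂ 1 (p.map continuous_snd)
  rw [comap_val] at j₁ j₂
  rw [← mul_one (1 : A)]
  exact congrArg₂ (· * ·) ((ρ.val_congr _ _ fun t => rfl).trans j₁)
    ((ρ.val_congr _ _ fun t => rfl).trans j₂)

end Holonomy

end

section

/-! ### Charts -/

/-- An open embedding of a normed space can be composed with a radial embedding centred at `z` to
have image in a given neighbourhood. -/
theorem exists_shrink {E X : Type*} [NormedAddCommGroup E] [NormedSpace ℝ E] [TopologicalSpace X]
    {e : E → X} (he : IsOpenEmbedding e) (z : E) {O : Set X} (hO : O ∈ 𝓝 (e z)) :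
    ∃ r : E → ℝ, (∀ v, 0 < r v) ∧ IsOpenEmbedding (fun v => e (z + r v • v)) ∧
      ∀ v, e (z + r v • v) ∈ O := by
  obtain ⟨ε, hε, hball⟩ := Metric.mem_nhds_iff.1 (he.continuous.continuousAt.preimage_mem_nhds hO)
  refine ⟨fun v => ε * (√(1 + ‖v‖ ^ 2))⁻¹, fun v => by positivity, ?_, fun v => ?_⟩
  · have h₁ : IsOpenEmbedding (OpenPartialHomeomorph.univUnitBall : E → E) :=
      OpenPartialHomeomorph.univUnitBall.isOpenEmbedding rfl
    have h₂ : IsOpenEmbedding (fun v : E => z + ε • v) :=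
      ((Homeomorph.smulOfNeZero ε hε.ne').trans (Homeomorph.addLeft z)).isOpenEmbedding
    have h := he.comp (h₂.comp h₁)
    convert! h using 2 with v
    simp [OpenPartialHomeomorph.univUnitBall_apply, smul_smul]
  · refine hball ?_
    rw [Metric.mem_ball, dist_self_add_left, ← smul_smul, norm_smul, Real.norm_eq_abs,
      abs_of_pos hε]
    have h := OpenPartialHomeomorph.univUnitBall.map_source (x := v) trivial
    have h' : ‖(√(1 + ‖v‖ ^ 2))⁻¹ • v‖ < 1 := by
      simpa [OpenPartialHomeomorph.univUnitBall_apply, OpenPartialHomeomorph.univUnitBall_target]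
        using h
    nlinarith

theorem exists_normed_chart {H X : Type*} [NormedAddCommGroup H] [NormedSpace ℝ H] [TopologicalSpace X]
    [ChartedSpace H X] (x : X) {O : Set X} (hO : O ∈ 𝓝 x) :
    ∃ e : H → X, IsOpenEmbedding e ∧ e 0 = x ∧ ∀ v, e v ∈ O := by
  set φ := chartAt H x
  have hx : x ∈ φ.source := mem_chart_source _ x
  have hO' : φ.target ∩ φ.symm ⁻¹' O ∈ 𝓝 (φ x) := by
    refine Filter.inter_mem (φ.open_target.mem_nhds (φ.map_source hx)) ?_
    refine (φ.continuousAt_symm (φ.map_source hx)).preimage_mem_nhds ?_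
    rwa [φ.left_inv hx]
  obtain ⟨r, -, hr, hrO⟩ := exists_shrink (e := (id : H → H)) IsOpenEmbedding.id (φ x) hO'
  let k : H → φ.symm.source := fun v => ⟨id (φ x + r v • v), (hrO v).1⟩
  have hk : IsOpenEmbedding k :=
    IsOpenEmbedding.of_comp k φ.open_target.isOpenEmbedding_subtypeVal hr
  refine ⟨_, φ.symm.isOpenEmbedding_restrict.comp hk, ?_, fun v => (hrO v).2⟩
  simp [k, Set.domRestrict, φ.left_inv hx]

theorem exists_chart {X : Type*} [TopologicalSpace X]
    [ChartedSpace (EuclideanSpace ℝ (Fin 4)) X] (x : X) {O : Set X} (hO : O ∈ 𝓝 x) :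
    ∃ e : ℂ × ℂ → X, IsOpenEmbedding e ∧ e 0 = x ∧ ∀ v, e v ∈ O := by
  obtain ⟨e, he, h0, heO⟩ := exists_normed_chart (H := EuclideanSpace ℝ (Fin 4)) x hO
  exact ⟨e ∘ euclideanEquiv.symm, he.comp euclideanEquiv.symm.toHomeomorph.isOpenEmbedding,
    by simp [h0], fun v => heO _⟩

theorem isPathConnected_preimage_range {X Y Z : Type*} [TopologicalSpace Y]
    [TopologicalSpace Z] [PathConnectedSpace Z] (j : Y → X) {U : Set X} (f : C(Z, Y))
    (h₁ : ∀ z, j (f z) ∈ U) (h₂ : ∀ y, j y ∈ U → ∃ z, f z = y) : IsPathConnected (j ⁻¹' U) := by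
  have : j ⁻¹' U = Set.range f := by
    ext y
    exact ⟨fun h => h₂ y h, by rintro ⟨z, rfl⟩; exact h₁ z⟩
  rw [this]
  exact isPathConnected_range f.continuous

/-! ### Removing finitely many points from a 4-manifold -/

section Finite

universe u

variable {X : Type u} [TopologicalSpace X] [T2Space X]
  [ChartedSpace (EuclideanSpace ℝ (Fin 4)) X]

theorem exists_chart_of_finite {F : Set X} (hF : F.Finite) (x : X) {O : Set X} (hO : O ∈ 𝓝 x) :
    ∃ e : ℂ × ℂ → X, IsOpenEmbedding e ∧ e 0 = x ∧ (∀ v, e v ∈ O) ∧ ∀ v, v ≠ 0 → e v ∉ F := by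
  obtain ⟨e, he, h0, h⟩ := exists_chart x (Filter.inter_mem hO
    ((hF.subset Set.sdiff_subset).isClosed.isOpen_compl.mem_nhds
      (show x ∈ (F \ {x})ᶜ from fun h => h.2 rfl)))
  refine ⟨e, he, h0, fun v => (h v).1, fun v hv hF => (h v).2 ⟨hF, fun hx => hv ?_⟩⟩
  exact he.injective (hx.trans h0.symm)

theorem locallyNonseparating_finite {F : Set X} (hF : F.Finite) :
    LocallyNonseparating (Subtype.val : ↥Fᶜ → X) := by
  intro x O hO
  obtain ⟨e, he, h0, heO, heF⟩ := exists_chart_of_finite hF x hO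
  refine ⟨Set.range e, by rintro _ ⟨v, rfl⟩; exact heO v, he.isOpen_range, ⟨0, h0⟩, ?_⟩
  by_cases hx : x ∈ F
  · refine isPathConnected_preimage_range _
      (⟨fun p => ⟨e p, heF p p.2⟩, Continuous.subtype_mk
        (he.continuous.comp continuous_subtype_val) _⟩ : C({p : ℂ × ℂ // p ≠ 0}, ↥Fᶜ)) ?_ ?_
    · exact fun z => ⟨_, rfl⟩
    · rintro ⟨y, hy⟩ ⟨v, rfl⟩
      exact ⟨⟨v, fun hv => hy (by rwa [hv, h0])⟩, rfl⟩
  · have heF' : ∀ v, e v ∉ F := fun v => by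
      by_cases hv : v = 0
      · rwa [hv, h0]
      · exact heF v hv
    refine isPathConnected_preimage_range _
      (⟨fun p => ⟨e p, heF' p⟩, Continuous.subtype_mk he.continuous _⟩ : C(ℂ × ℂ, ↥Fᶜ)) ?_ ?_
    · exact fun z => ⟨_, rfl⟩
    · rintro ⟨y, hy⟩ ⟨v, rfl⟩
      exact ⟨v, rfl⟩

theorem simplyConnectedSpace_compl_finite [SimplyConnectedSpace X] {F : Set X} (hF : F.Finite) :
    SimplyConnectedSpace ↥Fᶜ := by
  have : LocallyPathConnectedSpace X := ChartedSpace.locallyPathConnectedSpace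
    (EuclideanSpace ℝ (Fin 4)) X
  have : PathConnectedSpace ↥Fᶜ := (locallyNonseparating_finite hF).pathConnectedSpace
  refine simplyConnectedSpace_of_isTrivial fun A _ ρ => ?_
  refine ρ.isTrivial_of_locally ⟨Subtype.val, continuous_subtype_val⟩
    (locallyNonseparating_finite hF) fun x => ?_
  obtain ⟨e, he, h0, -, heF⟩ := exists_chart_of_finite hF x Filter.univ_mem
  refine ⟨Set.range e, he.isOpen_range.mem_nhds ⟨0, h0⟩, fun y p hp => ?_⟩
  by_cases hx : x ∈ F
  · let f : C({p : ℂ × ℂ // p ≠ 0}, ↥Fᶜ) := ⟨fun p => ⟨e p, heF p p.2⟩, Continuous.subtype_mk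
        (he.continuous.comp continuous_subtype_val) _⟩
    refine Holonomy.IsTrivial.val_eq_one_of_range (f := f)
      ((ρ.comap f).isTrivial_of_simplyConnected) ?_ p fun t => ?_
    · exact IsEmbedding.of_comp f.continuous continuous_subtype_val
        (he.isEmbedding.comp IsEmbedding.subtypeVal)
    · obtain ⟨v, hv⟩ := hp t
      refine ⟨⟨v, fun h => (p t).2 ?_⟩, Subtype.ext hv⟩
      change e v = (p t : X) at hv
      rwa [← hv, h, h0]
  · have heF' : ∀ v, e v ∉ F := fun v => by
      by_cases hv : v = 0
      · rwa [hv, h0]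
      · exact heF v hv
    let f : C(ℂ × ℂ, ↥Fᶜ) := ⟨fun p => ⟨e p, heF' p⟩, Continuous.subtype_mk he.continuous _⟩
    refine Holonomy.IsTrivial.val_eq_one_of_range (f := f)
      ((ρ.comap f).isTrivial_of_simplyConnected) ?_ p fun t => ?_
    · exact IsEmbedding.of_comp f.continuous continuous_subtype_val he.isEmbedding
    · obtain ⟨v, hv⟩ := hp t
      exact ⟨v, Subtype.ext hv⟩

end Finite

/-! ### Meridians of locally flat surfaces -/

section Surfaces

variable {X A : Type*} [TopologicalSpace X] [Group A] {S T Q : Set X}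

/-- The holonomy `ρ` on the complement of `Q` is trivial on the loops near `x`. -/
def TrivialNear (ρ : Holonomy ↥Qᶜ A) (x : X) : Prop :=
  ∃ O ∈ 𝓝 x, ∀ (y : ↥Qᶜ) (p : Path y y), (∀ t, (p t : X) ∈ O) → ρ.val p = 1

theorem TrivialNear.eventually {ρ : Holonomy ↥Qᶜ A} {x : X} (h : TrivialNear ρ x) :
    ∀ᶠ x' in 𝓝 x, TrivialNear ρ x' := by
  obtain ⟨O, hO, h⟩ := h
  filter_upwards [eventually_mem_nhds_iff.2 hO] with x' hx'
  exact ⟨O, hx', h⟩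

/-- The complement of the surface in a flat chart. -/
def flatChartMap {e : ℂ × ℂ → X} (he : IsOpenEmbedding e) (h : e ⁻¹' Q = {p | p.2 = 0}) :
    C(ℂ × CStar, ↥Qᶜ) where
  toFun p := ⟨e (p.1, p.2), fun hp => p.2.2 (by
    change ((p.1, (p.2 : ℂ)) : ℂ × ℂ) ∈ e ⁻¹' Q at hp
    rw [h] at hp
    exact hp)⟩
  continuous_toFun := Continuous.subtype_mk (he.continuous.comp (by fun_prop)) _

theorem isEmbedding_flatChartMap {e : ℂ × ℂ → X} (he : IsOpenEmbedding e)
    (h : e ⁻¹' Q = {p | p.2 = 0}) : IsEmbedding (flatChartMap he h) :=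
  IsEmbedding.of_comp (flatChartMap he h).continuous continuous_subtype_val
    (he.isEmbedding.comp (IsEmbedding.id.prodMap IsEmbedding.subtypeVal))

theorem exists_flatChartMap_eq {e : ℂ × ℂ → X} (he : IsOpenEmbedding e)
    (h : e ⁻¹' Q = {p | p.2 = 0}) (y : ↥Qᶜ) (hy : (y : X) ∈ Set.range e) :
    ∃ z, flatChartMap he h z = y := by
  obtain ⟨v, hv⟩ := hy
  refine ⟨(v.1, ⟨v.2, fun hv' => y.2 ?_⟩), Subtype.ext hv⟩
  rw [← hv]
  change v ∈ e ⁻¹' Q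
  rw [h]
  exact hv'

/-- If the holonomy is trivial around one point of the surface in a flat chart, then it is trivial
on all loops in the chart, as these can be moved close to the given point. -/
theorem TrivialNear.isTrivial_comap {ρ : Holonomy ↥Qᶜ A} {e : ℂ × ℂ → X}
    (he : IsOpenEmbedding e) (h : e ⁻¹' Q = {p | p.2 = 0}) {a : ℂ}
    (ha : TrivialNear ρ (e (a, 0))) : (ρ.comap (flatChartMap he h)).IsTrivial := by
  obtain ⟨O, hO, hρ⟩ := ha
  obtain ⟨δ, hδ, hball⟩ := Metric.mem_nhds_iff.1 (he.continuous.continuousAt.preimage_mem_nhds hO)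
  have hpos : ∀ (t : ℝ) (w : CStar), 0 ≤ t → t ≤ 1 →
      (((1 - t) + t * (δ / (2 * ‖(w : ℂ)‖)) : ℝ) : ℂ) ≠ 0 := fun t w h0 h1 => by
    have hw : 0 < ‖(w : ℂ)‖ := norm_pos_iff.2 w.2
    have h2 : 0 < δ / (2 * ‖(w : ℂ)‖) := by positivity
    rw [Complex.ofReal_ne_zero]
    rcases h0.eq_or_lt with rfl | h0
    · norm_num
    · have := mul_pos h0 h2; linarith
  let k : C(I × (ℂ × CStar), ℂ × CStar) :=
    ⟨fun q => ((1 - (q.1 : ℝ)) * q.2.1 + (q.1 : ℝ) * a,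
      ⟨(((1 - q.1) + q.1 * (δ / (2 * ‖(q.2.2 : ℂ)‖)) : ℝ) : ℂ) * q.2.2,
        mul_ne_zero (hpos _ _ q.1.2.1 q.1.2.2) q.2.2.2⟩), by
      refine Continuous.prodMk (by fun_prop) (Continuous.subtype_mk (Continuous.mul
        (Complex.continuous_ofReal.comp (Continuous.add (by fun_prop) (Continuous.mul
          (by fun_prop) (Continuous.div (by fun_prop) (by fun_prop) fun q => ?_))))
            (by fun_prop)) _)
      simpa using q.2.2.2⟩
  let g : C(ℂ × CStar, ↥Qᶜ) := (flatChartMap he h).comp ⟨fun q => k (1, q), by fun_prop⟩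
  refine Holonomy.isTrivial_comap_of_homotopic (g := g)
    ⟨⟨(flatChartMap he h).comp k, fun q => ?_, fun q => ?_⟩⟩ ?_
  · simp [k]
  · simp [g]
  · intro y p
    refine hρ _ _ fun t => hball ?_
    have hw : 0 < ‖((p t).2 : ℂ)‖ := norm_pos_iff.2 (p t).2.2
    change (_, _) ∈ Metric.ball _ _
    rw [Metric.mem_ball, Prod.dist_eq]
    refine max_lt ?_ ?_
    · simp [k, hδ]
    · simp only [k, ContinuousMap.coe_mk, dist_zero_right, norm_mul]
      simp only [Set.Icc.coe_one, sub_self, zero_add, one_mul, Complex.norm_real, norm_div,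
        Real.norm_eq_abs, abs_of_pos hδ, abs_mul, abs_two, abs_norm]
      rw [div_mul_eq_mul_div, div_lt_iff₀ (by positivity)]
      nlinarith [mul_pos hδ hw]

theorem TrivialNear.of_chart {ρ : Holonomy ↥Qᶜ A} {e : ℂ × ℂ → X}
    (he : IsOpenEmbedding e) (h : e ⁻¹' Q = {p | p.2 = 0}) {a : ℂ}
    (ha : TrivialNear ρ (e (a, 0))) (v : ℂ × ℂ) : TrivialNear ρ (e v) :=
  ⟨Set.range e, he.isOpen_range.mem_nhds ⟨v, rfl⟩, fun _ p hp =>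
    (ha.isTrivial_comap he h).val_eq_one_of_range (isEmbedding_flatChartMap he h) p
      fun t => exists_flatChartMap_eq he h _ (hp t)⟩

/-- Away from the other surface, a surface has arbitrarily small flat charts. -/
theorem exists_flatChart (hQ : Q = S ∪ T) (hT : IsClosed T) {e : ℂ × ℂ → X}
    (he : IsOpenEmbedding e) (h : e ⁻¹' S = {p | p.2 = 0}) {a : ℂ} (ha : e (a, 0) ∉ T)
    {O : Set X} (hO : O ∈ 𝓝 (e (a, 0))) :
    ∃ e' : ℂ × ℂ → X, IsOpenEmbedding e' ∧ e' 0 = e (a, 0) ∧ e' ⁻¹' Q = {p | p.2 = 0} ∧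
      (∀ v, e' v ∈ O) ∧ ∃ r : ℂ × ℂ → ℝ, (∀ v, 0 < r v) ∧ ∀ v, e' v = e ((a, 0) + r v • v) := by
  obtain ⟨r, hr, hre, hrO⟩ := exists_shrink he (a, 0)
    (Filter.inter_mem hO (hT.isOpen_compl.mem_nhds ha))
  refine ⟨_, hre, by simp, ?_, fun v => (hrO v).1, r, hr, fun v => rfl⟩
  ext v
  have h1 : e ((a, 0) + r v • v) ∈ S ↔ v.2 = 0 := by
    change _ ∈ e ⁻¹' S ↔ _
    rw [h]
    simp [(hr v).ne']
  simp only [hQ, Set.mem_preimage, Set.mem_union, h1, Set.mem_ofPred_eq, or_iff_left (hrO v).2]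

theorem isPreconnected_chart_diff (hfin : (S ∩ T).Finite) {e : ℂ × ℂ → X}
    (he : IsOpenEmbedding e) (h : e ⁻¹' S = {p | p.2 = 0}) :
    {b : ℂ | e (b, 0) ∈ T}.Finite ∧ IsPreconnected {b : ℂ | e (b, 0) ∈ T}ᶜ := by
  have hf : {b : ℂ | e (b, 0) ∈ T}.Finite := by
    refine (hfin.preimage (f := fun b : ℂ => e (b, 0)) ?_).subset fun b hb => ⟨?_, hb⟩
    · exact fun b _ b' _ hb => congrArg Prod.fst (he.injective hb)
    · change ((b, 0) : ℂ × ℂ) ∈ e ⁻¹' S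
      rw [h]; rfl
  exact ⟨hf, (hf.countable.isPathConnected_compl_of_one_lt_rank
    (by simp)).isConnected.isPreconnected⟩

/-- Along the part of a flat chart of `S` outside of `T`, the triviality of the holonomy around
one point implies that around all points. -/
theorem trivialNear_iff_of_chart (hQ : Q = S ∪ T) (hT : IsClosed T) (hfin : (S ∩ T).Finite)
    (ρ : Holonomy ↥Qᶜ A) {e : ℂ × ℂ → X} (he : IsOpenEmbedding e)
    (h : e ⁻¹' S = {p | p.2 = 0}) {a b : ℂ} (ha : e (a, 0) ∉ T) (hb : e (b, 0) ∉ T)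
    (hρ : TrivialNear ρ (e (a, 0))) : TrivialNear ρ (e (b, 0)) := by
  by_contra hb'
  have hc : Continuous fun b : ℂ => e (b, 0) := he.continuous.comp (by fun_prop)
  let V₁ : Set ℂ := {b | TrivialNear ρ (e (b, 0))}
  let V₂ : Set ℂ := {b | e (b, 0) ∉ T ∧ ¬ TrivialNear ρ (e (b, 0))}
  have h₁ : IsOpen V₁ := isOpen_iff_mem_nhds.2 fun b hb =>
    hc.continuousAt.eventually (TrivialNear.eventually hb)
  have h₂ : IsOpen V₂ := isOpen_iff_mem_nhds.2 fun b hb => by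
    obtain ⟨e', he', h0, hS', heT, r, hr, her⟩ := exists_flatChart hQ hT he h hb.1
      (hT.isOpen_compl.mem_nhds hb.1)
    filter_upwards [hc.continuousAt.preimage_mem_nhds (he'.isOpen_range.mem_nhds ⟨0, h0⟩)]
      with b' hb'
    obtain ⟨v, hv⟩ := hb'
    have hv2 : v.2 = 0 := by
      have : e' v ∈ Q := by
        rw [hQ, hv]; left
        change ((b', 0) : ℂ × ℂ) ∈ e ⁻¹' S
        rw [h]; rfl
      change v ∈ e' ⁻¹' Q at this
      rwa [hS'] at this
    refine ⟨fun hb'' => heT v (hv ▸ hb''), fun ht => hb.2 ?_⟩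
    have hv' : v = (v.1, 0) := Prod.ext rfl hv2
    simp only at hv
    rw [← hv, hv'] at ht
    rw [← h0]
    exact ht.of_chart he' hS' 0
  obtain ⟨b', -, h1, h2⟩ := (isPreconnected_chart_diff hfin he h).2 V₁ V₂ h₁ h₂
    (fun b hb => (em (TrivialNear ρ (e (b, 0)))).imp id fun h => ⟨hb, h⟩) ⟨a, ha, hρ⟩
    ⟨b, hb, hb, hb'⟩
  exact h2.2 h1

/-- All meridians of a connected surface `S` are alike: if the holonomy is trivial around the
points near one point of `S`, it is trivial around all points of `S` outside of `T`. -/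
theorem trivialNear_of_surface (hQ : Q = S ∪ T) (hS : IsEmbeddedSurface S) (hT : IsClosed T)
    (hfin : (S ∩ T).Finite) (ρ : Holonomy ↥Qᶜ A) {x₀ : X} (hx₀ : x₀ ∈ S)
    (h₀ : TrivialNear ρ x₀) {x : X} (hx : x ∈ S) (hxT : x ∉ T) : TrivialNear ρ x := by
  let V₁ : Set X := {x | ∀ᶠ x' in 𝓝 x, x' ∈ S → x' ∉ T → TrivialNear ρ x'}
  let V₂ : Set X := {x | ∀ᶠ x' in 𝓝 x, x' ∈ S → x' ∉ T → ¬ TrivialNear ρ x'}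
  have o₁ : IsOpen V₁ := isOpen_iff_mem_nhds.2 fun x hx => eventually_eventually_nhds.2 hx
  have o₂ : IsOpen V₂ := isOpen_iff_mem_nhds.2 fun x hx => eventually_eventually_nhds.2 hx
  have chart : ∀ x ∈ S, ∃ e : ℂ × ℂ → X, IsOpenEmbedding e ∧ e (0, 0) = x ∧
      e ⁻¹' S = {p | p.2 = 0} := hS.locally_flat
  have hcov : S ⊆ V₁ ∪ V₂ := by
    intro x hx
    obtain ⟨e, he, h0, heS⟩ := chart x hx
    have hnear : ∀ᶠ x' in 𝓝 x, x' ∈ Set.range e := he.isOpen_range.mem_nhds ⟨_, h0⟩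
    have hcoord : ∀ x' ∈ Set.range e, x' ∈ S → ∃ b : ℂ, e (b, 0) = x' := by
      rintro _ ⟨v, rfl⟩ hv
      change v ∈ e ⁻¹' S at hv
      rw [heS] at hv
      exact ⟨v.1, congrArg e (Prod.ext rfl hv.symm)⟩
    by_cases hex : ∃ a : ℂ, e (a, 0) ∉ T ∧ TrivialNear ρ (e (a, 0))
    · obtain ⟨a, haT, ha⟩ := hex
      left
      filter_upwards [hnear] with x' hx' hS' hT'
      obtain ⟨b, rfl⟩ := hcoord x' hx' hS'
      exact trivialNear_iff_of_chart hQ hT hfin ρ he heS haT hT' ha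
    · push Not at hex
      right
      filter_upwards [hnear] with x' hx' hS' hT'
      obtain ⟨b, rfl⟩ := hcoord x' hx' hS'
      exact hex b hT'
  by_contra hneg
  have hx₁ : x₀ ∈ V₁ := h₀.eventually.mono fun _ h _ _ => h
  have hx₂ : x ∈ V₂ := (hcov hx).resolve_left fun h => hneg (h.self_of_nhds hx hxT)
  obtain ⟨y, hyS, hy₁, hy₂⟩ := hS.isConnected.isPreconnected V₁ V₂ o₁ o₂ hcov ⟨x₀, hx₀, hx₁⟩
    ⟨x, hx, hx₂⟩
  obtain ⟨e, he, h0, heS⟩ := chart y hyS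
  have hc : Continuous fun b : ℂ => e (b, 0) := he.continuous.comp (by fun_prop)
  have hf := (isPreconnected_chart_diff hfin he heS).1
  have hev : ∀ᶠ b in 𝓝[≠] (0 : ℂ), e (b, 0) ∉ T := by
    have h' := ((hf.subset (Set.sdiff_subset (t := {0}))).isClosed.isOpen_compl).mem_nhds
      (show (0 : ℂ) ∈ ({b : ℂ | e (b, 0) ∈ T} \ {0})ᶜ from fun h => h.2 rfl)
    filter_upwards [mem_nhdsWithin_of_mem_nhds h', self_mem_nhdsWithin] with b hb hb0 hbT
    exact hb ⟨hbT, hb0⟩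
  have h12 : ∀ᶠ b in 𝓝[≠] (0 : ℂ), (e (b, 0) ∈ S → e (b, 0) ∉ T → TrivialNear ρ (e (b, 0))) ∧
      (e (b, 0) ∈ S → e (b, 0) ∉ T → ¬ TrivialNear ρ (e (b, 0))) := by
    have hc0 : Filter.Tendsto (fun b : ℂ => e (b, 0)) (𝓝[≠] 0) (𝓝 y) := by
      rw [← h0]
      exact hc.continuousAt.tendsto.mono_left nhdsWithin_le_nhds
    exact (hc0.eventually hy₁).and (hc0.eventually hy₂)
  obtain ⟨b, hb, hb₁, hb₂⟩ := (hev.and h12).exists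
  have hbS : e (b, 0) ∈ S := by
    change ((b, 0) : ℂ × ℂ) ∈ e ⁻¹' S
    rw [heS]; rfl
  exact hb₂ hbS hb (hb₁ hbS hb)

end Surfaces

end

section

/-! ### Holonomies on the complement of a configuration -/

variable {X : Type*} [TopologicalSpace X] {S₁ S₂ : Set X}

theorem IsConfiguration.isClosed [T2Space X] (hS : IsConfiguration S₁ S₂) :
    IsClosed S₁ ∧ IsClosed S₂ :=
  ⟨hS.left.isCompact.isClosed, hS.right.isCompact.isClosed⟩

theorem IsConfiguration.exists_flatChart [T2Space X] (hS : IsConfiguration S₁ S₂) {x : X}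
    (hx : x ∈ S₁ ∪ S₂) (hxF : x ∉ S₁ ∩ S₂) {O : Set X} (hO : O ∈ 𝓝 x) :
    ∃ e : ℂ × ℂ → X, IsOpenEmbedding e ∧ e 0 = x ∧ e ⁻¹' (S₁ ∪ S₂) = {p | p.2 = 0} ∧
      ∀ v, e v ∈ O := by
  rcases hx with hx | hx
  · obtain ⟨e, he, rfl, h⟩ := hS.left.locally_flat x hx
    obtain ⟨e', he', h0, hS', hO', -⟩ := DoublePointSurgery.exists_flatChart rfl hS.isClosed.2 he h
      (fun h => hxF ⟨hx, h⟩) hO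
    exact ⟨e', he', h0, hS', hO'⟩
  · obtain ⟨e, he, rfl, h⟩ := hS.right.locally_flat x hx
    obtain ⟨e', he', h0, hS', hO', -⟩ := DoublePointSurgery.exists_flatChart
      (Set.union_comm S₁ S₂) hS.isClosed.1 he h (fun h => hxF ⟨h, hx⟩) hO
    exact ⟨e', he', h0, hS', hO'⟩

/-- The inclusion of the complement of the configuration in the complement of its
singularities. -/
def complInclusion (S₁ S₂ : Set X) : C(↥(S₁ ∪ S₂)ᶜ, ↥(S₁ ∩ S₂)ᶜ) where
  toFun y := ⟨y, fun h => y.2 (Or.inl h.1)⟩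

theorem IsConfiguration.locallyNonseparating [T2Space X]
    [ChartedSpace (EuclideanSpace ℝ (Fin 4)) X] (hS : IsConfiguration S₁ S₂) :
    LocallyNonseparating (complInclusion S₁ S₂) := by
  rintro ⟨x, hxF⟩ O hO
  have hFo : IsOpen (S₁ ∩ S₂)ᶜ := (hS.isClosed.1.inter hS.isClosed.2).isOpen_compl
  have hO' : Subtype.val '' O ∈ 𝓝 x := hFo.isOpenEmbedding_subtypeVal.image_mem_nhds.2 hO
  have himg : ∀ {v : X}, v ∈ Subtype.val '' O → ∀ h : v ∈ (S₁ ∩ S₂)ᶜ, (⟨v, h⟩ : ↥(S₁ ∩ S₂)ᶜ) ∈ O := by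
    rintro _ ⟨v, hv, rfl⟩ h; exact hv
  by_cases hx : x ∈ S₁ ∪ S₂
  · obtain ⟨e, he, h0, hS', heO⟩ := hS.exists_flatChart hx hxF hO'
    refine ⟨Subtype.val ⁻¹' Set.range e, ?_, he.isOpen_range.preimage continuous_subtype_val,
      ⟨0, h0⟩, ?_⟩
    · rintro ⟨y, hy⟩ ⟨v, rfl⟩; exact himg (heO v) hy
    · refine isPathConnected_preimage_range _ (flatChartMap he hS') ?_ ?_
      · exact fun z => ⟨_, rfl⟩
      · exact fun y hy => exists_flatChartMap_eq he hS' y hy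
  · obtain ⟨e, he, h0, heO⟩ := exists_chart x (Filter.inter_mem hO'
      ((hS.isClosed.1.union hS.isClosed.2).isOpen_compl.mem_nhds hx))
    refine ⟨Subtype.val ⁻¹' Set.range e, ?_, he.isOpen_range.preimage continuous_subtype_val,
      ⟨0, h0⟩, ?_⟩
    · rintro ⟨y, hy⟩ ⟨v, rfl⟩; exact himg (heO v).1 hy
    · refine isPathConnected_preimage_range _ (⟨fun v => ⟨e v, (heO v).2⟩,
        Continuous.subtype_mk he.continuous _⟩ : C(ℂ × ℂ, ↥(S₁ ∪ S₂)ᶜ)) ?_ ?_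
      · exact fun z => ⟨_, rfl⟩
      · rintro ⟨y, hy⟩ ⟨v, rfl⟩; exact ⟨v, rfl⟩

theorem IsConfiguration.pathConnectedSpace [T2Space X]
    [ChartedSpace (EuclideanSpace ℝ (Fin 4)) X] [SimplyConnectedSpace X]
    (hS : IsConfiguration S₁ S₂) : PathConnectedSpace ↥(S₁ ∪ S₂)ᶜ :=
  have := simplyConnectedSpace_compl_finite hS.finite_inter
  hS.locallyNonseparating.pathConnectedSpace

namespace DoublePointChart

variable (c : DoublePointChart S₁ S₂)

/-- The complement of the coordinate axes in the chart at the double point. -/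
def quadrantMap : C(CStar × CStar, ↥(S₁ ∪ S₂)ᶜ) where
  toFun q := ⟨c.toFun (q.1, q.2), c.apply_mem_compl q.1.2 q.2.2⟩
  continuous_toFun := Continuous.subtype_mk (c.isOpenEmbedding.continuous.comp (by fun_prop)) _

theorem isEmbedding_quadrantMap : IsEmbedding c.quadrantMap :=
  IsEmbedding.of_comp c.quadrantMap.continuous continuous_subtype_val
    (c.isOpenEmbedding.isEmbedding.comp (IsEmbedding.subtypeVal.prodMap IsEmbedding.subtypeVal))

theorem exists_quadrantMap_eq (y : ↥(S₁ ∪ S₂)ᶜ) (hy : (y : X) ∈ Set.range c.toFun) :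
    ∃ z, c.quadrantMap z = y := by
  obtain ⟨⟨z, w⟩, hv⟩ := hy
  refine ⟨(⟨z, fun hz => y.2 ?_⟩, ⟨w, fun hw => y.2 ?_⟩), Subtype.ext hv⟩
  · rw [← hv]; right
    change (z, w) ∈ c.toFun ⁻¹' S₂
    rw [c.preimage_right]; exact hz
  · rw [← hv]; left
    change (z, w) ∈ c.toFun ⁻¹' S₁
    rw [c.preimage_left]; exact hw

/-- The double point torus as a continuous map. -/
noncomputable def torusMap : C(Circle × Circle, ↥(S₁ ∪ S₂)ᶜ) := ⟨c.torus, c.continuous_torus⟩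

/-- The radial homotopy from `z` to `r z / |z|` in the punctured plane. -/
theorem exists_radial_homotopy (r : ℝ) (hr : 0 < r) : ∃ k : C(I × CStar, CStar),
    (∀ z, k (0, z) = z) ∧ ∀ z, (k (1, z) : ℂ) = r * z.unitPart := by
  have hpos : ∀ (t : ℝ) (w : CStar), 0 ≤ t → t ≤ 1 →
      (((1 - t) + t * (r / ‖(w : ℂ)‖) : ℝ) : ℂ) ≠ 0 := fun t w h0 h1 => by
    have hw : 0 < ‖(w : ℂ)‖ := norm_pos_iff.2 w.2
    have h2 : 0 < r / ‖(w : ℂ)‖ := by positivity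
    rw [Complex.ofReal_ne_zero]
    rcases h0.eq_or_lt with rfl | h0
    · norm_num
    · have := mul_pos h0 h2; linarith
  refine ⟨⟨fun q => ⟨(((1 - q.1) + q.1 * (r / ‖(q.2 : ℂ)‖) : ℝ) : ℂ) * q.2,
        mul_ne_zero (hpos _ _ q.1.2.1 q.1.2.2) q.2.2⟩, ?_⟩, ?_, ?_⟩
  · refine Continuous.subtype_mk (Continuous.mul
        (Complex.continuous_ofReal.comp (Continuous.add (by fun_prop) (Continuous.mul
          (by fun_prop) (Continuous.div (by fun_prop) (by fun_prop) fun q => ?_))))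
            (by fun_prop)) _
    simpa using q.2.2
  · intro z; simp
  · intro z
    simp [CStar.coe_unitPart]
    ring

theorem isTrivial_comap_quadrantMap {A : Type*} [_root_.Group A] {ρ : Holonomy ↥(S₁ ∪ S₂)ᶜ A}
    (h : (ρ.comap c.torusMap).IsTrivial) : (ρ.comap c.quadrantMap).IsTrivial := by
  obtain ⟨k, hk0, hk1⟩ := exists_radial_homotopy (1 / 2) (by norm_num)
  let u : C(CStar × CStar, Circle × Circle) := ⟨fun q => (q.2.unitPart, q.1.unitPart),
    (CStar.continuous_unitPart.comp continuous_snd).prodMk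
      (CStar.continuous_unitPart.comp continuous_fst)⟩
  refine Holonomy.isTrivial_comap_of_homotopic (g := c.torusMap.comp u)
    ⟨⟨c.quadrantMap.comp ⟨fun q => (k (q.1, q.2.1), k (q.1, q.2.2)), by fun_prop⟩,
      fun q => ?_, fun q => ?_⟩⟩ (Holonomy.isTrivial_comap_of_eq_comp u (fun _ => rfl) h)
  · simp [hk0]
  · refine Subtype.ext ?_
    simp [quadrantMap, hk1, torusMap, torus, u]

variable [T2Space X] [ChartedSpace (EuclideanSpace ℝ (Fin 4)) X] [SimplyConnectedSpace X]

/-- A holonomy on the complement of the configuration that is trivial on the double point torus is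
trivial: it is trivial around the double point, hence around all points of the two surfaces,
as these are connected, and so extends over the surfaces. -/
theorem isTrivial_of_torus (hS : IsConfiguration S₁ S₂) {A : Type*} [_root_.Group A]
    {ρ : Holonomy ↥(S₁ ∪ S₂)ᶜ A} (h : (ρ.comap c.torusMap).IsTrivial) : ρ.IsTrivial := by
  have := simplyConnectedSpace_compl_finite hS.finite_inter
  have hF : IsOpen (S₁ ∩ S₂)ᶜ := (hS.isClosed.1.inter hS.isClosed.2).isOpen_compl
  have : LocallyPathConnectedSpace X := ChartedSpace.locallyPathConnectedSpace
    (EuclideanSpace ℝ (Fin 4)) X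
  have : LocallyPathConnectedSpace ↥(S₁ ∩ S₂)ᶜ := hF.locallyPathConnectedSpace
  have h0 : TrivialNear ρ (c.toFun (0, 0)) :=
    ⟨Set.range c.toFun, c.isOpenEmbedding.isOpen_range.mem_nhds ⟨_, rfl⟩, fun y p hp =>
      (c.isTrivial_comap_quadrantMap h).val_eq_one_of_range c.isEmbedding_quadrantMap p
        fun t => c.exists_quadrantMap_eq _ (hp t)⟩
  have hc₁ : c.toFun (0, 0) ∈ S₁ := by
    change ((0, 0) : ℂ × ℂ) ∈ c.toFun ⁻¹' S₁
    rw [c.preimage_left]; rfl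
  have hc₂ : c.toFun (0, 0) ∈ S₂ := by
    change ((0, 0) : ℂ × ℂ) ∈ c.toFun ⁻¹' S₂
    rw [c.preimage_right]; rfl
  refine ρ.isTrivial_of_locally (complInclusion S₁ S₂) hS.locallyNonseparating ?_
  rintro ⟨x, hxF⟩
  have key : TrivialNear ρ x := by
    by_cases hx : x ∈ S₁ ∪ S₂
    · rcases hx with hx | hx
      · exact trivialNear_of_surface rfl hS.left hS.isClosed.2 hS.finite_inter ρ hc₁ h0 hx
          fun h => hxF ⟨hx, h⟩
      · exact trivialNear_of_surface (Set.union_comm _ _) hS.right hS.isClosed.1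
          (Set.inter_comm S₁ S₂ ▸ hS.finite_inter) ρ hc₂ h0 hx fun h => hxF ⟨h, hx⟩
    · obtain ⟨e, he, h0, heO⟩ := exists_chart x
        ((hS.isClosed.1.union hS.isClosed.2).isOpen_compl.mem_nhds hx)
      let f : C(ℂ × ℂ, ↥(S₁ ∪ S₂)ᶜ) := ⟨fun v => ⟨e v, heO v⟩,
        Continuous.subtype_mk he.continuous _⟩
      refine ⟨Set.range e, he.isOpen_range.mem_nhds ⟨0, h0⟩, fun y p hp => ?_⟩
      refine ((ρ.comap f).isTrivial_of_simplyConnected).val_eq_one_of_range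
        (IsEmbedding.of_comp f.continuous continuous_subtype_val he.isEmbedding) p fun t => ?_
      obtain ⟨v, hv⟩ := hp t
      exact ⟨v, Subtype.ext hv⟩
  obtain ⟨O, hO, hρ⟩ := key
  exact ⟨_, continuous_subtype_val.continuousAt.preimage_mem_nhds hO, fun y p hp => hρ y p hp⟩

end DoublePointChart

end

section

/-! ### Pushing the complement out of the ball -/

open Classical in
/-- The extension by the identity of a family `k` of maps, defined in the image of the open embedding
`e`. -/
noncomputable def extendById {P Q Y : Type*} (e : Q → Y) (k : P × Q → Q) (a : P × Y) : Y :=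
  if h : ∃ q, e q = a.2 then e (k (a.1, h.choose)) else a.2

theorem extendById_apply {P Q Y : Type*} {e : Q → Y} (he : Function.Injective e) (k : P × Q → Q)
    (t : P) (q : Q) : extendById e k (t, e q) = e (k (t, q)) := by
  have h : ∃ q', e q' = e q := ⟨q, rfl⟩
  have hq : h.choose = q := he h.choose_spec
  simp only [extendById]
  rw [dif_pos h, hq]

theorem extendById_of_notMem {P Q Y : Type*} {e : Q → Y} (k : P × Q → Q)
    (t : P) {y : Y} (hy : ¬ ∃ q, e q = y) : extendById e k (t, y) = y := dif_neg hy

theorem continuous_extendById {P Q Y : Type*} [TopologicalSpace P] [TopologicalSpace Q]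
    [TopologicalSpace Y] {e : Q → Y} (he : IsOpenEmbedding e) {k : P × Q → Q} (hk : Continuous k)
    {C : Set Y} (hC : IsClosed C) (hCe : C ⊆ Set.range e)
    (hkC : ∀ t q, e q ∉ C → k (t, q) = q) : Continuous (extendById e k) := by
  refine continuous_iff_continuousAt.2 fun a => ?_
  obtain ⟨t, y⟩ := a
  by_cases hy : y ∈ Set.range e
  · obtain ⟨q, rfl⟩ := hy
    have he' : IsOpenEmbedding (Prod.map id e : P × Q → P × Y) := IsOpenEmbedding.id.prodMap he
    refine (he'.continuousAt_iff (x := (t, q))).1 ?_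
    have : extendById e k ∘ Prod.map id e = e ∘ k := by
      ext a
      exact extendById_apply he.injective k _ _
    rw [this]
    exact (he.continuous.comp hk).continuousAt
  · have hy' : (t, y) ∈ Prod.snd ⁻¹' Cᶜ := fun h => hy (hCe h)
    refine continuousAt_snd.congr ?_
    filter_upwards [(hC.isOpen_compl.preimage continuous_snd).mem_nhds hy'] with b hb
    obtain ⟨s, z⟩ := b
    by_cases hz : ∃ q, e q = z
    · obtain ⟨q, rfl⟩ := hz
      rw [extendById_apply he.injective, hkC s q hb]
    · rw [extendById_of_notMem k s hz]

namespace DoublePointChart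

/-- The squared Euclidean norm on `ℂ²`, off the axes. -/
noncomputable def normSq (q : CStar × CStar) : ℝ := ‖(q.1 : ℂ)‖ ^ 2 + ‖(q.2 : ℂ)‖ ^ 2

theorem normSq_pos (q : CStar × CStar) : 0 < normSq q := by
  have := norm_pos_iff.2 q.1.2
  unfold normSq
  positivity

theorem continuous_normSq : Continuous normSq := by unfold normSq; fun_prop

/-- The multiplication of a point of `ℂ²` off the axes by a positive number. -/
noncomputable def scale (r : {r : ℝ // 0 < r}) (q : CStar × CStar) : CStar × CStar :=
  (⟨(r : ℝ) * q.1, mul_ne_zero (Complex.ofReal_ne_zero.2 r.2.ne') q.1.2⟩,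
    ⟨(r : ℝ) * q.2, mul_ne_zero (Complex.ofReal_ne_zero.2 r.2.ne') q.2.2⟩)

theorem continuous_scale : Continuous fun a : {r : ℝ // 0 < r} × (CStar × CStar) =>
    scale a.1 a.2 := by
  unfold scale
  fun_prop

theorem normSq_scale (r : {r : ℝ // 0 < r}) (q : CStar × CStar) :
    normSq (scale r q) = (r : ℝ) ^ 2 * normSq q := by
  simp only [normSq, scale, norm_mul, Complex.norm_real, Real.norm_eq_abs, mul_pow, sq_abs]
  ring

/-- The factor `(1 - t) + t max (1, 1 / |q|)` of the radial push. -/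
noncomputable def pushFactor (t : I) (q : CStar × CStar) : {r : ℝ // 0 < r} :=
  ⟨(1 - t) + t * max 1 (√(normSq q))⁻¹, by
    have h1 : (t : ℝ) * 1 ≤ t * max 1 (√(normSq q))⁻¹ :=
      mul_le_mul_of_nonneg_left (le_max_left _ _) t.2.1
    linarith⟩

theorem one_le_pushFactor (t : I) (q : CStar × CStar) : (1 : ℝ) ≤ pushFactor t q := by
  have h1 : (t : ℝ) * 1 ≤ t * max 1 (√(normSq q))⁻¹ :=
    mul_le_mul_of_nonneg_left (le_max_left _ _) t.2.1
  change (1 : ℝ) ≤ (1 - t) + t * max 1 (√(normSq q))⁻¹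
  linarith

theorem pushFactor_of_one_le (t : I) {q : CStar × CStar} (h : 1 ≤ normSq q) :
    (pushFactor t q : ℝ) = 1 := by
  have : (√(normSq q))⁻¹ ≤ 1 := inv_le_one_of_one_le₀ (by rwa [Real.one_le_sqrt])
  change (1 - t) + t * max 1 (√(normSq q))⁻¹ = (1 : ℝ)
  rw [max_eq_left this]
  ring

theorem scale_eq_self {r : {r : ℝ // 0 < r}} (hr : (r : ℝ) = 1) (q : CStar × CStar) :
    scale r q = q := by
  refine Prod.ext (Subtype.ext ?_) (Subtype.ext ?_) <;> simp [scale, hr]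

/-- The radial push of `ℂ²` out of the unit ball, off the axes. -/
noncomputable def pushOut (a : I × (CStar × CStar)) : CStar × CStar :=
  scale (pushFactor a.1 a.2) a.2

theorem continuous_pushOut : Continuous pushOut := by
  refine continuous_scale.comp (Continuous.prodMk (Continuous.subtype_mk ?_ _) continuous_snd)
  refine Continuous.add (by fun_prop) (Continuous.mul (by fun_prop)
    (continuous_const.max (Continuous.inv₀ ?_ fun a => ?_)))
  · exact Real.continuous_sqrt.comp (continuous_normSq.comp continuous_snd)
  · exact (Real.sqrt_pos.2 (normSq_pos _)).ne'

theorem pushOut_of_one_le (t : I) {q : CStar × CStar} (h : 1 ≤ normSq q) : pushOut (t, q) = q :=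
  scale_eq_self (pushFactor_of_one_le t h) q

theorem pushOut_zero (q : CStar × CStar) : pushOut (0, q) = q :=
  scale_eq_self (by change (1 - 0) + 0 * max 1 (√(normSq q))⁻¹ = (1 : ℝ); ring) q

theorem normSq_le_normSq_pushOut (t : I) (q : CStar × CStar) :
    normSq q ≤ normSq (pushOut (t, q)) := by
  unfold pushOut
  rw [normSq_scale]
  have h := one_le_pushFactor t q
  have := normSq_pos q
  nlinarith [mul_self_nonneg ((pushFactor t q : ℝ) - 1)]

theorem normSq_pushOut_one_of_le {q : CStar × CStar} (h : normSq q ≤ 1) :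
    normSq (pushOut (1, q)) = 1 := by
  unfold pushOut
  have h0 := Real.sqrt_pos.2 (normSq_pos q)
  have : 1 ≤ (√(normSq q))⁻¹ := (one_le_inv₀ h0).2 (Real.sqrt_le_one.2 h)
  rw [normSq_scale]
  change ((1 - 1) + 1 * max 1 (√(normSq q))⁻¹ : ℝ) ^ 2 * normSq q = 1
  rw [max_eq_right this, sub_self, zero_add, one_mul, inv_pow, Real.sq_sqrt (normSq_pos q).le,
    inv_mul_cancel₀ (normSq_pos q).ne']

variable {X : Type*} [TopologicalSpace X] {S₁ S₂ : Set X} (c : DoublePointChart S₁ S₂)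

theorem isOpenEmbedding_quadrantMap : IsOpenEmbedding c.quadrantMap := by
  refine ⟨c.isEmbedding_quadrantMap, ?_⟩
  have : Set.range c.quadrantMap = Subtype.val ⁻¹' Set.range c.toFun := by
    ext y
    exact ⟨by rintro ⟨q, rfl⟩; exact ⟨_, rfl⟩, fun h => c.exists_quadrantMap_eq y h⟩
  rw [this]
  exact c.isOpenEmbedding.isOpen_range.preimage continuous_subtype_val

theorem coe_quadrantMap_mem_ballExterior {q : CStar × CStar} :
    (c.quadrantMap q : X) ∈ c.ballExterior ↔ 1 ≤ normSq q := by
  constructor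
  · intro h
    by_contra! hq
    exact h.1 ⟨_, hq, rfl⟩
  · intro h
    refine ⟨?_, (c.quadrantMap q).2⟩
    rintro ⟨p, hp, hpq⟩
    have := c.isOpenEmbedding.injective hpq
    subst this
    exact absurd hp (not_lt.2 h)

variable [T2Space X]

theorem isClosed_closedBall {r : ℝ} (hr : r ≤ 1) :
    IsClosed (c.toFun '' {p | ‖p.1‖ ^ 2 + ‖p.2‖ ^ 2 ≤ r}) := by
  refine (IsCompact.image ?_ c.isOpenEmbedding.continuous).isClosed
  refine Metric.isCompact_of_isClosed_isBounded
    (isClosed_le (by fun_prop) continuous_const) ?_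
  refine (Metric.isBounded_closedBall (x := (0 : ℂ × ℂ)) (r := 1)).subset fun p hp => ?_
  rw [mem_closedBall_zero_iff, Prod.norm_def]
  have h : ‖p.1‖ ^ 2 + ‖p.2‖ ^ 2 ≤ 1 := le_trans hp hr
  refine max_le ?_ ?_ <;> nlinarith [sq_nonneg ‖p.1‖, sq_nonneg ‖p.2‖]

/-- The homotopy that pushes the complement of the configuration radially out of the unit ball. -/
noncomputable def pushHomotopy : C(I × ↥(S₁ ∪ S₂)ᶜ, ↥(S₁ ∪ S₂)ᶜ) where
  toFun := extendById c.quadrantMap pushOut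
  continuous_toFun := by
    refine continuous_extendById c.isOpenEmbedding_quadrantMap continuous_pushOut
      (C := Subtype.val ⁻¹' (c.toFun '' {p | ‖p.1‖ ^ 2 + ‖p.2‖ ^ 2 ≤ 1}))
      ((c.isClosed_closedBall le_rfl).preimage continuous_subtype_val) ?_ ?_
    · rintro y ⟨p, -, hp⟩
      exact c.exists_quadrantMap_eq y ⟨p, hp⟩
    · intro t q hq
      refine pushOut_of_one_le t (le_of_not_ge fun h => hq ?_)
      exact ⟨_, h, rfl⟩

theorem pushHomotopy_quadrantMap (t : I) (q : CStar × CStar) :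
    c.pushHomotopy (t, c.quadrantMap q) = c.quadrantMap (pushOut (t, q)) :=
  extendById_apply c.isEmbedding_quadrantMap.injective _ _ _

theorem pushHomotopy_of_notMem (t : I) {y : ↥(S₁ ∪ S₂)ᶜ} (hy : ¬ ∃ q, c.quadrantMap q = y) :
    c.pushHomotopy (t, y) = y := extendById_of_notMem _ _ hy

theorem pushHomotopy_zero (y : ↥(S₁ ∪ S₂)ᶜ) : c.pushHomotopy (0, y) = y := by
  by_cases hy : ∃ q, c.quadrantMap q = y
  · obtain ⟨q, rfl⟩ := hy
    rw [pushHomotopy_quadrantMap, pushOut_zero]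
  · exact c.pushHomotopy_of_notMem 0 hy

theorem pushHomotopy_of_mem (t : I) {y : ↥(S₁ ∪ S₂)ᶜ} (hy : (y : X) ∈ c.ballExterior) :
    c.pushHomotopy (t, y) = y := by
  by_cases hy' : ∃ q, c.quadrantMap q = y
  · obtain ⟨q, rfl⟩ := hy'
    rw [pushHomotopy_quadrantMap, pushOut_of_one_le t (c.coe_quadrantMap_mem_ballExterior.1 hy)]
  · exact c.pushHomotopy_of_notMem t hy'

theorem pushHomotopy_one_mem (y : ↥(S₁ ∪ S₂)ᶜ) : (c.pushHomotopy (1, y) : X) ∈ c.ballExterior := by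
  by_cases hy : ∃ q, c.quadrantMap q = y
  · obtain ⟨q, rfl⟩ := hy
    rw [pushHomotopy_quadrantMap, coe_quadrantMap_mem_ballExterior]
    rcases le_total 1 (normSq q) with h | h
    · exact h.trans (normSq_le_normSq_pushOut _ _)
    · exact (normSq_pushOut_one_of_le h).ge
  · rw [pushHomotopy_of_notMem c 1 hy]
    refine ⟨?_, y.2⟩
    rintro ⟨p, -, hp⟩
    exact hy (c.exists_quadrantMap_eq y ⟨p, hp⟩)

/-- The retraction of the complement of the configuration to the exterior of the ball. -/
noncomputable def retraction : C(↥(S₁ ∪ S₂)ᶜ, c.ballExterior) where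
  toFun y := ⟨c.pushHomotopy (1, y), c.pushHomotopy_one_mem y⟩
  continuous_toFun := by fun_prop

/-- The inclusion of the exterior of the ball in the complement of the configuration. -/
def exteriorInclusion : C(c.ballExterior, ↥(S₁ ∪ S₂)ᶜ) :=
  ⟨Set.inclusion fun _ h => h.2, continuous_inclusion _⟩

theorem retraction_exteriorInclusion (y : c.ballExterior) :
    c.retraction (c.exteriorInclusion y) = y := by
  have h := c.pushHomotopy_of_mem 1 (y := c.exteriorInclusion y) y.2
  exact Subtype.ext (congrArg (fun z : ↥(S₁ ∪ S₂)ᶜ => (z : X)) h)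

/-- The retraction is homotopic to the identity in the complement of the configuration. -/
noncomputable def retractionHomotopy : (ContinuousMap.id ↥(S₁ ∪ S₂)ᶜ).Homotopy
    (c.exteriorInclusion.comp c.retraction) where
  toContinuousMap := c.pushHomotopy
  map_zero_left := c.pushHomotopy_zero
  map_one_left _ := rfl

theorem mul_comm_of_joined {Y : Type*} [TopologicalSpace Y] {x y : Y} (p : Path x y)
    (h : ∀ a b : FundamentalGroup Y x, a * b = b * a) (a b : FundamentalGroup Y y) :
    a * b = b * a := by
  let e := FundamentalGroup.fundamentalGroupMulEquivOfPath p
  rw [← e.apply_symm_apply a, ← e.apply_symm_apply b, ← map_mul, h, map_mul]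

variable [ChartedSpace (EuclideanSpace ℝ (Fin 4)) X] [SimplyConnectedSpace X]

/-- The torus `{|z| = |z₀|, |w| = |w₀|}` through the point `(z₀, w₀)` of the thickened torus carries
the fundamental group of the complement of the configuration, if that is abelian. -/
theorem exists_loop_thickTorus (hS : IsConfiguration S₁ S₂)
    (hab : ∀ a b : c.Group, a * b = b * a) (x : c.thickTorus)
    (p : Path (c.exteriorInclusion (c.thickTorusInclusion x))
      (c.exteriorInclusion (c.thickTorusInclusion x))) :
    ∃ l : Path x x, ((l.map c.thickTorusInclusion.continuous).map
      c.exteriorInclusion.continuous).Homotopic p := by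
  have := hS.pathConnectedSpace
  set i := c.exteriorInclusion.comp c.thickTorusInclusion
  change Path (i x) (i x) at p
  have hcomm := mul_comm_of_joined (PathConnectedSpace.somePath c.basePoint (i x)) hab
  set R := (FundamentalGroup.map i x).range
  have hR : R.Normal := ⟨fun n hn g => by rwa [hcomm g n, mul_inv_cancel_right]⟩
  have key := Holonomy.eq_one_of_isTrivial (QuotientGroup.mk' R) (c.isTrivial_of_torus hS ?_)
  · have h := DFunLike.congr_fun key (FundamentalGroup.fromPath (Path.Homotopic.Quotient.mk p))
    rw [MonoidHom.one_apply, QuotientGroup.mk'_apply, QuotientGroup.eq_one_iff] at h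
    obtain ⟨g, hg⟩ := h
    induction g using Path.Homotopic.Quotient.ind with
    | mk l => exact ⟨l, Path.Homotopic.Quotient.exact hg⟩
  · obtain ⟨-, ⟨⟨z₀, w₀⟩, ⟨hN, hz, hw⟩, rfl⟩⟩ := x
    obtain ⟨γ⟩ : Nonempty (Path (((⟨1 / 2, by norm_num⟩, ⟨1 / 2, by norm_num⟩) : CStar × CStar))
      ((⟨z₀, hz⟩, ⟨w₀, hw⟩) : CStar × CStar)) := ⟨PathConnectedSpace.somePath _ _⟩
    let j : C(Circle × Circle, c.thickTorus) :=
      ⟨fun m => ⟨c.toFun (z₀ * (m.2 : ℂ), w₀ * (m.1 : ℂ)), _, ⟨by simpa [Circle.norm_coe] using hN,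
        by simpa using hz,
        by simpa using hw⟩, rfl⟩, Continuous.subtype_mk
          (c.isOpenEmbedding.continuous.comp (by fun_prop)) _⟩
    have hj : j (1, 1) = ⟨c.toFun (z₀, w₀), ⟨_, ⟨hN, hz, hw⟩, rfl⟩⟩ := Subtype.ext (by simp [j])
    refine Holonomy.isTrivial_comap_of_homotopic (g := i.comp j) ⟨⟨c.quadrantMap.comp
      ⟨fun q => (⟨(γ q.1).1 * q.2.2, mul_ne_zero (γ q.1).1.2 (by simp)⟩,
        ⟨(γ q.1).2 * q.2.1, mul_ne_zero (γ q.1).2.2 (by simp)⟩), by fun_prop⟩, fun m => ?_,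
        fun m => ?_⟩⟩ ?_
    · exact Subtype.ext (by simp [quadrantMap, torusMap, torus])
    · refine Subtype.ext ?_
      simp [quadrantMap, i, j, exteriorInclusion, thickTorusInclusion]
    · have hloop : ∀ l : Path ((1 : Circle), (1 : Circle)) (1, 1),
          (((Holonomy.tautological (basePath (i ⟨c.toFun (z₀, w₀), ⟨_, ⟨hN, hz, hw⟩, rfl⟩⟩))).mapHom
            (QuotientGroup.mk' R)).comap (i.comp j)).val l = 1 := fun l => by
        let l' : Path (⟨c.toFun (z₀, w₀), ⟨_, ⟨hN, hz, hw⟩, rfl⟩⟩ : c.thickTorus) _ :=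
          (l.map j.continuous).cast hj.symm hj.symm
        refine (congrArg (QuotientGroup.mk' R) (Holonomy.tautological_val_of_eq
          (l.map (i.comp j).continuous) (l'.map i.continuous) fun t => rfl)).trans ?_
        rw [QuotientGroup.mk'_apply, QuotientGroup.eq_one_iff]
        exact R.inv_mem ⟨FundamentalGroup.fromPath (Path.Homotopic.Quotient.mk l'), rfl⟩
      exact Holonomy.val_loop_eq_one_of_basePoint (1, 1) hloop

theorem surjective_map_thickTorusInclusion (hS : IsConfiguration S₁ S₂)
    (hab : ∀ a b : c.Group, a * b = b * a) (x : c.thickTorus) :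
    Function.Surjective (FundamentalGroup.map c.thickTorusInclusion x) := by
  have := hS.pathConnectedSpace
  have : PathConnectedSpace c.ballExterior :=
    (show Function.Surjective c.retraction from fun y =>
      ⟨_, c.retraction_exteriorInclusion y⟩).pathConnectedSpace c.retraction.continuous
  intro g
  induction g using Path.Homotopic.Quotient.ind with
  | mk p =>
  obtain ⟨l, hl⟩ := c.exists_loop_thickTorus hS hab x (p.map c.exteriorInclusion.continuous)
  refine ⟨FundamentalGroup.fromPath (Path.Homotopic.Quotient.mk l), ?_⟩
  have h := (Holonomy.tautological (basePath (c.thickTorusInclusion x))).val_eq_of_homotopic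
    (hl.map c.retraction)
  rw [Holonomy.tautological_val_of_eq _ (l.map c.thickTorusInclusion.continuous)
      fun t => c.retraction_exteriorInclusion _,
    Holonomy.tautological_val_of_eq _ p fun t => c.retraction_exteriorInclusion _, inv_inj] at h
  exact h

end DoublePointChart

end

section

/-! ### The group of a knot is normally generated by a meridian -/

namespace Knot

variable (K : Knot)

/-- The complement of the core of the tube, i.e. of the knot itself. -/
abbrev Complement : Type := ↥(K.tube '' {q | q.2 = 0})ᶜ

theorem tube_mem_complement {q : Circle × ℂ} (h : q.2 ≠ 0) :
    K.tube q ∈ (K.tube '' {q | q.2 = 0})ᶜ := by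
  rintro ⟨q', hq', hqq⟩
  exact h (K.isOpenEmbedding_tube.injective hqq ▸ hq')

/-- The deleted tube in the complement of the knot. -/
noncomputable def deletedTube : C(Circle × CStar, K.Complement) where
  toFun q := ⟨K.tube (q.1, q.2), K.tube_mem_complement q.2.2⟩
  continuous_toFun := Continuous.subtype_mk
    (K.isOpenEmbedding_tube.continuous.comp (by fun_prop)) _

theorem exists_deletedTube_eq (y : K.Complement) (q : Circle × ℂ) (hq : K.tube q = y) :
    ∃ h : q.2 ≠ 0, K.deletedTube (q.1, ⟨q.2, h⟩) = y :=
  ⟨fun h => y.2 ⟨q, h, hq⟩, Subtype.ext hq⟩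

theorem isOpenEmbedding_deletedTube : IsOpenEmbedding K.deletedTube := by
  refine ⟨IsEmbedding.of_comp K.deletedTube.continuous continuous_subtype_val
    (K.isOpenEmbedding_tube.isEmbedding.comp
      (IsEmbedding.id.prodMap IsEmbedding.subtypeVal)), ?_⟩
  have : Set.range K.deletedTube = Subtype.val ⁻¹' Set.range K.tube := by
    ext y
    constructor
    · rintro ⟨q, rfl⟩; exact ⟨_, rfl⟩
    · rintro ⟨q, hq⟩
      obtain ⟨h, h'⟩ := K.exists_deletedTube_eq y q hq
      exact ⟨_, h'⟩
  rw [this]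
  exact K.isOpenEmbedding_tube.isOpen_range.preimage continuous_subtype_val

instance : LocallyPathConnectedSpace Circle :=
  haveI : Fact (Module.finrank ℝ ℂ = 1 + 1) := ⟨Complex.finrank_real_complex⟩
  ChartedSpace.locallyPathConnectedSpace (EuclideanSpace ℝ (Fin 1)) Circle

instance : LocallyPathConnectedSpace ThreeSphere :=
  ChartedSpace.locallyPathConnectedSpace (EuclideanSpace ℝ (Fin 3)) ThreeSphere

theorem isCompact_closedTube : IsCompact (K.tube '' {q | ‖q.2‖ ≤ 1}) := by
  refine IsCompact.image ?_ K.isOpenEmbedding_tube.continuous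
  have : {q : Circle × ℂ | ‖q.2‖ ≤ 1} = Set.univ ×ˢ Metric.closedBall 0 1 := by
    ext q; simp
  rw [this]
  exact isCompact_univ.prod (isCompact_closedBall 0 1)

theorem isClosed_core : IsClosed (K.tube '' {q | q.2 = 0}) := by
  refine (IsCompact.image ?_ K.isOpenEmbedding_tube.continuous).isClosed
  have : {q : Circle × ℂ | q.2 = 0} = Set.univ ×ˢ {0} := by
    ext q; simp
  rw [this]
  exact isCompact_univ.prod isCompact_singleton

theorem locallyNonseparating_complement :
    LocallyNonseparating (Subtype.val : K.Complement → ThreeSphere) := by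
  intro x O hO
  by_cases hx : x ∈ K.tube '' {q | q.2 = 0}
  · obtain ⟨⟨a, z⟩, hz, rfl⟩ := hx
    obtain rfl : z = 0 := hz
    have hO' := K.isOpenEmbedding_tube.continuous.continuousAt.preimage_mem_nhds hO
    obtain ⟨V, hV, B, hB, hVB⟩ := mem_nhds_prod_iff.1 hO'
    obtain ⟨r, hr, hre, hrB⟩ := exists_shrink (e := (id : ℂ → ℂ)) IsOpenEmbedding.id 0 hB
    obtain ⟨V', ⟨hV'o, haV', hV'c⟩, hV'⟩ := (isOpen_isPathConnected_basis a).mem_iff.1 hV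
    have : PathConnectedSpace V' := isPathConnected_iff_pathConnectedSpace.1 hV'c
    have hne (v : CStar) : id (0 + r v • (v : ℂ)) ≠ 0 := by simp [(hr _).ne', v.2]
    refine ⟨K.tube '' (V' ×ˢ Set.range fun v => (id (0 + r v • v) : ℂ)), ?_, ?_, ?_, ?_⟩
    · rintro _ ⟨⟨b, w⟩, ⟨hb, v, rfl⟩, rfl⟩
      exact hVB ⟨hV' hb, hrB v⟩
    · exact K.isOpenEmbedding_tube.isOpenMap _ (hV'o.prod hre.isOpen_range)
    · exact ⟨_, ⟨haV', 0, by simp⟩, rfl⟩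
    · refine isPathConnected_preimage_range _ (K.deletedTube.comp
        (⟨fun q => (q.1, ⟨id (0 + r q.2 • (q.2 : ℂ)), hne q.2⟩),
          (continuous_subtype_val.comp continuous_fst).prodMk (Continuous.subtype_mk
            (hre.continuous.comp (continuous_subtype_val.comp continuous_snd)) fun q => hne q.2)⟩ :
          C(V' × CStar, Circle × CStar))) ?_ ?_
      · exact fun q => ⟨_, ⟨q.1.2, ⟨_, rfl⟩⟩, rfl⟩
      · rintro y ⟨⟨b, _⟩, ⟨hb, v, rfl⟩, hy⟩
        obtain ⟨h, h'⟩ := K.exists_deletedTube_eq y _ hy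
        refine ⟨(⟨b, hb⟩, ⟨v, fun hv => h ?_⟩), h'⟩
        simp [hv]
  · have hO' := Filter.inter_mem hO (K.isClosed_core.isOpen_compl.mem_nhds hx)
    obtain ⟨V', ⟨hV'o, haV', hV'c⟩, hV'⟩ := (isOpen_isPathConnected_basis x).mem_iff.1 hO'
    have : PathConnectedSpace V' := isPathConnected_iff_pathConnectedSpace.1 hV'c
    refine ⟨V', fun _ h => (hV' h).1, hV'o, haV', ?_⟩
    refine isPathConnected_preimage_range _ (⟨fun v => ⟨v, (hV' v.2).2⟩,
      Continuous.subtype_mk continuous_subtype_val _⟩ : C(V', K.Complement)) ?_ ?_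
    · exact fun v => v.2
    · exact fun y hy => ⟨⟨y, hy⟩, rfl⟩

instance : PathConnectedSpace K.Complement :=
  K.locallyNonseparating_complement.pathConnectedSpace

/-- The meridian over the point `a` of the knot, as a map to the complement of the knot. -/
noncomputable def complementMeridian (a : Circle) : C(Circle, K.Complement) :=
  K.deletedTube.comp ⟨fun b => (a, ⟨(b : ℂ), by simp⟩), by fun_prop⟩

/-- A holonomy on the complement of a knot that is trivial on a meridian is trivial, as it extends
to the 3-sphere. -/
theorem isTrivial_of_meridian {A : Type*} [Group A] {ρ : Holonomy K.Complement A} (a : Circle)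
    (h : (ρ.comap (K.complementMeridian a)).val stdLoop = 1) : ρ.IsTrivial := by
  refine ρ.isTrivial_of_locally ⟨Subtype.val, continuous_subtype_val⟩
    K.locallyNonseparating_complement fun x => ?_
  by_cases hx : x ∈ K.tube '' {q | q.2 = 0}
  · obtain ⟨⟨b, z⟩, hz, rfl⟩ := hx
    obtain rfl : z = 0 := hz
    -- over the circle without the point `-b`, the argument is continuous
    let V : Set Circle := {v | ((v * b⁻¹ : Circle) : ℂ) ∈ Complex.slitPlane}
    have hV : IsOpen V := Complex.isOpen_slitPlane.preimage (by fun_prop)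
    have hbV : b ∈ V := by simp [V]
    refine ⟨K.tube '' (V ×ˢ Set.univ), K.isOpenEmbedding_tube.isOpenMap.image_mem_nhds
      ((hV.prod isOpen_univ).mem_nhds ⟨hbV, trivial⟩), fun y p hp => ?_⟩
    let f : C(V × CStar, K.Complement) := K.deletedTube.comp ⟨fun q => (q.1, q.2), by fun_prop⟩
    have hf : IsEmbedding f := K.isOpenEmbedding_deletedTube.isEmbedding.comp
      (IsEmbedding.subtypeVal.prodMap IsEmbedding.id)
    refine Holonomy.IsTrivial.val_eq_one_of_range (f := f) ?_ hf p fun t => ?_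
    · obtain ⟨k, hk0, hk1⟩ := DoublePointChart.exists_radial_homotopy 1 one_pos
      have hθ : Continuous fun v : V => Complex.arg ((v : Circle) * b⁻¹ : Circle) + Complex.arg b := by
        refine Continuous.add (continuous_iff_continuousAt.2 fun v => ?_) continuous_const
        exact ContinuousAt.comp (f := fun v : V => (((v : Circle) * b⁻¹ : Circle) : ℂ))
          (Complex.continuousAt_arg v.2) (Continuous.continuousAt (by fun_prop))
      have hθe : ∀ v : V, Circle.exp (Complex.arg ((v : Circle) * b⁻¹ : Circle) + Complex.arg b) =
          v := fun v => by
        rw [Circle.exp_add, Circle.exp_arg, Circle.exp_arg, inv_mul_cancel_right]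
      refine Holonomy.isTrivial_comap_of_homotopic (g := (K.complementMeridian a).comp
        ⟨fun q => q.2.unitPart, CStar.continuous_unitPart.comp continuous_snd⟩)
        ⟨⟨K.deletedTube.comp ⟨fun q => (Circle.exp ((1 - (q.1 : ℝ)) *
          (Complex.arg ((q.2.1 : Circle) * b⁻¹ : Circle) + Complex.arg b) +
            q.1 * Complex.arg a), k (q.1, q.2.2)), ?_⟩, fun q => ?_, fun q => ?_⟩⟩
          (Holonomy.isTrivial_comap_of_eq_comp _ (fun _ => rfl) (Holonomy.isTrivial_circle h))
      · refine Continuous.prodMk (Circle.exp.continuous.comp (Continuous.add (Continuous.mul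
          (by fun_prop) (hθ.comp (by fun_prop))) (by fun_prop))) (by fun_prop)
      · simp only [ContinuousMap.toFun_eq_coe, ContinuousMap.comp_apply, ContinuousMap.coe_mk, f]
        simp only [Set.Icc.coe_zero, sub_zero, one_mul, zero_mul, add_zero, hθe, hk0]
      · simp only [ContinuousMap.toFun_eq_coe, ContinuousMap.comp_apply, ContinuousMap.coe_mk,
          complementMeridian]
        simp only [Set.Icc.coe_one, sub_self, zero_mul, one_mul, zero_add, Circle.exp_arg]
        congr 2
        exact Subtype.ext (by simp [hk1])
    · obtain ⟨q, ⟨hq, -⟩, hqp⟩ := hp t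
      obtain ⟨h, h'⟩ := K.exists_deletedTube_eq (p t) q hqp
      exact ⟨(⟨q.1, hq⟩, ⟨q.2, h⟩), h'⟩
  · obtain ⟨e, he, h0, heO⟩ := exists_normed_chart (H := EuclideanSpace ℝ (Fin 3)) x
      (K.isClosed_core.isOpen_compl.mem_nhds hx)
    let f : C(EuclideanSpace ℝ (Fin 3), K.Complement) := ⟨fun v => ⟨e v, heO v⟩,
      Continuous.subtype_mk he.continuous _⟩
    refine ⟨Set.range e, he.isOpen_range.mem_nhds ⟨0, h0⟩, fun y p hp => ?_⟩
    refine ((ρ.comap f).isTrivial_of_simplyConnected).val_eq_one_of_range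
      (IsEmbedding.of_comp f.continuous continuous_subtype_val he.isEmbedding) p fun t => ?_
    obtain ⟨v, hv⟩ := hp t
    exact ⟨v, Subtype.ext hv⟩

/-! #### The retraction of the complement of a knot to the exterior -/

/-- The radial push of the deleted tube to the part outside of the closed tube. -/
noncomputable def tubePush (a : Unit × (Circle × CStar)) : Circle × CStar :=
  (a.2.1, ⟨((max 1 ‖(a.2.2 : ℂ)‖⁻¹ : ℝ) : ℂ) * a.2.2, mul_ne_zero (Complex.ofReal_ne_zero.2
    (zero_lt_one.trans_le (le_max_left _ _)).ne') a.2.2.2⟩)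

theorem tubePush_of_one_le {q : Circle × CStar} (h : 1 ≤ ‖(q.2 : ℂ)‖) :
    tubePush ((), q) = q := by
  refine Prod.ext rfl (Subtype.ext ?_)
  simp [tubePush, max_eq_left (inv_le_one_of_one_le₀ h)]

theorem one_le_norm_tubePush (q : Circle × CStar) : 1 ≤ ‖((tubePush ((), q)).2 : ℂ)‖ := by
  have h := norm_pos_iff.2 q.2.2
  have h1 : ‖(q.2 : ℂ)‖⁻¹ * ‖(q.2 : ℂ)‖ = 1 := inv_mul_cancel₀ h.ne'
  have h2 : (0 : ℝ) ≤ max 1 ‖(q.2 : ℂ)‖⁻¹ := zero_le_one.trans (le_max_left _ _)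
  simp only [tubePush, norm_mul, Complex.norm_real, Real.norm_eq_abs, abs_of_nonneg h2]
  rw [← h1]
  exact mul_le_mul_of_nonneg_right (h1 ▸ le_max_right _ _) h.le

theorem continuous_tubePush : Continuous tubePush := by
  refine Continuous.prodMk (by fun_prop) (Continuous.subtype_mk (Continuous.mul
    (Complex.continuous_ofReal.comp (continuous_const.max (Continuous.inv₀ (by fun_prop)
      fun a => ?_))) (by fun_prop)) _)
  exact (norm_pos_iff.2 a.2.2.2).ne'

theorem mem_exterior_iff (q : Circle × ℂ) : K.tube q ∈ K.exterior ↔ 1 ≤ ‖q.2‖ := by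
  constructor
  · intro h
    by_contra! hq
    exact h ⟨q, hq, rfl⟩
  · rintro h ⟨q', hq', hqq⟩
    have := K.isOpenEmbedding_tube.injective hqq
    subst this
    exact absurd hq' (not_lt.2 h)

/-- The inclusion of the exterior in the complement. -/
noncomputable def exteriorInclusion : C(K.exterior, K.Complement) where
  toFun y := ⟨y, fun ⟨q, hq, h⟩ => y.2 ⟨q, by
    have hq' : q.2 = 0 := hq
    simp [hq'], h⟩⟩

theorem extendById_tubePush_mem (y : K.Complement) :
    (extendById K.deletedTube tubePush ((), y) : K.Complement).1 ∈ K.exterior := by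
  by_cases hy : ∃ q, K.deletedTube q = y
  · obtain ⟨q, rfl⟩ := hy
    rw [extendById_apply K.isOpenEmbedding_deletedTube.injective]
    exact (K.mem_exterior_iff _).2 (one_le_norm_tubePush q)
  · rw [extendById_of_notMem _ _ hy]
    rintro ⟨q, -, hq⟩
    obtain ⟨h, h'⟩ := K.exists_deletedTube_eq y q hq
    exact hy ⟨_, h'⟩

theorem continuous_extendById_tubePush :
    Continuous fun y : K.Complement =>
      (extendById K.deletedTube tubePush ((), y) : K.Complement) := by
  have h := continuous_extendById (P := Unit) K.isOpenEmbedding_deletedTube continuous_tubePush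
    (C := Subtype.val ⁻¹' (K.tube '' {q | ‖q.2‖ ≤ 1}))
    (K.isCompact_closedTube.isClosed.preimage continuous_subtype_val) ?_ ?_
  · exact h.comp (by fun_prop)
  · rintro y ⟨q, -, hq⟩
    obtain ⟨h, h'⟩ := K.exists_deletedTube_eq y q hq
    exact ⟨_, h'⟩
  · intro _ q hq
    exact tubePush_of_one_le (le_of_not_ge fun h => hq ⟨_, h, rfl⟩)

/-- The retraction of the complement of a knot to its exterior. -/
noncomputable def retraction : C(K.Complement, K.exterior) where
  toFun y := ⟨_, K.extendById_tubePush_mem y⟩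
  continuous_toFun := Continuous.subtype_mk
    (continuous_subtype_val.comp K.continuous_extendById_tubePush) _

theorem retraction_exteriorInclusion (y : K.exterior) :
    K.retraction (K.exteriorInclusion y) = y := by
  refine Subtype.ext ?_
  change ((extendById K.deletedTube tubePush ((), K.exteriorInclusion y) : K.Complement) :
    ThreeSphere) = y
  by_cases hy : ∃ q, K.deletedTube q = K.exteriorInclusion y
  · obtain ⟨q, hq⟩ := hy
    rw [← hq, extendById_apply K.isOpenEmbedding_deletedTube.injective, tubePush_of_one_le, hq]
    · rfl
    · refine (K.mem_exterior_iff (q.1, q.2)).1 ?_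
      have := congrArg Subtype.val hq
      change K.tube (q.1, q.2) = y at this
      exact this ▸ y.2
  · rw [extendById_of_notMem _ _ hy]
    rfl

instance : PathConnectedSpace K.exterior :=
  (show Function.Surjective K.retraction from fun y =>
    ⟨_, K.retraction_exteriorInclusion y⟩).pathConnectedSpace K.retraction.continuous

/-- The boundary torus of the exterior. -/
noncomputable def boundaryTorus : C(Circle × Circle, K.exterior) where
  toFun q := ⟨K.tube (q.1, (q.2 : ℂ)), boundary_mem_tubeExterior K.isOpenEmbedding_tube _ _⟩
  continuous_toFun := Continuous.subtype_mk
    (K.isOpenEmbedding_tube.continuous.comp (by fun_prop)) _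

/-- The meridian over the point `a` of the knot. -/
noncomputable def meridian (a : Circle) : C(Circle, K.exterior) :=
  K.boundaryTorus.comp ⟨fun b => (a, b), by fun_prop⟩

/-- The group of a knot is the normal closure of a meridian. -/
theorem normalClosure_meridian (a : Circle) :
    Subgroup.normalClosure {circleClass (K.meridian a)} = ⊤ := by
  set R := Subgroup.normalClosure {circleClass (K.meridian a)}
  have key := Holonomy.eq_one_of_isTrivial (QuotientGroup.mk' R) ?_
  · rw [eq_top_iff]
    intro g _
    have := DFunLike.congr_fun key g
    rwa [MonoidHom.one_apply, QuotientGroup.mk'_apply, QuotientGroup.eq_one_iff] at this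
  · set κ := (Holonomy.tautological (basePath (K.meridian a 1))).mapHom (QuotientGroup.mk' R)
    have h : (κ.comap K.retraction).IsTrivial := by
      refine K.isTrivial_of_meridian a ?_
      refine (congrArg (QuotientGroup.mk' R) (Holonomy.tautological_val_of_eq
        (((stdLoop).map (K.complementMeridian a).continuous).map K.retraction.continuous)
        (circleLoop (K.meridian a))
        fun t => K.retraction_exteriorInclusion
          (K.meridian a (Circle.exp (2 * Real.pi * (t : ℝ)))))).trans ?_
      rw [QuotientGroup.mk'_apply, QuotientGroup.eq_one_iff]
      exact R.inv_mem (Subgroup.subset_normalClosure rfl)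
    intro y p
    have := h _ (p.map K.exteriorInclusion.continuous)
    rw [← this]
    exact κ.val_congr _ _ fun t => (K.retraction_exteriorInclusion _).symm

end Knot

end

section

/-! ### The angle on the exterior of a knot -/

theorem continuous_extend_const {Q Y Z : Type*} [TopologicalSpace Q] [TopologicalSpace Y]
    [TopologicalSpace Z] {e : Q → Y} (he : IsOpenEmbedding e) {f : Q → Z} (hf : Continuous f)
    {C : Set Y} (hC : IsClosed C) (hCe : C ⊆ Set.range e) {z : Z}
    (hfC : ∀ q, e q ∉ C → f q = z) : Continuous (Function.extend e f fun _ => z) := by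
  refine continuous_iff_continuousAt.2 fun y => ?_
  by_cases hy : y ∈ Set.range e
  · obtain ⟨q, rfl⟩ := hy
    refine (he.continuousAt_iff (x := q)).1 ?_
    have : (Function.extend e f fun _ => z) ∘ e = f := Function.extend_comp he.injective _ _
    rw [this]
    exact hf.continuousAt
  · refine (continuousAt_const (y := z)).congr ?_
    filter_upwards [hC.isOpen_compl.mem_nhds fun h => hy (hCe h)] with y' hy'
    by_cases hz : ∃ q, e q = y'
    · obtain ⟨q, rfl⟩ := hz
      rw [he.injective.extend_apply, hfC q hy']
    · rw [Function.extend_apply' _ _ _ hz]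

/-- A bundle, given as the range of a family `Q` of projections, has a section without zeros over a
ball: the projections transport a vector along the rays. -/
theorem exists_section_of_projections {F B : Type*} [NormedAddCommGroup F] [NormedSpace ℝ F]
    [ProperSpace F] [NormedAddCommGroup B] [NormedSpace ℂ B] {Q : F → B →L[ℂ] B}
    (hQ : Continuous Q) (hQQ : ∀ y b, Q y (Q y b) = Q y b) {u : B} (hu : Q 0 u = u) (hu0 : u ≠ 0)
    (R : ℝ) : ∃ v : F → B, Continuous v ∧ ∀ y, ‖y‖ ≤ R → v y ≠ 0 ∧ Q y (v y) = v y := by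
  obtain ⟨δ, hδ, hQδ⟩ := Metric.uniformContinuousOn_iff.1
    ((isCompact_closedBall (0 : F) R).uniformContinuousOn_of_continuous hQ.continuousOn) 1 one_pos
  obtain ⟨n, hn⟩ := exists_nat_gt (R / δ)
  let v : ℕ → F → B := fun j =>
    Nat.rec (fun _ => u) (fun j w y => Q ((((j : ℝ) + 1) / (n + 1)) • y) (w y)) j
  have hv : ∀ j, Continuous (v j) := fun j => by
    induction j with
    | zero => exact continuous_const
    | succ j ih => exact (hQ.comp (by fun_prop)).clm_apply ih
  have key : ∀ y : F, ‖y‖ ≤ R → ∀ j : ℕ, j ≤ n + 1 →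
      v j y ≠ 0 ∧ Q (((j : ℝ) / (n + 1)) • y) (v j y) = v j y := fun y hy j => by
    have hn0 : (0 : ℝ) < n + 1 := by positivity
    have hball : ∀ i : ℕ, i ≤ n + 1 → ((i : ℝ) / (n + 1)) • y ∈ Metric.closedBall (0 : F) R := by
      intro i hi
      have hi' : (i : ℝ) / (n + 1) ≤ 1 := (div_le_one hn0).2 (by exact_mod_cast hi)
      rw [mem_closedBall_zero_iff, norm_smul, Real.norm_of_nonneg (by positivity)]
      exact (mul_le_of_le_one_left (norm_nonneg y) hi').trans hy
    induction j with
    | zero => exact fun _ => by simpa [v] using ⟨hu0, hu⟩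
    | succ j ih =>
      intro hj
      obtain ⟨h0, h1⟩ := ih (by omega)
      have hstep : v (j + 1) y = Q (((j + 1 : ℕ) / ((n : ℝ) + 1)) • y) (v j y) := by
        simp [v]
      refine ⟨fun hz => ?_, by rw [hstep, hQQ]⟩
      have hd := hQδ _ (hball (j + 1) hj) _ (hball j (by omega)) (by
        rw [dist_eq_norm, ← sub_smul, ← sub_div, norm_smul,
          Real.norm_of_nonneg (by push_cast; rw [add_sub_cancel_left]; positivity)]
        push_cast
        rw [add_sub_cancel_left, one_div, inv_mul_lt_iff₀ hn0]
        calc ‖y‖ ≤ R := hy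
          _ < n * δ := (div_lt_iff₀ hδ).1 hn
          _ ≤ (n + 1) * δ := by nlinarith)
      rw [dist_eq_norm] at hd
      have hle := (Q (((j + 1 : ℕ) / ((n : ℝ) + 1)) • y) - Q (((j : ℕ) / ((n : ℝ) + 1)) • y)).le_opNorm
        (v j y)
      rw [sub_apply, ← hstep, hz, h1, zero_sub, norm_neg] at hle
      have := norm_pos_iff.2 h0
      nlinarith
  refine ⟨v (n + 1), hv (n + 1), fun y hy => ?_⟩
  have := key y hy (n + 1) le_rfl
  rwa [Nat.cast_add_one, div_self (by positivity), one_smul] at this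

/-- The endomorphism of `ℂ²` with matrix `(α, β; conj β, 1 - α)`. It is the orthogonal projection to
a line if `|β|² = α (1 - α)`. -/
noncomputable def lineProjection (α β : ℂ) : (ℂ × ℂ) →L[ℂ] (ℂ × ℂ) :=
  (ContinuousLinearMap.inl ℂ ℂ ℂ).comp
      (α • ContinuousLinearMap.fst ℂ ℂ ℂ + β • ContinuousLinearMap.snd ℂ ℂ ℂ) +
    (ContinuousLinearMap.inr ℂ ℂ ℂ).comp
      (star β • ContinuousLinearMap.fst ℂ ℂ ℂ + (1 - α) • ContinuousLinearMap.snd ℂ ℂ ℂ)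

theorem lineProjection_apply (α β : ℂ) (v : ℂ × ℂ) :
    lineProjection α β v = (α * v.1 + β * v.2, star β * v.1 + (1 - α) * v.2) := by
  simp [lineProjection]

theorem lineProjection_idem {α β : ℂ} (h : β * star β = α * (1 - α)) (v : ℂ × ℂ) :
    lineProjection α β (lineProjection α β v) = lineProjection α β v := by
  simp only [lineProjection_apply]
  refine Prod.ext ?_ ?_
  · linear_combination v.1 * h
  · linear_combination v.2 * h

theorem exists_lineProjection_eq {α β : ℂ} (h : β * star β = α * (1 - α)) :
    ∃ u, lineProjection α β u = u ∧ u ≠ 0 := by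
  by_cases h0 : lineProjection α β (1, 0) = 0
  · rw [lineProjection_apply] at h0
    obtain ⟨h1, h2⟩ := Prod.mk_eq_zero.1 h0
    refine ⟨(0, 1), ?_, by simp⟩
    rw [lineProjection_apply]
    have hα : α = 0 := by simpa using h1
    have hβ : β = 0 := by simpa using h2
    simp [hα, hβ]
  · exact ⟨_, lineProjection_idem h _, h0⟩

theorem continuous_lineProjection {Y : Type*} [TopologicalSpace Y] {α β : Y → ℂ}
    (hα : Continuous α) (hβ : Continuous β) :
    Continuous fun y => lineProjection (α y) (β y) := by
  unfold lineProjection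
  have := hβ.star
  fun_prop

/-- The distance from `z` to the unit circle, for `z` in the unit disk. -/
noncomputable def codepth (z : ℂ) : ℝ := max 0 (1 - ‖z‖)

/-- The squared length of `(z, codepth z)`. -/
noncomputable def lineNorm (z : ℂ) : ℝ := ‖z‖ ^ 2 + codepth z ^ 2

theorem continuous_codepth : Continuous codepth := by unfold codepth; fun_prop

theorem lineNorm_pos (z : ℂ) : 0 < lineNorm z := by
  unfold lineNorm codepth
  rcases eq_or_ne z 0 with rfl | h
  · simp
  · have := norm_pos_iff.2 h
    positivity

theorem continuous_lineNorm : Continuous lineNorm := by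
  unfold lineNorm
  have := continuous_codepth
  fun_prop

theorem ofReal_lineNorm (z : ℂ) : (lineNorm z : ℂ) = z * star z + codepth z * codepth z := by
  have : z * star z = ((‖z‖ ^ 2 : ℝ) : ℂ) := by
    rw [← Complex.normSq_eq_norm_sq]; exact Complex.mul_conj z
  rw [this, lineNorm]
  push_cast
  ring

theorem codepth_of_one_le {z : ℂ} (h : 1 ≤ ‖z‖) : codepth z = 0 := max_eq_left (by linarith)

namespace Knot

variable (K : Knot)

/-- The first entry of the projection to the line spanned by `(z, codepth z)` over the point
`tube (a, z)`, and by `(1, 0)` over the exterior. -/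
noncomputable def lineEntry₁ : ThreeSphere → ℂ :=
  Function.extend K.tube (fun q => q.2 * star q.2 / lineNorm q.2) fun _ => 1

/-- The second entry of the first row of the projection described at `lineEntry₁`. -/
noncomputable def lineEntry₂ : ThreeSphere → ℂ :=
  Function.extend K.tube (fun q => q.2 * codepth q.2 / lineNorm q.2) fun _ => 0

theorem lineEntry₁_tube (q : Circle × ℂ) :
    K.lineEntry₁ (K.tube q) = q.2 * star q.2 / lineNorm q.2 :=
  K.isOpenEmbedding_tube.injective.extend_apply _ _ _

theorem lineEntry₂_tube (q : Circle × ℂ) :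
    K.lineEntry₂ (K.tube q) = q.2 * codepth q.2 / lineNorm q.2 :=
  K.isOpenEmbedding_tube.injective.extend_apply _ _ _

theorem lineEntries_eq_of_one_le {q : Circle × ℂ} (h : 1 ≤ ‖q.2‖) :
    q.2 * star q.2 / lineNorm q.2 = 1 ∧ q.2 * codepth q.2 / (lineNorm q.2 : ℂ) = 0 := by
  have h0 := (Complex.ofReal_ne_zero.2 (lineNorm_pos q.2).ne')
  rw [ofReal_lineNorm, codepth_of_one_le h] at *
  simp only [Complex.ofReal_zero, mul_zero, add_zero, zero_div] at *
  exact ⟨div_self h0, trivial⟩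

theorem lineEntries_of_mem_exterior (e : K.exterior) :
    K.lineEntry₁ e = 1 ∧ K.lineEntry₂ e = 0 := by
  obtain ⟨x, hx⟩ := e
  by_cases h : ∃ q, K.tube q = x
  · obtain ⟨q, rfl⟩ := h
    rw [lineEntry₁_tube, lineEntry₂_tube]
    exact lineEntries_eq_of_one_le ((K.mem_exterior_iff q).1 hx)
  · exact ⟨Function.extend_apply' _ _ _ h, Function.extend_apply' _ _ _ h⟩

theorem continuous_lineEntries : Continuous K.lineEntry₁ ∧ Continuous K.lineEntry₂ := by
  have h0 : ∀ q : Circle × ℂ, (lineNorm q.2 : ℂ) ≠ 0 := fun q =>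
    Complex.ofReal_ne_zero.2 (lineNorm_pos q.2).ne'
  have hN := continuous_lineNorm
  have hc := continuous_codepth
  have hsub : K.tube '' {q | ‖q.2‖ ≤ 1} ⊆ Set.range K.tube := Set.image_subset_range _ _
  have hle : ∀ q, K.tube q ∉ K.tube '' {q | ‖q.2‖ ≤ 1} → 1 ≤ ‖q.2‖ := fun q hq =>
    le_of_not_ge fun h => hq ⟨q, h, rfl⟩
  exact ⟨continuous_extend_const K.isOpenEmbedding_tube (by fun_prop (disch := exact h0))
      K.isCompact_closedTube.isClosed hsub fun q hq => (lineEntries_eq_of_one_le (hle q hq)).1,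
    continuous_extend_const K.isOpenEmbedding_tube (by fun_prop (disch := exact h0))
      K.isCompact_closedTube.isClosed hsub fun q hq => (lineEntries_eq_of_one_le (hle q hq)).2⟩

theorem lineEntries_mul (x : ThreeSphere) :
    K.lineEntry₂ x * star (K.lineEntry₂ x) = K.lineEntry₁ x * (1 - K.lineEntry₁ x) := by
  by_cases h : ∃ q, K.tube q = x
  · obtain ⟨q, rfl⟩ := h
    have h0 := (Complex.ofReal_ne_zero.2 (lineNorm_pos q.2).ne')
    rw [lineEntry₁_tube, lineEntry₂_tube]
    simp only [star_div₀, star_mul', RCLike.star_def, Complex.conj_ofReal]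
    field_simp
    rw [ofReal_lineNorm, RCLike.star_def]
    ring
  · rw [lineEntry₁, lineEntry₂, Function.extend_apply' _ _ _ h, Function.extend_apply' _ _ _ h]
    simp

theorem isClosed_exterior : IsClosed K.exterior := by
  refine (K.isOpenEmbedding_tube.isOpenMap _ ?_).isClosed_compl
  exact isOpen_lt (by fun_prop) continuous_const

/-- A section without zeros of the line bundle, off the point `tube (-1, 0)`: on the exterior, and on
the meridian disk at `tube (1, 0)`. -/
theorem exists_section : ∃ V : ThreeSphere → ℂ × ℂ, ∃ O : Set ThreeSphere, K.exterior ⊆ O ∧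
    (∀ z : ℂ, K.tube (1, z) ∈ O) ∧ ContinuousOn V O ∧
    (∀ x, (x ∈ K.exterior ∨ ∃ z : ℂ, ‖z‖ ≤ 1 ∧ K.tube (1, z) = x) → V x ≠ 0 ∧
      lineProjection (K.lineEntry₁ x) (K.lineEntry₂ x) (V x) = V x) := by
  set v : EuclideanSpace ℝ (Fin 4) := (K.tube (-1, 0)).1
  have hv : ‖v‖ = 1 := by simp [v]
  have hne : K.exterior ⊆ {(⟨v, by simp [hv]⟩ : ThreeSphere)}ᶜ := by
    rintro x hx rfl
    exact absurd ((K.mem_exterior_iff (-1, 0)).1 hx) (by simp)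
  have hne' : ∀ z : ℂ, K.tube (1, z) ∈ ({(⟨v, by simp [hv]⟩ : ThreeSphere)} : Set ThreeSphere)ᶜ := by
    intro z h
    have h1 : K.tube (1, z) = K.tube (-1, 0) := h
    have h2 := congrArg Subtype.val (congrArg Prod.fst (K.isOpenEmbedding_tube.injective h1))
    have h3 : (1 : ℂ) = -1 := h2
    norm_num at h3
  have hs := stereographic_source hv
  have hcont := (stereographic hv).continuousOn
  rw [hs] at hcont
  have hD : IsCompact ((fun z : ℂ => K.tube (1, z)) '' Metric.closedBall 0 1) :=
    (isCompact_closedBall _ _).image (K.isOpenEmbedding_tube.continuous.comp (by fun_prop))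
  have hC := (K.isClosed_exterior.isCompact.union hD).image_of_continuousOn (hcont.mono (by
    rintro x (hx | ⟨z, -, rfl⟩)
    exacts [hne hx, hne' z]))
  obtain ⟨R, hR⟩ := hC.isBounded.exists_norm_le
  let Q : (ℝ ∙ v)ᗮ → (ℂ × ℂ) →L[ℂ] (ℂ × ℂ) := fun y =>
    lineProjection (K.lineEntry₁ (stereoInvFun hv y)) (K.lineEntry₂ (stereoInvFun hv y))
  obtain ⟨u, hu, hu0⟩ := exists_lineProjection_eq (K.lineEntries_mul (stereoInvFun hv 0))
  obtain ⟨V, hVc, hV⟩ := exists_section_of_projections (Q := Q)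
    ((continuous_lineProjection K.continuous_lineEntries.1 K.continuous_lineEntries.2).comp
      (continuous_stereoInvFun hv)) (fun y b => lineProjection_idem (K.lineEntries_mul _) b) hu hu0 R
  refine ⟨V ∘ stereographic hv, _, hne, hne', hVc.comp_continuousOn hcont, fun x hx => ?_⟩
  have hx' : x ∈ K.exterior ∪ (fun z : ℂ => K.tube (1, z)) '' Metric.closedBall 0 1 :=
    hx.imp id fun ⟨z, hz, h⟩ => ⟨z, by simpa using hz, h⟩
  have hxs : x ∈ (stereographic hv).source := by
    rw [hs]
    rcases hx' with h | ⟨z, -, rfl⟩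
    exacts [hne h, hne' z]
  have h := hV (stereographic hv x) (hR _ ⟨x, hx', rfl⟩)
  have hinv : stereoInvFun hv (stereographic hv x) = x := (stereographic hv).left_inv hxs
  simp only [Q, hinv] at h
  exact h

/-- A map of the exterior to the circle that, on a meridian, differs from the meridian coordinate by
a function that extends over the meridian disk. -/
theorem exists_angle : ∃ θ : C(K.exterior, Circle), ∃ h : C(Metric.closedBall (0 : ℂ) 1, Circle),
    ∀ b : Circle, θ (K.boundaryTorus (1, b)) = b * h ⟨b, mem_closedBall_zero_iff.2 (Circle.norm_coe b).le⟩ := by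
  obtain ⟨V, O, hEO, hDO, hVc, hV⟩ := K.exists_section
  have hE : ∀ e : K.exterior, (V e).1 ≠ 0 := fun e h => by
    obtain ⟨h0, h1⟩ := hV e (Or.inl e.2)
    rw [(K.lineEntries_of_mem_exterior e).1, (K.lineEntries_of_mem_exterior e).2,
      lineProjection_apply] at h1
    refine h0 (Prod.ext h ?_)
    have := congrArg Prod.snd h1
    simpa using this.symm
  let g : ℂ → ℂ := fun z => (star z * (V (K.tube (1, z))).1 + codepth z * (V (K.tube (1, z))).2) /
    lineNorm z
  have hg : ∀ z : ℂ, ‖z‖ ≤ 1 → V (K.tube (1, z)) = (z * g z, codepth z * g z) := fun z hz => by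
    obtain ⟨h0, h1⟩ := hV _ (Or.inr ⟨z, hz, rfl⟩)
    rw [lineEntry₁_tube, lineEntry₂_tube, lineProjection_apply] at h1
    have hN := (Complex.ofReal_ne_zero.2 (lineNorm_pos z).ne')
    have hα : 1 - z * star z / lineNorm z = codepth z * codepth z / (lineNorm z : ℂ) := by
      rw [eq_div_iff hN, sub_mul, div_mul_cancel₀ _ hN, ofReal_lineNorm]
      ring
    refine Prod.ext ((congrArg Prod.fst h1).symm.trans ?_) ((congrArg Prod.snd h1).symm.trans ?_)
    · simp only [g]
      ring
    · rw [RCLike.star_def] at hα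
      simp only [g, star_div₀, star_mul', RCLike.star_def, Complex.conj_ofReal]
      linear_combination (V (K.tube (1, z))).2 * hα
  have hg0 : ∀ z : Metric.closedBall (0 : ℂ) 1, g z ≠ 0 := fun z hz => by
    have hz1 : ‖(z : ℂ)‖ ≤ 1 := mem_closedBall_zero_iff.1 z.2
    refine (hV _ (Or.inr ⟨z, hz1, rfl⟩)).1 ?_
    rw [hg _ hz1, hz]
    simp
  have hVt : Continuous fun z : ℂ => V (K.tube (1, z)) := by
    refine continuousOn_univ.1 (hVc.comp (Continuous.continuousOn
      (K.isOpenEmbedding_tube.continuous.comp (by fun_prop))) fun z _ => hDO z)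
  have hgc : Continuous g := by
    have := continuous_codepth
    have := continuous_lineNorm
    have := Complex.continuous_ofReal.comp continuous_codepth
    refine Continuous.div (((continuous_star).mul hVt.fst).add (this.mul hVt.snd)) (by fun_prop) fun z =>
      Complex.ofReal_ne_zero.2 (lineNorm_pos z).ne'
  refine ⟨⟨fun e => CStar.unitPart ⟨(V e).1, hE e⟩, CStar.continuous_unitPart.comp
    (Continuous.subtype_mk (continuous_fst.comp (hVc.mono hEO).domRestrict) _)⟩,
    ⟨fun z => CStar.unitPart ⟨g z, hg0 z⟩, CStar.continuous_unitPart.comp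
      (Continuous.subtype_mk (hgc.comp continuous_subtype_val) _)⟩, fun b => ?_⟩
  refine Subtype.ext ?_
  have hb : (V (K.tube (1, (b : ℂ)))).1 = b * g b := congrArg Prod.fst (hg b (Circle.norm_coe b).le)
  change (V (K.tube (1, (b : ℂ)))).1 / (‖(V (K.tube (1, (b : ℂ)))).1‖ : ℂ) = b * (g b / (‖g b‖ : ℂ))
  rw [hb, norm_mul, Circle.norm_coe, one_mul, mul_div_assoc]

theorem isClosedEmbedding_boundaryTorus : IsClosedEmbedding K.boundaryTorus := by
  refine K.boundaryTorus.continuous.isClosedEmbedding fun q q' h => ?_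
  have h1 : (q.1, (q.2 : ℂ)) = (q'.1, (q'.2 : ℂ)) :=
    K.isOpenEmbedding_tube.injective (congrArg Subtype.val h)
  exact Prod.ext (Prod.mk.inj h1).1 (Subtype.ext (Prod.mk.inj h1).2)

/-- The coordinate of the core on the boundary torus extends over the exterior, as a map to the
disk. -/
theorem exists_extension_core : ∃ ψ : C(K.exterior, ℂ), (∀ e, ‖ψ e‖ ≤ 1) ∧
    ∀ q, ψ (K.boundaryTorus q) = q.1 := by
  have : TietzeExtension (Metric.closedBall (0 : ℂ) 1) :=
    Set.instTietzeExtensionUnitClosedBall (𝕜 := ℂ)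
  obtain ⟨ψ, hψ⟩ := ContinuousMap.exists_extension (Y := Metric.closedBall (0 : ℂ) 1)
    K.isClosedEmbedding_boundaryTorus
    ⟨fun q => ⟨q.1, mem_closedBall_zero_iff.2 (Circle.norm_coe q.1).le⟩, by fun_prop⟩
  exact ⟨⟨fun e => ψ e, by fun_prop⟩, fun e => mem_closedBall_zero_iff.1 (ψ e).2,
    fun q => congrArg Subtype.val (DFunLike.congr_fun hψ q)⟩

theorem map_longitude_eq_one (θ : C(K.exterior, Circle)) :
    FundamentalGroup.map θ _ (circleClass (longitudeMap K.isOpenEmbedding_tube)) = 1 := by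
  have hcomm : ∀ x y : FundamentalGroup Circle
      (θ (longitudeMap K.isOpenEmbedding_tube 1)), x * y = y * x :=
    DoublePointChart.mul_comm_of_joined (PathConnectedSpace.somePath 1 _) fun a b => by
      have hz : ∀ a : FundamentalGroup Circle 1,
          ∃ n : ℤ, a⁻¹ = (Holonomy.tautological (basePath 1)).val stdLoop ^ n := fun a => by
        induction a using Path.Homotopic.Quotient.ind with
        | mk p =>
          obtain ⟨n, hn⟩ := (Holonomy.tautological (basePath 1)).exists_val_eq_zpow_circle p
          exact ⟨n, by rw [← hn, Holonomy.tautological_val]⟩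
      obtain ⟨m, hm⟩ := hz a
      obtain ⟨n, hn⟩ := hz b
      rw [← inv_inj, mul_inv_rev, mul_inv_rev, hm, hn, ← zpow_add, ← zpow_add, add_comm]
  let : CommGroup (FundamentalGroup Circle (θ (longitudeMap K.isOpenEmbedding_tube 1))) :=
    CommGroup.mk hcomm
  have := congrArg (Abelianization.lift (FundamentalGroup.map θ _)) K.longitude_null_homologous
  exact this.trans (map_one _)

/-- The coordinate of the meridian on the boundary torus extends over the exterior, as a map to the
circle. -/
theorem exists_extension_meridian : ∃ ψ : C(K.exterior, Circle),
    ∀ q, ψ (K.boundaryTorus q) = q.2 := by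
  obtain ⟨θ, h, hθ⟩ := K.exists_angle
  let f : C(Circle × Circle, Circle) :=
    ⟨fun q => θ (K.boundaryTorus q) * q.2⁻¹, by fun_prop⟩
  have htriv : ((Holonomy.tautological (basePath (f (1, 1)))).comap f).IsTrivial := by
    set ρ := Holonomy.tautological (basePath (f (1, 1)))
    have : ContractibleSpace (Metric.closedBall (0 : ℂ) 1) :=
      (convex_closedBall 0 1).contractibleSpace ⟨0, by simp⟩
    refine Holonomy.isTrivial_torus ?_ ?_
    · have hn : ((circleLoop (longitudeMap K.isOpenEmbedding_tube)).map θ.continuous).Homotopic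
          (Path.refl _) := Path.Homotopic.Quotient.exact (K.map_longitude_eq_one θ)
      let m : C(Circle, Circle) := ⟨fun x => x * (1 : Circle)⁻¹, by fun_prop⟩
      exact (ρ.val_congr _ (((circleLoop (longitudeMap K.isOpenEmbedding_tube)).map
        θ.continuous).map m.continuous) fun t => rfl).trans
        (((ρ.comap m).val_eq_of_homotopic hn).trans ((ρ.comap m).val_refl _))
    · have := (ρ.comap h).isTrivial_of_simplyConnected
      let d : C(Circle, Metric.closedBall (0 : ℂ) 1) :=
        ⟨fun b => ⟨b, mem_closedBall_zero_iff.2 (Circle.norm_coe b).le⟩, by fun_prop⟩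
      refine Eq.trans (ρ.val_congr _ _ fun t => ?_) (this _ (stdLoop.map d.continuous))
      change θ (K.boundaryTorus (1, stdLoop t)) * (stdLoop t)⁻¹ = h (d (stdLoop t))
      rw [hθ, mul_right_comm, mul_inv_cancel, one_mul]
      rfl
  obtain ⟨s, hs⟩ := Circle.exp_surjective (f (1, 1))
  obtain ⟨u, ⟨-, hu⟩, -⟩ := Circle.isCoveringMap_exp.existsUnique_continuousMap_lifts_of_range_le
    (f := f) hs (by
      rintro _ ⟨g, rfl⟩
      induction g using Path.Homotopic.Quotient.ind with
      | mk p =>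
        have := htriv _ p
        rw [Holonomy.comap_val, Holonomy.tautological_val, inv_eq_one] at this
        change FundamentalGroup.fromPath (Path.Homotopic.Quotient.mk (p.map f.continuous)) ∈ _
        rw [this]
        exact one_mem _)
  obtain ⟨U, hU⟩ := ContinuousMap.exists_extension (Y := ℝ) K.isClosedEmbedding_boundaryTorus u
  refine ⟨⟨fun e => θ e * (Circle.exp (U e))⁻¹, by fun_prop⟩, fun q => ?_⟩
  have h1 : U (K.boundaryTorus q) = u q := DFunLike.congr_fun hU q
  have h2 : Circle.exp (u q) = f q := congrFun hu q
  change θ (K.boundaryTorus q) * (Circle.exp (U (K.boundaryTorus q)))⁻¹ = q.2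
  rw [h1, h2]
  change _ * (θ (K.boundaryTorus q) * q.2⁻¹)⁻¹ = _
  rw [mul_inv_rev, inv_inv, mul_comm q.2, mul_inv_cancel_left]

end Knot

end

section

/-! ### The complement of the surfaces in the surgered manifold -/

namespace DoublePointChart

variable {X : Type*} [TopologicalSpace X] {S₁ S₂ : Set X} (c : DoublePointChart S₁ S₂)
  (K : Knot) (k : ℤ)

theorem torusTube_mem_compl (m₁ m₂ : Circle) {d : ℂ} (h : -4 < d.re ∧ -4 < d.im) :
    c.torusTube m₁ m₂ d ∈ (S₁ ∪ S₂)ᶜ := by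
  refine c.apply_mem_compl (mul_ne_zero ?_ (Circle.coe_ne_zero _))
    (mul_ne_zero ?_ (Circle.coe_ne_zero _))
  · exact Complex.ofReal_ne_zero.2 (by linarith [h.1])
  · exact Complex.ofReal_ne_zero.2 (by linarith [h.2])

theorem bounds_of_norm_le_one {d : ℂ} (h : ‖d‖ ≤ 1) : -4 < d.re ∧ -4 < d.im :=
  ⟨by linarith [neg_abs_le d.re, Complex.abs_re_le_norm d],
    by linarith [neg_abs_le d.im, Complex.abs_im_le_norm d]⟩

/-- The complement of the surfaces in the surgered manifold. -/
abbrev SurgeredComplement : Type _ := ↥(c.surgeredSurfaces K k)ᶜ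

/-- The complement of the open tube of the double point torus in the complement of the
configuration. -/
def tubeComplement : Set ↥(S₁ ∪ S₂)ᶜ := {y | (y : X) ∈ c.torusExterior}

/-- Points of the surfaces are not involved in the gluing, so being one of them is a well defined
property of points of the surgered manifold. -/
theorem exists_predicate_surgeredSurfaces : ∃ P : c.Surgered K k → Prop,
    (∀ x : c.torusExterior, P (Quot.mk _ (Sum.inl x)) = ((x : X) ∈ S₁ ∪ S₂)) ∧
      ∀ e, P (Quot.mk _ (Sum.inr e)) = False := by
  refine ⟨Quot.lift (Sum.elim (fun x => (x : X) ∈ S₁ ∪ S₂) fun _ => False) ?_,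
    fun _ => rfl, fun _ => rfl⟩
  rintro (x | x) (y | ⟨e, s⟩) h
  · exact h.elim
  · obtain ⟨m₁, m₂, d, hx, -, -⟩ := h
    refine eq_false fun h' => ?_
    change (x : X) ∈ S₁ ∪ S₂ at h'
    rw [hx] at h'
    exact c.torusTube_mem_compl m₁ m₂ (bounds_of_norm_le_one (Circle.norm_coe d).le) h'
  · exact h.elim
  · exact h.elim

theorem mk_inl_mem_surgeredSurfaces_iff (x : c.torusExterior) :
    Quot.mk _ (Sum.inl x) ∈ c.surgeredSurfaces K k ↔ (x : X) ∈ S₁ ∪ S₂ := by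
  obtain ⟨P, hP, -⟩ := c.exists_predicate_surgeredSurfaces K k
  refine ⟨?_, fun h => ⟨x, h, rfl⟩⟩
  rintro ⟨y, hy, h⟩
  rwa [← hP, ← h, hP]

theorem mk_inr_notMem_surgeredSurfaces (e : K.exterior × Circle) :
    Quot.mk _ (Sum.inr e) ∈ (c.surgeredSurfaces K k)ᶜ := by
  obtain ⟨P, hP, hP'⟩ := c.exists_predicate_surgeredSurfaces K k
  rintro ⟨y, hy, h⟩
  rwa [← hP, h, hP'] at hy

/-- The first part of the complement of the surfaces in the surgered manifold. -/
def leftMap : C(c.tubeComplement, c.SurgeredComplement K k) where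
  toFun y := ⟨Quot.mk _ (Sum.inl ⟨y.1, y.2⟩), fun h =>
    y.1.2 ((c.mk_inl_mem_surgeredSurfaces_iff K k _).1 h)⟩
  continuous_toFun := Continuous.subtype_mk (continuous_quot_mk.comp (continuous_inl.comp
    (Continuous.subtype_mk (continuous_subtype_val.comp continuous_subtype_val) _))) _

/-- The second part of the complement of the surfaces in the surgered manifold. -/
noncomputable def rightMap : C(K.exterior × Circle, c.SurgeredComplement K k) where
  toFun e := ⟨_, c.mk_inr_notMem_surgeredSurfaces K k e⟩
  continuous_toFun := Continuous.subtype_mk (continuous_quot_mk.comp continuous_inr) _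

theorem leftMap_eq_rightMap (m₁ m₂ d : Circle) (y : c.tubeComplement)
    (hy : (y : X) = c.torusTube m₁ m₂ d) :
    c.leftMap K k y = c.rightMap K k (K.boundaryTorus (d, m₁ * m₂ ^ k), m₂) :=
  Subtype.ext (Quot.sound ⟨m₁, m₂, d, hy, rfl, rfl⟩)

theorem leftMap_or_rightMap (w : c.SurgeredComplement K k) :
    (∃ y, c.leftMap K k y = w) ∨ ∃ e, c.rightMap K k e = w := by
  obtain ⟨w, hw⟩ := w
  induction w using Quot.ind with
  | mk z =>
  rcases z with x | e
  · exact Or.inl ⟨⟨⟨x, fun h => hw ⟨x, h, rfl⟩⟩, x.2⟩, rfl⟩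
  · exact Or.inr ⟨e, rfl⟩

/-- Functions on the complement of the surfaces in the surgered manifold are given by compatible
functions on the two parts. -/
theorem exists_lift {T : Type*} (fl : c.tubeComplement → T) (fr : K.exterior × Circle → T)
    (h : ∀ (m₁ m₂ d : Circle) (y : c.tubeComplement), (y : X) = c.torusTube m₁ m₂ d →
      fl y = fr (K.boundaryTorus (d, m₁ * m₂ ^ k), m₂)) :
    ∃ f : c.SurgeredComplement K k → T,
      (∀ y, f (c.leftMap K k y) = fl y) ∧ ∀ e, f (c.rightMap K k e) = fr e := by
  classical
  -- the value at points of the surfaces is irrelevant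
  let f : c.Surgered K k → T := Quot.lift (Sum.elim (fun x => if hx : (x : X) ∈ (S₁ ∪ S₂)ᶜ then
    fl ⟨⟨x, hx⟩, x.2⟩ else fr (K.boundaryTorus 1, 1)) fr) (by
      rintro (x | x) (y | ⟨e, s⟩) hg
      · exact hg.elim
      · obtain ⟨m₁, m₂, d, hx, he, rfl⟩ := hg
        have hx' : (x : X) ∈ (S₁ ∪ S₂)ᶜ := by
          rw [hx]
          exact c.torusTube_mem_compl m₁ s (bounds_of_norm_le_one (Circle.norm_coe d).le)
        have he' : e = K.boundaryTorus (d, m₁ * s ^ k) := Subtype.ext he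
        rw [he', Sum.elim_inl, dif_pos hx']
        exact h m₁ s d _ hx
      · exact hg.elim
      · exact hg.elim)
  exact ⟨fun w => f w, fun y => dif_pos y.1.2, fun e => rfl⟩

theorem isQuotientMap_leftMap_rightMap (hC : IsClosed (S₁ ∪ S₂)) :
    IsQuotientMap (Sum.elim (c.leftMap K k) (c.rightMap K k)) := by
  refine (isQuotientMap_iff _).2 ⟨isCoinducing_iff.2 fun s => ⟨fun hs => ?_, fun hs => hs.preimage
    (Continuous.sumElim (c.leftMap K k).continuous (c.rightMap K k).continuous)⟩, fun w => ?_⟩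
  · obtain ⟨hl, hr⟩ := isOpen_sum_iff.1 hs
    obtain ⟨W, hW, hWl⟩ := isOpen_induced_iff.1 hl
    obtain ⟨W', hW', rfl⟩ := isOpen_induced_iff.1 hW
    have hval : IsOpen (Subtype.val '' s) := by
      refine isQuotientMap_quot_mk.isOpen_preimage.1 (isOpen_sum_iff.2 ⟨?_, ?_⟩)
      · convert (hW'.inter hC.isOpen_compl).preimage
          (continuous_subtype_val : Continuous fun x : c.torusExterior => (x : X)) using 1
        ext x
        constructor
        · rintro ⟨w, hw, hwx⟩
          have hx : (x : X) ∈ (S₁ ∪ S₂)ᶜ := fun h => w.2 (hwx ▸ ⟨x, h, rfl⟩)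
          have : c.leftMap K k ⟨⟨x, hx⟩, x.2⟩ = w := Subtype.ext hwx.symm
          refine ⟨?_, hx⟩
          have h' : (⟨⟨x, hx⟩, x.2⟩ : c.tubeComplement) ∈ c.leftMap K k ⁻¹' s := by
            rwa [Set.mem_preimage, this]
          exact (Set.ext_iff.1 hWl _).2 h'
        · rintro ⟨hx, hx'⟩
          exact ⟨c.leftMap K k ⟨⟨x, hx'⟩, x.2⟩, (Set.ext_iff.1 hWl ⟨⟨x, hx'⟩, x.2⟩).1 hx, rfl⟩
      · convert hr using 1
        ext e
        constructor
        · rintro ⟨w, hw, hwe⟩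
          have : c.rightMap K k e = w := Subtype.ext hwe.symm
          exact (this ▸ hw : c.rightMap K k e ∈ s)
        · exact fun h => ⟨_, h, rfl⟩
    have := hval.preimage (continuous_subtype_val (p := fun w => w ∈ (c.surgeredSurfaces K k)ᶜ))
    rwa [Set.preimage_image_eq _ Subtype.val_injective] at this
  · rcases c.leftMap_or_rightMap K k w with ⟨y, rfl⟩ | ⟨e, rfl⟩
    exacts [⟨Sum.inl y, rfl⟩, ⟨Sum.inr e, rfl⟩]

theorem continuousOn_of_leftMap_rightMap (hC : IsClosed (S₁ ∪ S₂)) {T : Type*} [TopologicalSpace T]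
    {f : c.SurgeredComplement K k → T} {O : Set (c.SurgeredComplement K k)} (hO : IsOpen O)
    (hl : ContinuousOn (f ∘ c.leftMap K k) (c.leftMap K k ⁻¹' O))
    (hr : Continuous (f ∘ c.rightMap K k)) : ContinuousOn f O := by
  refine ((c.isQuotientMap_leftMap_rightMap K k hC).continuousOn_isOpen_iff hO).2 ?_
  rintro (y | e) hz
  · refine ContinuousAt.continuousWithinAt ((IsOpenEmbedding.inl.continuousAt_iff (x := y)).1 ?_)
    exact hl.continuousAt ((hO.preimage (c.leftMap K k).continuous).mem_nhds hz)
  · exact ContinuousAt.continuousWithinAt ((IsOpenEmbedding.inr.continuousAt_iff (x := e)).1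
      hr.continuousAt)

/-! ### Polar coordinates at the double point -/

/-- Polar coordinates `(m₁, m₂, d)` in `ℂ²`, off the axes. The last one is chosen such that the
tube of the double point torus is given by `‖d‖ < 1`. -/
abbrev Polar : Type := Circle × Circle × {d : ℂ // -4 < d.re ∧ -4 < d.im}

/-- The change from polar coordinates to the coordinates of `ℂ²`. -/
noncomputable def polarHomeomorph : Polar ≃ₜ CStar × CStar where
  toFun p := (⟨((1 / 2 + p.2.2.1.re / 8 : ℝ) : ℂ) * p.2.1, mul_ne_zero
      (Complex.ofReal_ne_zero.2 (by linarith [p.2.2.2.1])) (Circle.coe_ne_zero _)⟩,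
    ⟨((1 / 2 + p.2.2.1.im / 8 : ℝ) : ℂ) * p.1, mul_ne_zero
      (Complex.ofReal_ne_zero.2 (by linarith [p.2.2.2.2])) (Circle.coe_ne_zero _)⟩)
  invFun q := (q.2.unitPart, q.1.unitPart, ⟨⟨8 * ‖(q.1 : ℂ)‖ - 4, 8 * ‖(q.2 : ℂ)‖ - 4⟩,
    by linarith [norm_pos_iff.2 q.1.2], by linarith [norm_pos_iff.2 q.2.2]⟩)
  left_inv p := by
    have h1 : (0 : ℝ) < 1 / 2 + p.2.2.1.re / 8 := by linarith [p.2.2.2.1]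
    have h2 : (0 : ℝ) < 1 / 2 + p.2.2.1.im / 8 := by linarith [p.2.2.2.2]
    have n1 : ‖((1 / 2 + p.2.2.1.re / 8 : ℝ) : ℂ) * p.2.1‖ = 1 / 2 + p.2.2.1.re / 8 := by
      rw [norm_mul, Circle.norm_coe, mul_one, Complex.norm_real, Real.norm_of_nonneg h1.le]
    have n2 : ‖((1 / 2 + p.2.2.1.im / 8 : ℝ) : ℂ) * p.1‖ = 1 / 2 + p.2.2.1.im / 8 := by
      rw [norm_mul, Circle.norm_coe, mul_one, Complex.norm_real, Real.norm_of_nonneg h2.le]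
    refine Prod.ext (Subtype.ext ?_) (Prod.ext (Subtype.ext ?_) (Subtype.ext ?_))
    · refine (CStar.coe_unitPart _).trans ?_
      rw [n2, mul_div_cancel_left₀ _ (Complex.ofReal_ne_zero.2 h2.ne')]
    · refine (CStar.coe_unitPart _).trans ?_
      rw [n1, mul_div_cancel_left₀ _ (Complex.ofReal_ne_zero.2 h1.ne')]
    · refine Complex.ext ?_ ?_
      · change 8 * ‖((1 / 2 + p.2.2.1.re / 8 : ℝ) : ℂ) * p.2.1‖ - 4 = _
        rw [n1]
        ring
      · change 8 * ‖((1 / 2 + p.2.2.1.im / 8 : ℝ) : ℂ) * p.1‖ - 4 = _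
        rw [n2]
        ring
  right_inv q := by
    refine Prod.ext (Subtype.ext ?_) (Subtype.ext ?_)
    · refine Eq.trans ?_ (CStar.norm_mul_unitPart q.1)
      change ((1 / 2 + (8 * ‖(q.1 : ℂ)‖ - 4) / 8 : ℝ) : ℂ) * q.1.unitPart = _
      congr 2
      ring
    · refine Eq.trans ?_ (CStar.norm_mul_unitPart q.2)
      change ((1 / 2 + (8 * ‖(q.2 : ℂ)‖ - 4) / 8 : ℝ) : ℂ) * q.2.unitPart = _
      congr 2
      ring
  continuous_toFun := by fun_prop
  continuous_invFun := by
    have := CStar.continuous_unitPart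
    refine Continuous.prodMk (by fun_prop) (Continuous.prodMk (by fun_prop)
      (Continuous.subtype_mk ?_ _))
    refine Complex.equivRealProdCLM.symm.continuous.comp (f := fun q : CStar × CStar =>
      (8 * ‖(q.1 : ℂ)‖ - 4, 8 * ‖(q.2 : ℂ)‖ - 4)) (by fun_prop)

/-- The complement of the configuration near the double point, in polar coordinates. -/
noncomputable def polarMap : C(Polar, ↥(S₁ ∪ S₂)ᶜ) :=
  c.quadrantMap.comp ⟨polarHomeomorph, polarHomeomorph.continuous⟩

theorem coe_polarMap (p : Polar) : (c.polarMap p : X) = c.torusTube p.1 p.2.1 p.2.2 := rfl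

theorem isOpenEmbedding_polarMap : IsOpenEmbedding c.polarMap :=
  c.isOpenEmbedding_quadrantMap.comp polarHomeomorph.isOpenEmbedding

theorem polarMap_mem_tubeComplement (p : Polar) :
    c.polarMap p ∈ c.tubeComplement ↔ 1 ≤ ‖(p.2.2 : ℂ)‖ := by
  constructor
  · intro h
    by_contra! hp
    exact h ⟨_, _, _, hp, rfl⟩
  · rintro h ⟨m₁, m₂, d, hd, hp⟩
    have : c.polarMap (m₁, m₂, ⟨d, bounds_of_norm_le_one hd.le⟩) = c.polarMap p := Subtype.ext hp
    have := c.isOpenEmbedding_polarMap.injective this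
    subst this
    exact absurd hd (not_lt.2 h)

/-- The surgered manifold is mapped back to the original one, since the exterior of a knot can
be mapped to the solid torus by an extension of the identification of the boundaries. -/
theorem exists_collapse (hC : IsClosed (S₁ ∪ S₂)) :
    ∃ F : C(c.SurgeredComplement K k, ↥(S₁ ∪ S₂)ᶜ), (∀ y, F (c.leftMap K k y) = y) ∧
      ∀ e, ∃ p : Polar, ‖(p.2.2 : ℂ)‖ ≤ 1 ∧ F (c.rightMap K k e) = c.polarMap p := by
  obtain ⟨ψ₁, h₁⟩ := K.exists_extension_meridian
  obtain ⟨ψ₂, hle, h₂⟩ := K.exists_extension_core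
  let g : K.exterior × Circle → Polar := fun e =>
    (ψ₁ e.1 * (e.2 ^ k)⁻¹, e.2, ⟨ψ₂ e.1, bounds_of_norm_le_one (hle _)⟩)
  have hg : Continuous g := by
    refine Continuous.prodMk (by fun_prop) (by fun_prop)
  obtain ⟨F, hl, hr⟩ := c.exists_lift K k (fun y => (y : ↥(S₁ ∪ S₂)ᶜ)) (fun e => c.polarMap (g e))
    fun m₁ m₂ d y hy => Subtype.ext (hy.trans (by
      rw [coe_polarMap]
      simp only [g, h₁, h₂, mul_inv_cancel_right]))
  refine ⟨⟨F, continuousOn_univ.1 (c.continuousOn_of_leftMap_rightMap K k hC isOpen_univ ?_ ?_)⟩,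
    hl, fun e => ⟨g e, hle _, hr e⟩⟩
  · rw [show F ∘ c.leftMap K k = Subtype.val from funext hl]
    exact continuous_subtype_val.continuousOn
  · rw [show F ∘ c.rightMap K k = c.polarMap ∘ g from funext hr]
    exact c.polarMap.continuous.comp hg

end DoublePointChart

end

section

/-! ### Decomposing the complement of the surfaces in the surgered manifold -/

theorem exists_path_subtype {Y : Type*} [TopologicalSpace Y] {U : Set Y} {x y : Y} (p : Path x y)
    (hp : ∀ t, p t ∈ U) : ∃ (hx : x ∈ U) (hy : y ∈ U) (p' : Path (⟨x, hx⟩ : U) ⟨y, hy⟩),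
      ∀ t, (p' t : Y) = p t :=
  ⟨by simpa using hp 0, by simpa using hp 1, ⟨⟨fun t => ⟨p t, hp t⟩, by fun_prop⟩, by simp, by simp⟩,
    fun _ => rfl⟩

namespace Holonomy

/-- The generation half of the Seifert–van Kampen theorem, for sets that can be deformed. Suppose
that `U₁`, `U₂` cover the space, and that they are deformed to the images of maps `j₁`, `j₂`,
along whose paths the holonomy lies, after a gauge transformation, in the subgroup `M`. If moreover
`U₁ ∩ U₂` is path connected, and the two gauges are compatible at one of its points, then
the holonomy of loops at that point lies in `M`, in the gauge given there. -/
theorem gauge_of_homotopies {Y Y₁ Y₂ A : Type*} [TopologicalSpace Y] [TopologicalSpace Y₁]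
    [TopologicalSpace Y₂] [Group A] (ρ : Holonomy Y A) {U₁ U₂ : Set Y} (h₁ : IsOpen U₁)
    (h₂ : IsOpen U₂) (hcov : ∀ y, y ∈ U₁ ∨ y ∈ U₂) (M : Subgroup A)
    {r₁ : C(U₁, Y₁)} {j₁ : C(Y₁, Y)}
    (F₁ : (⟨Subtype.val, continuous_subtype_val⟩ : C(U₁, Y)).Homotopy (j₁.comp r₁)) (v₁ : Y₁ → A)
    (hv₁ : ∀ {x y : Y₁} (p : Path x y), (v₁ x)⁻¹ * ρ.val (p.map j₁.continuous) * v₁ y ∈ M)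
    {r₂ : C(U₂, Y₂)} {j₂ : C(Y₂, Y)}
    (F₂ : (⟨Subtype.val, continuous_subtype_val⟩ : C(U₂, Y)).Homotopy (j₂.comp r₂)) (v₂ : Y₂ → A)
    (hv₂ : ∀ {x y : Y₂} (p : Path x y), (v₂ x)⁻¹ * ρ.val (p.map j₂.continuous) * v₂ y ∈ M)
    (hU : IsPathConnected (U₁ ∩ U₂)) {w : Y} (hw₁ : w ∈ U₁) (hw₂ : w ∈ U₂)
    (hw : (ρ.val (F₁.evalAt ⟨w, hw₁⟩) * v₁ (r₁ ⟨w, hw₁⟩))⁻¹ *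
      (ρ.val (F₂.evalAt ⟨w, hw₂⟩) * v₂ (r₂ ⟨w, hw₂⟩)) ∈ M) (p : Path w w) :
    (ρ.val (F₁.evalAt ⟨w, hw₁⟩) * v₁ (r₁ ⟨w, hw₁⟩))⁻¹ * ρ.val p *
      (ρ.val (F₁.evalAt ⟨w, hw₁⟩) * v₁ (r₁ ⟨w, hw₁⟩)) ∈ M := by
  classical
  let u₁ : Y → A := fun y => if h : y ∈ U₁ then ρ.val (F₁.evalAt ⟨y, h⟩) * v₁ (r₁ ⟨y, h⟩) else 1
  let u₂ : Y → A := fun y => if h : y ∈ U₂ then ρ.val (F₂.evalAt ⟨y, h⟩) * v₂ (r₂ ⟨y, h⟩) else 1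
  have e₁ : ∀ {y} (h : y ∈ U₁), u₁ y = ρ.val (F₁.evalAt ⟨y, h⟩) * v₁ (r₁ ⟨y, h⟩) :=
    fun h => dif_pos h
  have e₂ : ∀ {y} (h : y ∈ U₂), u₂ y = ρ.val (F₂.evalAt ⟨y, h⟩) * v₂ (r₂ ⟨y, h⟩) :=
    fun h => dif_pos h
  have hu₁ : ∀ {x y : Y} (p : Path x y), (∀ t, p t ∈ U₁) → (u₁ x)⁻¹ * ρ.val p * u₁ y ∈ M := by
    intro x y p hp
    obtain ⟨hx, hy, p', hp'⟩ := exists_path_subtype p hp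
    have h := ρ.val_map_eq F₁ p'
    rw [ρ.val_congr (p'.map (⟨Subtype.val, continuous_subtype_val⟩ : C(U₁, Y)).continuous) p hp'] at h
    rw [e₁ hx, e₁ hy, h]
    convert hv₁ (p'.map r₁.continuous) using 1
    have : ρ.val ((p'.map r₁.continuous).map j₁.continuous) =
      ρ.val (p'.map (j₁.comp r₁).continuous) := ρ.val_congr _ _ fun t => rfl
    rw [this]
    group
  have hu₂ : ∀ {x y : Y} (p : Path x y), (∀ t, p t ∈ U₂) → (u₂ x)⁻¹ * ρ.val p * u₂ y ∈ M := by
    intro x y p hp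
    obtain ⟨hx, hy, p', hp'⟩ := exists_path_subtype p hp
    have h := ρ.val_map_eq F₂ p'
    rw [ρ.val_congr (p'.map (⟨Subtype.val, continuous_subtype_val⟩ : C(U₂, Y)).continuous) p hp'] at h
    rw [e₂ hx, e₂ hy, h]
    convert hv₂ (p'.map r₂.continuous) using 1
    have : ρ.val ((p'.map r₂.continuous).map j₂.continuous) =
      ρ.val (p'.map (j₂.comp r₂).continuous) := ρ.val_congr _ _ fun t => rfl
    rw [this]
    group
  rw [← e₁ hw₁]
  refine ρ.gauge_of_cover h₁ h₂ hcov M u₁ u₂ hu₁ hu₂ (fun x hx₁ hx₂ => ?_) hw₁ hw₁ p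
  obtain ⟨q, hq⟩ := hU.joinedIn x ⟨hx₁, hx₂⟩ w ⟨hw₁, hw₂⟩
  have i₁ := hu₁ q fun t => (hq t).1
  have i₂ := hu₂ q fun t => (hq t).2
  rw [← e₁ hw₁, ← e₂ hw₂] at hw
  have := M.mul_mem (M.mul_mem i₁ hw) (M.inv_mem i₂)
  convert this using 1
  group

/-- If the holonomy of the loops at one point lies in a subgroup, then so does that of all paths, in
a suitable gauge. -/
theorem exists_gauge {Y A : Type*} [TopologicalSpace Y] [PathConnectedSpace Y] [Group A]
    (ρ : Holonomy Y A) (M : Subgroup A) (y₀ : Y) (b : A)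
    (h : ∀ p : Path y₀ y₀, b⁻¹ * ρ.val p * b ∈ M) :
    ∃ v : Y → A, v y₀ = b ∧ ∀ {x y : Y} (p : Path x y), (v x)⁻¹ * ρ.val p * v y ∈ M := by
  refine ⟨fun y => (ρ.val (basePath y₀ y))⁻¹ * b, ?_, fun {x y} p => ?_⟩
  · simp only [basePath_self, val_refl, inv_one, one_mul]
  · have := h (((basePath y₀ x).trans p).trans (basePath y₀ y).symm)
    rw [val_trans, val_trans, val_symm] at this
    convert this using 1
    group

end Holonomy

namespace DoublePointChart

/-- The polar coordinates of the points outside of the tube of the double point torus. -/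
abbrev OuterPolar : Type := {p : Polar // 1 ≤ ‖(p.2.2 : ℂ)‖}

/-- The direction from the double point torus, in polar coordinates. -/
noncomputable def direction (p : OuterPolar) : Circle :=
  CStar.unitPart ⟨p.1.2.2, fun h => by
    have := p.2
    rw [h, norm_zero] at this
    linarith⟩

theorem continuous_direction : Continuous direction :=
  CStar.continuous_unitPart.comp (Continuous.subtype_mk (by fun_prop) _)

theorem coe_direction (p : OuterPolar) :
    (direction p : ℂ) = (p.1.2.2 : ℂ) / ‖(p.1.2.2 : ℂ)‖ := rfl

theorem direction_eq {p : OuterPolar} {d : Circle} (h : (p.1.2.2 : ℂ) = d) : direction p = d := by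
  refine Subtype.ext ((coe_direction p).trans ?_)
  rw [h, Circle.norm_coe, Complex.ofReal_one, div_one]

/-- The factor `(1 - t) + t / ‖d‖` of the contraction. -/
noncomputable def contractFactor (t : I) (d : ℂ) : ℝ := (1 - t) + t * ‖d‖⁻¹

theorem contractFactor_bounds (t : I) {d : ℂ} (hd : 1 ≤ ‖d‖) :
    0 ≤ contractFactor t d ∧ contractFactor t d ≤ 1 := by
  have h1 : ‖d‖⁻¹ ≤ 1 := inv_le_one_of_one_le₀ hd
  have h2 : 0 ≤ ‖d‖⁻¹ := by positivity
  have := t.2.1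
  have := t.2.2
  unfold contractFactor
  constructor <;> nlinarith

theorem contractFactor_mul_norm (t : I) {d : ℂ} (hd : 1 ≤ ‖d‖) :
    contractFactor t d * ‖d‖ = (1 - t) * ‖d‖ + t := by
  rw [contractFactor, add_mul, mul_assoc, inv_mul_cancel₀ (by linarith), mul_one]

/-- The radial contraction, in polar coordinates, of the complement of the tube of the double
point torus to the boundary of the tube. -/
noncomputable def contract (a : I × OuterPolar) : OuterPolar :=
  ⟨(a.2.1.1, a.2.1.2.1, ⟨(contractFactor a.1 a.2.1.2.2 : ℂ) * a.2.1.2.2, by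
      obtain ⟨h0, h1⟩ := contractFactor_bounds a.1 a.2.2
      have h (x : ℝ) (hx : -4 < x) : -4 < contractFactor a.1 a.2.1.2.2 * x := by
        rcases le_total 0 x with hx' | hx' <;> nlinarith
      rw [Complex.re_ofReal_mul, Complex.im_ofReal_mul]
      exact ⟨h _ a.2.1.2.2.2.1, h _ a.2.1.2.2.2.2⟩⟩), by
    change 1 ≤ ‖(contractFactor a.1 a.2.1.2.2 : ℂ) * a.2.1.2.2‖
    rw [norm_mul, Complex.norm_real, Real.norm_of_nonneg (contractFactor_bounds a.1 a.2.2).1,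
      contractFactor_mul_norm _ a.2.2]
    nlinarith [a.1.2.1, a.1.2.2, a.2.2]⟩

theorem continuous_contract : Continuous contract := by
  refine Continuous.subtype_mk (Continuous.prodMk (by fun_prop) (Continuous.prodMk (by fun_prop)
    (Continuous.subtype_mk (Continuous.mul (Complex.continuous_ofReal.comp ?_) (by fun_prop)) _))) _
  exact Continuous.add (by fun_prop) (Continuous.mul (by fun_prop)
    (Continuous.inv₀ (by fun_prop) fun a => by linarith [a.2.2]))

theorem contract_eq_self {t : I} {p : OuterPolar} (h : contractFactor t p.1.2.2 = 1) :
    contract (t, p) = p := by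
  refine Subtype.ext (Prod.ext rfl (Prod.ext rfl (Subtype.ext ?_)))
  change (contractFactor t p.1.2.2 : ℂ) * p.1.2.2 = p.1.2.2
  rw [h, Complex.ofReal_one, one_mul]

theorem contract_zero (p : OuterPolar) : contract (0, p) = p :=
  contract_eq_self (by simp [contractFactor])

theorem contract_of_norm_eq_one (t : I) {p : OuterPolar} (h : ‖(p.1.2.2 : ℂ)‖ = 1) :
    contract (t, p) = p :=
  contract_eq_self (by simp [contractFactor, h])

theorem coe_contract_one (p : OuterPolar) : ((contract (1, p)).1.2.2 : ℂ) = direction p := by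
  change (contractFactor 1 p.1.2.2 : ℂ) * p.1.2.2 = _
  rw [coe_direction, contractFactor, div_eq_inv_mul]
  simp

variable {X : Type*} [TopologicalSpace X] {S₁ S₂ : Set X} (c : DoublePointChart S₁ S₂)
  (K : Knot) (k : ℤ)

/-- The complement of the configuration near the double point and outside of the tube, in polar
coordinates. -/
noncomputable def outerMap : C(OuterPolar, c.tubeComplement) where
  toFun p := ⟨c.polarMap p, (c.polarMap_mem_tubeComplement _).2 p.2⟩
  continuous_toFun := by fun_prop

theorem exists_outerMap_eq (y : c.tubeComplement) (p : Polar) (h : c.polarMap p = y) :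
    ∃ hp, c.outerMap ⟨p, hp⟩ = y :=
  ⟨(c.polarMap_mem_tubeComplement p).1 (h ▸ y.2), Subtype.ext h⟩

theorem isOpenEmbedding_outerMap : IsOpenEmbedding c.outerMap := by
  refine ⟨IsEmbedding.of_comp c.outerMap.continuous continuous_subtype_val
    (c.isOpenEmbedding_polarMap.isEmbedding.comp IsEmbedding.subtypeVal), ?_⟩
  have : Set.range c.outerMap = Subtype.val ⁻¹' Set.range c.polarMap := by
    ext y
    constructor
    · rintro ⟨p, rfl⟩; exact ⟨_, rfl⟩
    · rintro ⟨p, hp⟩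
      obtain ⟨h, h'⟩ := c.exists_outerMap_eq y p hp
      exact ⟨_, h'⟩
  rw [this]
  exact c.isOpenEmbedding_polarMap.isOpen_range.preimage continuous_subtype_val

theorem exists_outerMap_of_eq_torusTube (m₁ m₂ d : Circle) (y : c.tubeComplement)
    (hy : (y : X) = c.torusTube m₁ m₂ d) :
    ∃ p : OuterPolar, c.outerMap p = y ∧ p.1.1 = m₁ ∧ p.1.2.1 = m₂ ∧ (p.1.2.2 : ℂ) = d :=
  ⟨⟨(m₁, m₂, ⟨d, bounds_of_norm_le_one (Circle.norm_coe d).le⟩), (Circle.norm_coe d).ge⟩,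
    Subtype.ext (Subtype.ext hy.symm), rfl, rfl, rfl⟩

theorem continuous_contract_path (y : c.tubeComplement) :
    Continuous fun t : I => extendById c.outerMap contract (t, y) := by
  by_cases h : ∃ p, c.outerMap p = y
  · obtain ⟨p, rfl⟩ := h
    simp only [extendById_apply c.isOpenEmbedding_outerMap.injective]
    exact c.outerMap.continuous.comp (continuous_contract.comp (by fun_prop))
  · simp only [extendById_of_notMem _ _ h]
    exact continuous_const

theorem continuousOn_range_of_isOpenEmbedding {Q Y Z : Type*} [TopologicalSpace Q]
    [TopologicalSpace Y] [TopologicalSpace Z] {e : Q → Y} (he : IsOpenEmbedding e) {f : Y → Z}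
    (hf : Continuous (f ∘ e)) : ContinuousOn f (Set.range e) := by
  rintro _ ⟨q, rfl⟩
  exact (he.continuousAt_iff.1 hf.continuousAt).continuousWithinAt

/-- Near the double point, the complement of the surfaces in the surgered manifold is deformed to
the product of the knot exterior and the circle. -/
theorem exists_deformation_near (hC : IsClosed (S₁ ∪ S₂))
    {F : C(c.SurgeredComplement K k, ↥(S₁ ∪ S₂)ᶜ)} (hF : ∀ y, F (c.leftMap K k y) = y) :
    ∃ r : C(F ⁻¹' Set.range c.polarMap, K.exterior × Circle),
      Nonempty ((⟨Subtype.val, continuous_subtype_val⟩ :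
        C(F ⁻¹' Set.range c.polarMap, c.SurgeredComplement K k)).Homotopy
          ((c.rightMap K k).comp r)) ∧
      ∀ (p : OuterPolar) (h : c.leftMap K k (c.outerMap p) ∈ F ⁻¹' Set.range c.polarMap),
        r ⟨_, h⟩ = (K.boundaryTorus (direction p, p.1.1 * p.1.2.1 ^ k), p.1.2.1) := by
  have hinj := c.isOpenEmbedding_outerMap.injective
  set O := F ⁻¹' Set.range c.polarMap
  have hO : IsOpen O := c.isOpenEmbedding_polarMap.isOpen_range.preimage F.continuous
  have hlO : c.leftMap K k ⁻¹' O = Set.range c.outerMap := by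
    ext y
    constructor
    · rintro ⟨p, hp⟩
      obtain ⟨h, h'⟩ := c.exists_outerMap_eq y p (hp.trans (hF y))
      exact ⟨_, h'⟩
    · rintro ⟨p, rfl⟩
      exact ⟨p, (hF (c.outerMap p)).symm⟩
  -- the end of the deformation
  let g : OuterPolar → K.exterior × Circle := fun p =>
    (K.boundaryTorus (direction p, p.1.1 * p.1.2.1 ^ k), p.1.2.1)
  have hg : Continuous g := by
    have := continuous_direction
    fun_prop
  obtain ⟨r, hrl, hrr⟩ := c.exists_lift K k
    (Function.extend c.outerMap g fun _ => (K.boundaryTorus 1, 1)) id fun m₁ m₂ d y hy => by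
      obtain ⟨p, rfl, hp₁, hp₂, hpd⟩ := c.exists_outerMap_of_eq_torusTube m₁ m₂ d y hy
      rw [hinj.extend_apply]
      simp only [g, direction_eq hpd, hp₁, hp₂, id]
  have hrO : ContinuousOn r O := by
    refine c.continuousOn_of_leftMap_rightMap K k hC hO ?_ ?_
    · rw [hlO, show r ∘ c.leftMap K k = _ from funext hrl]
      refine continuousOn_range_of_isOpenEmbedding c.isOpenEmbedding_outerMap ?_
      rwa [Function.extend_comp hinj]
    · rw [show r ∘ c.rightMap K k = id from funext hrr]
      exact continuous_id
  -- the tracks of the deformation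
  obtain ⟨T, hTl, hTr⟩ := c.exists_lift K k (T := C(I, c.SurgeredComplement K k))
    (fun y => ⟨fun t => c.leftMap K k (extendById c.outerMap contract (t, y)),
      (c.leftMap K k).continuous.comp (c.continuous_contract_path y)⟩)
    (fun e => ContinuousMap.const I (c.rightMap K k e)) fun m₁ m₂ d y hy => by
      obtain ⟨p, rfl, hp₁, hp₂, hpd⟩ := c.exists_outerMap_of_eq_torusTube m₁ m₂ d y hy
      ext1 t
      change c.leftMap K k (extendById c.outerMap contract (t, c.outerMap p)) = c.rightMap K k _
      rw [extendById_apply hinj, contract_of_norm_eq_one t (by rw [hpd, Circle.norm_coe])]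
      exact c.leftMap_eq_rightMap K k m₁ m₂ d _ hy
  have hTO : ContinuousOn T O := by
    refine c.continuousOn_of_leftMap_rightMap K k hC hO ?_ ?_
    · rw [hlO]
      refine continuousOn_range_of_isOpenEmbedding c.isOpenEmbedding_outerMap ?_
      have : (T ∘ c.leftMap K k) ∘ c.outerMap = ContinuousMap.curry
          ⟨fun a : OuterPolar × I => c.leftMap K k (c.outerMap (contract (a.2, a.1))),
            (c.leftMap K k).continuous.comp (c.outerMap.continuous.comp
              (continuous_contract.comp (by fun_prop)))⟩ := by
        funext p
        ext1 t
        change T (c.leftMap K k (c.outerMap p)) t = _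
        rw [hTl]
        exact congrArg (c.leftMap K k) (extendById_apply hinj contract t p)
      rw [this]
      exact ContinuousMap.continuous _
    · rw [show T ∘ c.rightMap K k = _ from funext hTr]
      exact ContinuousMap.continuous_const'.comp (c.rightMap K k).continuous
  have hT := continuousOn_iff_continuous_domRestrict.1 hTO
  refine ⟨⟨O.domRestrict r, continuousOn_iff_continuous_domRestrict.1 hrO⟩,
    ⟨⟨⟨fun a => T a.2 a.1, ?_⟩, fun w => ?_, fun w => ?_⟩⟩, fun p h => ?_⟩
  · exact (hT.comp continuous_snd).eval continuous_fst
  · change T w 0 = w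
    rcases c.leftMap_or_rightMap K k w with ⟨y, hy⟩ | ⟨e, he⟩
    · rw [← hy, hTl]
      obtain ⟨p, rfl⟩ : y ∈ Set.range c.outerMap := by
        rw [← hlO, Set.mem_preimage, hy]
        exact w.2
      change c.leftMap K k (extendById c.outerMap contract (0, c.outerMap p)) = _
      rw [extendById_apply hinj, contract_zero]
    · rw [← he, hTr]
      rfl
  · change T w 1 = c.rightMap K k (r w)
    rcases c.leftMap_or_rightMap K k w with ⟨y, hy⟩ | ⟨e, he⟩
    · rw [← hy, hTl, hrl]
      obtain ⟨p, rfl⟩ : y ∈ Set.range c.outerMap := by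
        rw [← hlO, Set.mem_preimage, hy]
        exact w.2
      change c.leftMap K k (extendById c.outerMap contract (1, c.outerMap p)) = _
      rw [extendById_apply hinj, hinj.extend_apply]
      refine c.leftMap_eq_rightMap K k _ _ _ _ ?_
      change c.torusTube p.1.1 p.1.2.1 (contract (1, p)).1.2.2 = _
      rw [coe_contract_one]
    · rw [← he, hTr, hrr]
      rfl
  · change r (c.leftMap K k (c.outerMap p)) = _
    rw [hrl, hinj.extend_apply]

end DoublePointChart

end

section

/-! ### The product of a knot exterior and the circle -/

namespace Holonomy

variable {Y Z A : Type*} [TopologicalSpace Y] [TopologicalSpace Z] [Group A]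

/-- The homomorphism of the fundamental group given by a holonomy. Inverses are taken as the product
of the fundamental group reverses the concatenation of paths. -/
noncomputable def monodromy (ρ : Holonomy Y A) (y₀ : Y) : FundamentalGroup Y y₀ →* A where
  toFun g := Quotient.lift (fun p : Path y₀ y₀ => (ρ.val p)⁻¹)
    (fun _ _ h => congrArg _ (ρ.val_eq_of_homotopic h)) (FundamentalGroup.toPath g)
  map_one' := inv_eq_one.2 (ρ.val_refl y₀)
  map_mul' g h := by
    induction g using Path.Homotopic.Quotient.ind with
    | mk p =>
    induction h using Path.Homotopic.Quotient.ind with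
    | mk q =>
    change (ρ.val (q.trans p))⁻¹ = (ρ.val p)⁻¹ * (ρ.val q)⁻¹
    rw [ρ.val_trans, mul_inv_rev]

/-- The two factors of a product commute. -/
theorem val_prod_comm (ρ : Holonomy (Y × Z) A) {y : Y} {z : Z} (p : Path y y) (q : Path z z) :
    ρ.val (p.prod (Path.refl z)) * ρ.val ((Path.refl y).prod q) =
      ρ.val ((Path.refl y).prod q) * ρ.val (p.prod (Path.refl z)) := by
  rw [← val_prod]
  let κ := ρ.comap (⟨Prod.swap, continuous_swap⟩ : C(Z × Y, Y × Z))
  have h := κ.val_prod q p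
  have h1 : κ.val (q.prod p) = ρ.val (p.prod q) := ρ.val_congr _ _ fun _ => rfl
  have h2 : κ.val (q.prod (Path.refl y)) = ρ.val ((Path.refl y).prod q) :=
    ρ.val_congr _ _ fun _ => rfl
  have h3 : κ.val ((Path.refl z).prod p) = ρ.val (p.prod (Path.refl z)) :=
    ρ.val_congr _ _ fun _ => rfl
  rw [← h1, h, h2, h3]

theorem val_stdLoop_zpow (ρ : Holonomy Circle A) (k : ℤ) :
    (ρ.comap ⟨fun m => m ^ k, by fun_prop⟩).val stdLoop = ρ.val stdLoop ^ k := by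
  have step (k : ℤ) : (ρ.comap ⟨fun m => m ^ (k + 1), by fun_prop⟩).val stdLoop =
      (ρ.comap ⟨fun m => m ^ k, by fun_prop⟩).val stdLoop * ρ.val stdLoop := by
    let f : C(Circle × Circle, Circle) := ⟨fun q => q.1 ^ k * q.2, by fun_prop⟩
    have h := (ρ.comap f).val_prod stdLoop stdLoop
    refine ((ρ.val_congr _ _ fun t => ?_).trans h).trans
      (congrArg₂ (· * ·) (ρ.val_congr _ _ fun t => ?_) (ρ.val_congr _ _ fun t => ?_))
    · exact zpow_add_one _ _
    · exact mul_one _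
    · change (1 : Circle) ^ k * stdLoop t = stdLoop t
      rw [one_zpow, one_mul]
  induction k with
  | zero =>
    rw [zpow_zero]
    refine Eq.trans (ρ.val_congr _ (Path.refl 1) fun t => ?_) (ρ.val_refl 1)
    exact zpow_zero _
  | succ n ih => rw [step, ih, zpow_add_one]
  | pred n ih =>
    have h := step (-(n : ℤ) - 1)
    simp only [sub_add_cancel] at h
    rw [zpow_sub_one, ← ih, h, mul_inv_cancel_right]

end Holonomy

namespace Knot

variable (K : Knot)

/-- The curve `m ↦ (μ_K (m ^ k), m)` in the product of the knot exterior and the circle, over the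
point `a` of the knot: under the `k`-twisted gluing it is the second factor of the torus. -/
noncomputable def twistedCircle (k : ℤ) (a : Circle) : C(Circle, K.exterior × Circle) :=
  ⟨fun m => (K.boundaryTorus (a, m ^ k), m), by fun_prop⟩

/-- The meridian, in the product of the knot exterior and the circle. -/
noncomputable def meridianCircle (a : Circle) : C(Circle, K.exterior × Circle) :=
  ⟨fun b => (K.boundaryTorus (a, b), 1), by fun_prop⟩

/-- Let `x` and `y` be the holonomies of the meridian and of the factor `S¹` of the product of the
knot exterior and the circle. If `x` is a power of `y`, it is central in the holonomy group, as
`y` is. As the meridian normally generates the knot group, all holonomies are powers of `y`. -/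
theorem val_mem_zpowers {A : Type*} [Group A] (ρ : Holonomy (K.exterior × Circle) A) (k : ℤ)
    (a : Circle) {x x₂ : A} (hx : (ρ.comap (K.meridianCircle a)).val stdLoop = x)
    (hx₂ : (ρ.comap (K.twistedCircle k a)).val stdLoop = x₂)
    (h : x ∈ Subgroup.zpowers (x ^ (-k) * x₂))
    (p : Path (K.boundaryTorus (a, 1), (1 : Circle)) (K.boundaryTorus (a, 1), 1)) :
    ρ.val p ∈ Subgroup.zpowers (x ^ (-k) * x₂) := by
  set ρE := ρ.comap (⟨fun e => (e, 1), by fun_prop⟩ : C(K.exterior, K.exterior × Circle)) with hρE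
  set ρS := ρ.comap (⟨fun s => (K.boundaryTorus (a, 1), s), by fun_prop⟩ :
    C(Circle, K.exterior × Circle)) with hρS
  have hE {e e' : K.exterior} (q : Path e e') : ρ.val (q.prod (Path.refl (1 : Circle))) = ρE.val q :=
    ρ.val_congr _ _ fun _ => rfl
  have hS (q : Path (1 : Circle) 1) :
      ρ.val ((Path.refl (K.boundaryTorus (a, 1))).prod q) = ρS.val q :=
    ρ.val_congr _ _ fun _ => rfl
  have hy : x ^ (-k) * x₂ = ρS.val stdLoop := by
    have h1 := (ρE.comap (K.meridian a)).val_stdLoop_zpow k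
    have h2 : (ρE.comap (K.meridian a)).val stdLoop = x := hx ▸ ρ.val_congr _ _ fun _ => rfl
    rw [h2] at h1
    have h3 := (ρ.comap (⟨fun q : Circle × Circle => (K.boundaryTorus (a, q.1 ^ k), q.2),
      by fun_prop⟩ : C(Circle × Circle, K.exterior × Circle))).val_prod stdLoop stdLoop
    rw [zpow_neg, inv_mul_eq_iff_eq_mul, ← hx₂, ← h1]
    refine ((ρ.val_congr _ _ fun t => rfl).trans h3).trans
      (congrArg₂ (· * ·) (ρ.val_congr _ _ fun t => rfl) (ρ.val_congr _ _ fun t => ?_))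
    change (K.boundaryTorus (a, (1 : Circle) ^ k), stdLoop t) = (K.boundaryTorus (a, 1), stdLoop t)
    rw [one_zpow]
  rw [hy] at h ⊢
  have hcomm (q : Path (K.boundaryTorus (a, 1)) (K.boundaryTorus (a, 1))) :
      ρE.val q * x = x * ρE.val q := by
    obtain ⟨n, hn⟩ := Subgroup.mem_zpowers_iff.1 h
    have := ρ.val_prod_comm q (stdLoop : Path (1 : Circle) 1)
    rw [hE, hS] at this
    rw [← hn]
    exact (Commute.zpow_right this n).eq
  let φ := ρE.monodromy (K.meridian a 1)
  have hN : ((Subgroup.zpowers x).comap φ).Normal := ⟨fun g hg u => by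
    rw [Subgroup.mem_comap, map_mul, map_mul, map_inv]
    have : Commute (φ u) x := by
      induction u using Path.Homotopic.Quotient.ind with
      | mk q => exact Commute.inv_left (show Commute (ρE.val q) x from hcomm q)
    obtain ⟨n, hn⟩ := Subgroup.mem_zpowers_iff.1 (Subgroup.mem_comap.1 hg)
    rw [← hn, (this.zpow_right n).eq, mul_inv_cancel_right]
    exact ⟨n, rfl⟩⟩
  have htop : (Subgroup.zpowers x).comap φ = ⊤ := by
    rw [eq_top_iff, ← K.normalClosure_meridian a]
    refine Subgroup.normalClosure_le_normal ?_
    rintro _ rfl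
    rw [SetLike.mem_coe, Subgroup.mem_comap]
    have hm : ρE.val (circleLoop (K.meridian a)) = x := Eq.trans (ρ.val_congr _ _ fun _ => rfl) hx
    have : φ (circleClass (K.meridian a)) = x⁻¹ := congrArg (·⁻¹) hm
    rw [this]
    exact inv_mem (Subgroup.mem_zpowers x)
  have hp : ρ.val p = ρ.val ((p.map continuous_fst).prod (p.map continuous_snd)) :=
    ρ.val_congr _ _ fun t => rfl
  rw [hp, ρ.val_prod]
  refine mul_mem ?_ ?_
  · have := htop.ge (Subgroup.mem_top (FundamentalGroup.fromPath
      (Path.Homotopic.Quotient.mk (p.map continuous_fst))))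
    have h' : ρE.val (p.map continuous_fst) ∈ Subgroup.zpowers x := inv_mem_iff.1 this
    exact (Subgroup.zpowers_le.2 h) ((hE _).symm ▸ h')
  · obtain ⟨n, hn⟩ := ρS.exists_val_eq_zpow_circle (p.map continuous_snd)
    exact ⟨n, (hn.symm.trans (hS _).symm)⟩

end Knot

end

section

/-! ### The group of the surgered configuration -/

/-- A homeomorphism induces a bijection of fundamental groups. -/
theorem bijective_map_homeomorph {Y Z : Type*} [TopologicalSpace Y] [TopologicalSpace Z]
    [PathConnectedSpace Y] (f : Y ≃ₜ Z) (y : Y) :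
    Function.Bijective (FundamentalGroup.map (⟨f, f.continuous⟩ : C(Y, Z)) y) := by
  refine ⟨(injective_iff_map_eq_one _).2 fun g hg => ?_, fun g => ?_⟩
  · induction g using Path.Homotopic.Quotient.ind with
    | mk p =>
    have hp : (p.map f.continuous).Homotopic (Path.refl _) := Path.Homotopic.Quotient.exact hg
    set ρ := Holonomy.tautological (basePath y)
    let s : C(Z, Y) := ⟨f.symm, f.symm.continuous⟩
    have h : ρ.val p = 1 := ((ρ.val_congr _ ((p.map f.continuous).map s.continuous)
      fun t => (f.symm_apply_apply (p t)).symm).trans ((ρ.comap s).val_eq_of_homotopic hp)).trans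
        ((ρ.comap s).val_refl _)
    rw [Holonomy.tautological_val, inv_eq_one] at h
    exact h
  · induction g using Path.Homotopic.Quotient.ind with
    | mk q =>
    change Path (f y) (f y) at q
    refine ⟨FundamentalGroup.fromPath (Path.Homotopic.Quotient.mk ((q.map f.symm.continuous).cast
      (f.symm_apply_apply y).symm (f.symm_apply_apply y).symm)), ?_⟩
    refine congrArg Path.Homotopic.Quotient.mk (Path.ext (funext fun t => ?_))
    exact f.apply_symm_apply (q t)

namespace DoublePointChart

theorem normSq_polarHomeomorph (p : Polar) : normSq (polarHomeomorph p) =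
    (1 / 2 + (p.2.2 : ℂ).re / 8) ^ 2 + (1 / 2 + (p.2.2 : ℂ).im / 8) ^ 2 := by
  change ‖((1 / 2 + p.2.2.1.re / 8 : ℝ) : ℂ) * p.2.1‖ ^ 2 +
    ‖((1 / 2 + p.2.2.1.im / 8 : ℝ) : ℂ) * p.1‖ ^ 2 = _
  rw [norm_mul, norm_mul, Circle.norm_coe, Circle.norm_coe, mul_one, mul_one, Complex.norm_real,
    Complex.norm_real, Real.norm_eq_abs, Real.norm_eq_abs, sq_abs, sq_abs]

/-- The radial projection of the double point torus to the unit sphere, in polar coordinates: the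
point `(m₁, m₂)` goes to `(m₂ / √2, m₁ / √2)`. -/
noncomputable def sphereTorus (m₁ m₂ : Circle) : OuterPolar :=
  ⟨(m₁, m₂, ⟨⟨4 * √2 - 4, 4 * √2 - 4⟩, by
    have := Real.sqrt_pos.2 (zero_lt_two (α := ℝ))
    constructor <;> linarith⟩), by
    refine le_trans ?_ (Complex.re_le_norm _)
    have : (5 / 4 : ℝ) ≤ √2 := Real.le_sqrt_of_sq_le (by norm_num)
    change 1 ≤ 4 * √2 - 4
    linarith⟩

variable {X : Type*} [TopologicalSpace X] {S₁ S₂ : Set X} (c : DoublePointChart S₁ S₂)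
  (K : Knot) (k : ℤ)

/-- The complement of the configuration outside of a ball that is smaller than the unit ball but
contains the tube of the double point torus. -/
def farPart : Set ↥(S₁ ∪ S₂)ᶜ := {y | (y : X) ∉ c.toFun '' {p | ‖p.1‖ ^ 2 + ‖p.2‖ ^ 2 ≤ 4 / 5}}

theorem quadrantMap_mem_farPart (q : CStar × CStar) :
    c.quadrantMap q ∈ c.farPart ↔ 4 / 5 < normSq q := by
  constructor
  · intro h
    by_contra! hq
    exact h ⟨_, hq, rfl⟩
  · rintro h ⟨p, hp, hpq⟩
    have := c.isOpenEmbedding.injective hpq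
    subst this
    exact absurd hp (not_le.2 h)

theorem mem_farPart_of_notMem {y : ↥(S₁ ∪ S₂)ᶜ} (hy : ¬ ∃ q, c.quadrantMap q = y) :
    y ∈ c.farPart := by
  rintro ⟨p, -, hp⟩
  exact hy (c.exists_quadrantMap_eq y ⟨p, hp⟩)

theorem polarMap_notMem_farPart {p : Polar} (hp : ‖(p.2.2 : ℂ)‖ ≤ 1) :
    c.polarMap p ∉ c.farPart := by
  intro h
  have h := (c.quadrantMap_mem_farPart _).1 h
  change 4 / 5 < normSq (polarHomeomorph p) at h
  rw [normSq_polarHomeomorph] at h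
  have h1 := abs_le.1 ((Complex.abs_re_le_norm _).trans hp)
  have h2 := abs_le.1 ((Complex.abs_im_le_norm _).trans hp)
  nlinarith

theorem farPart_subset_tubeComplement : c.farPart ⊆ c.tubeComplement := by
  rintro y hy ⟨m₁, m₂, d, hd, hyd⟩
  refine c.polarMap_notMem_farPart (p := (m₁, m₂, ⟨d, bounds_of_norm_le_one hd.le⟩)) hd.le ?_
  convert hy
  exact Subtype.ext hyd

theorem mem_farPart_of_mem_ballExterior {y : ↥(S₁ ∪ S₂)ᶜ} (hy : (y : X) ∈ c.ballExterior) :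
    y ∈ c.farPart := by
  by_cases h : ∃ q, c.quadrantMap q = y
  · obtain ⟨q, rfl⟩ := h
    have := c.coe_quadrantMap_mem_ballExterior.1 hy
    exact (c.quadrantMap_mem_farPart q).2 (by linarith)
  · exact c.mem_farPart_of_notMem h

section

variable {c K k}

theorem leftMap_collapse {F : C(c.SurgeredComplement K k, ↥(S₁ ∪ S₂)ᶜ)}
    (hl : ∀ y, F (c.leftMap K k y) = y)
    (hr : ∀ e, ∃ p : Polar, ‖(p.2.2 : ℂ)‖ ≤ 1 ∧ F (c.rightMap K k e) = c.polarMap p)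
    {w : c.SurgeredComplement K k} (hw : F w ∈ c.farPart) :
    c.leftMap K k ⟨F w, c.farPart_subset_tubeComplement hw⟩ = w := by
  rcases c.leftMap_or_rightMap K k w with ⟨y, rfl⟩ | ⟨e, rfl⟩
  · exact congrArg _ (Subtype.ext (hl y))
  · obtain ⟨p, hp, h⟩ := hr e
    exact absurd (h ▸ hw) (c.polarMap_notMem_farPart hp)

theorem mem_far_or_near (y : ↥(S₁ ∪ S₂)ᶜ) : y ∈ c.farPart ∨ y ∈ Set.range c.polarMap := by
  by_cases h : ∃ q, c.quadrantMap q = y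
  · obtain ⟨q, rfl⟩ := h
    refine Or.inr ⟨polarHomeomorph.symm q, ?_⟩
    exact congrArg c.quadrantMap (polarHomeomorph.apply_symm_apply q)
  · exact Or.inl (c.mem_farPart_of_notMem h)

theorem isPathConnected_far_inter_near {F : C(c.SurgeredComplement K k, ↥(S₁ ∪ S₂)ᶜ)}
    (hl : ∀ y, F (c.leftMap K k y) = y)
    (hr : ∀ e, ∃ p : Polar, ‖(p.2.2 : ℂ)‖ ≤ 1 ∧ F (c.rightMap K k e) = c.polarMap p) :
    IsPathConnected (F ⁻¹' c.farPart ∩ F ⁻¹' Set.range c.polarMap) := by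
  have : PathConnectedSpace (Set.Ioi (4 / 5 : ℝ)) :=
    isPathConnected_iff_pathConnectedSpace.1 ((convex_Ioi _).isPathConnected Set.nonempty_Ioi)
  let f : (CStar × CStar) × Set.Ioi (4 / 5 : ℝ) → CStar × CStar := fun a =>
    scale ⟨√(a.2 / normSq a.1), Real.sqrt_pos.2 (div_pos
      ((by norm_num : (0 : ℝ) < 4 / 5).trans a.2.2) (normSq_pos _))⟩ a.1
  have hf : Continuous f := continuous_scale.comp (Continuous.prodMk (Continuous.subtype_mk
    (Real.continuous_sqrt.comp (Continuous.div (by fun_prop) (continuous_normSq.comp continuous_fst)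
      fun a => (normSq_pos _).ne')) _) continuous_fst)
  have hn (a) : normSq (f a) = a.2 := by
    have h0 := normSq_pos a.1
    have ha : (4 / 5 : ℝ) < a.2 := a.2.2
    change normSq (scale _ _) = _
    rw [normSq_scale]
    change √(a.2 / normSq a.1) ^ 2 * _ = _
    rw [Real.sq_sqrt (div_nonneg (by linarith) h0.le), div_mul_cancel₀ _ h0.ne']
  have hfar (a) : c.quadrantMap (f a) ∈ c.farPart :=
    (c.quadrantMap_mem_farPart _).2 (by rw [hn]; exact a.2.2)
  convert isPathConnected_range (f := fun a => c.leftMap K k ⟨c.quadrantMap (f a),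
    c.farPart_subset_tubeComplement (hfar a)⟩) (by fun_prop) using 1
  ext w
  constructor
  · rintro ⟨h1, p, hp⟩
    have hq : c.quadrantMap (polarHomeomorph p) = F w := hp
    have hq' : 4 / 5 < normSq (polarHomeomorph p) :=
      (c.quadrantMap_mem_farPart _).1 (by rw [hq]; exact h1)
    refine ⟨(polarHomeomorph p, ⟨_, hq'⟩), ?_⟩
    refine Eq.trans (congrArg (c.leftMap K k) (Subtype.ext ?_)) (leftMap_collapse hl hr h1)
    refine Eq.trans (congrArg c.quadrantMap (scale_eq_self ?_ _)) hq
    change √(normSq (polarHomeomorph p) / normSq (polarHomeomorph p)) = 1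
    rw [div_self (normSq_pos _).ne', Real.sqrt_one]
  · rintro ⟨a, rfl⟩
    refine ⟨?_, polarHomeomorph.symm (f a), ?_⟩
    · rw [Set.mem_preimage, hl]
      exact hfar a
    · rw [hl]
      exact congrArg c.quadrantMap (polarHomeomorph.apply_symm_apply (f a))

end

variable [T2Space X]

theorem isOpen_farPart : IsOpen c.farPart :=
  (c.isClosed_closedBall (r := 4 / 5) (by norm_num)).isOpen_compl.preimage continuous_subtype_val

theorem pushHomotopy_mem_farPart (t : I) {y : ↥(S₁ ∪ S₂)ᶜ} (hy : y ∈ c.farPart) :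
    c.pushHomotopy (t, y) ∈ c.farPart := by
  by_cases h : ∃ q, c.quadrantMap q = y
  · obtain ⟨q, rfl⟩ := h
    rw [pushHomotopy_quadrantMap, quadrantMap_mem_farPart]
    exact ((c.quadrantMap_mem_farPart q).1 hy).trans_le (normSq_le_normSq_pushOut t q)
  · rwa [c.pushHomotopy_of_notMem t h]

/-- The map of the complement of the configuration to the part outside of the unit ball, which is
not affected by the surgery. -/
noncomputable def surgeryMap : C(↥(S₁ ∪ S₂)ᶜ, c.SurgeredComplement K k) :=
  (c.leftMap K k).comp ⟨fun y => ⟨c.exteriorInclusion (c.retraction y),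
    c.farPart_subset_tubeComplement (c.mem_farPart_of_mem_ballExterior (c.retraction y).2)⟩,
    by fun_prop⟩

/-- The radial projection of the complement of the configuration, as a map to itself. -/
noncomputable def projection : C(↥(S₁ ∪ S₂)ᶜ, ↥(S₁ ∪ S₂)ᶜ) := c.exteriorInclusion.comp c.retraction

theorem projection_projection (y : ↥(S₁ ∪ S₂)ᶜ) :
    c.projection (c.projection y) = c.projection y :=
  congrArg c.exteriorInclusion (c.retraction_exteriorInclusion _)

theorem surgeryMap_projection (y : ↥(S₁ ∪ S₂)ᶜ) :
    c.surgeryMap K k (c.projection y) = c.surgeryMap K k y :=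
  congrArg (c.leftMap K k) (Subtype.ext (c.projection_projection y))

theorem pushOut_torus (m₁ m₂ : Circle) :
    pushOut (1, (⟨(1 / 2 : ℂ) * m₂, by simp⟩, ⟨(1 / 2 : ℂ) * m₁, by simp⟩)) =
      polarHomeomorph (sphereTorus m₁ m₂).1 := by
  set q : CStar × CStar := (⟨(1 / 2 : ℂ) * m₂, by simp⟩, ⟨(1 / 2 : ℂ) * m₁, by simp⟩)
  have hq : normSq q = 2⁻¹ := by
    simp only [normSq, q, norm_mul, Circle.norm_coe]
    norm_num
  have hf : (pushFactor 1 q : ℝ) = √2 := by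
    change (1 - 1) + 1 * max 1 (√(normSq q))⁻¹ = √2
    have : (1 : ℝ) ≤ √2 := Real.one_le_sqrt.2 (by norm_num)
    rw [hq, Real.sqrt_inv, inv_inv, max_eq_right this]
    ring
  refine Prod.ext (Subtype.ext ?_) (Subtype.ext ?_)
  · change (pushFactor 1 q : ℂ) * ((1 / 2 : ℂ) * m₂) = ((1 / 2 + (4 * √2 - 4) / 8 : ℝ) : ℂ) * m₂
    rw [hf]
    push_cast
    ring
  · change (pushFactor 1 q : ℂ) * ((1 / 2 : ℂ) * m₁) = ((1 / 2 + (4 * √2 - 4) / 8 : ℝ) : ℂ) * m₁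
    rw [hf]
    push_cast
    ring

theorem projection_torus (m₁ m₂ : Circle) :
    c.projection (c.torus (m₁, m₂)) = c.polarMap (sphereTorus m₁ m₂).1 := by
  have h := c.pushHomotopy_quadrantMap 1 (⟨(1 / 2 : ℂ) * m₂, by simp⟩, ⟨(1 / 2 : ℂ) * m₁, by simp⟩)
  rw [pushOut_torus] at h
  exact h

theorem surgeryMap_torus (m₁ m₂ : Circle) :
    c.surgeryMap K k (c.torus (m₁, m₂)) = c.leftMap K k (c.outerMap (sphereTorus m₁ m₂)) :=
  congrArg (c.leftMap K k) (Subtype.ext (c.projection_torus m₁ m₂))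

variable {c K k}

theorem collapse_surgeryMap {F : C(c.SurgeredComplement K k, ↥(S₁ ∪ S₂)ᶜ)}
    (hl : ∀ y, F (c.leftMap K k y) = y) (y : ↥(S₁ ∪ S₂)ᶜ) :
    F (c.surgeryMap K k y) = c.projection y := hl _

/-- Away from the double point, the complement of the surfaces in the surgered manifold is deformed
to the part outside of the unit ball. -/
theorem exists_deformation_far {F : C(c.SurgeredComplement K k, ↥(S₁ ∪ S₂)ᶜ)}
    (hl : ∀ y, F (c.leftMap K k y) = y)
    (hr : ∀ e, ∃ p : Polar, ‖(p.2.2 : ℂ)‖ ≤ 1 ∧ F (c.rightMap K k e) = c.polarMap p) :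
    ∃ H : (⟨Subtype.val, continuous_subtype_val⟩ :
        C(F ⁻¹' c.farPart, c.SurgeredComplement K k)).Homotopy
          ((c.surgeryMap K k).comp (F.comp ⟨Subtype.val, continuous_subtype_val⟩)),
      ∀ w : F ⁻¹' c.farPart, (F w : X) ∈ c.ballExterior → ∀ t, H (t, w) = w := by
  refine ⟨⟨(c.leftMap K k).comp ⟨fun a => ⟨c.pushHomotopy (a.1, F a.2),
    c.farPart_subset_tubeComplement (c.pushHomotopy_mem_farPart a.1 a.2.2)⟩, by fun_prop⟩,
    fun w => ?_, fun w => rfl⟩, fun w hw t => ?_⟩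
  · refine Eq.trans (congrArg (c.leftMap K k) (Subtype.ext ?_)) (leftMap_collapse hl hr w.2)
    exact c.pushHomotopy_zero _
  · refine Eq.trans (congrArg (c.leftMap K k) (Subtype.ext ?_)) (leftMap_collapse hl hr w.2)
    exact c.pushHomotopy_of_mem t hw

theorem pathConnectedSpace_surgeredComplement [PathConnectedSpace ↥(S₁ ∪ S₂)ᶜ]
    (hC : IsClosed (S₁ ∪ S₂)) : PathConnectedSpace (c.SurgeredComplement K k) := by
  obtain ⟨F, hl, hr⟩ := c.exists_collapse K k hC
  obtain ⟨H₁, -⟩ := exists_deformation_far hl hr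
  obtain ⟨r, ⟨H₂⟩, -⟩ := c.exists_deformation_near K k hC hl
  obtain ⟨w, hw⟩ := (isPathConnected_far_inter_near hl hr).nonempty
  have h₁ (v) (hv : F v ∈ c.farPart) : Joined w v :=
    (Joined.trans ⟨H₁.evalAt ⟨w, hw.1⟩⟩ ((PathConnectedSpace.joined (F w) (F v)).map
      (c.surgeryMap K k).continuous)).trans (Joined.symm ⟨H₁.evalAt ⟨v, hv⟩⟩)
  have h₂ (v) (hv : F v ∈ Set.range c.polarMap) : Joined w v :=
    (Joined.trans ⟨H₂.evalAt ⟨w, hw.2⟩⟩ ((PathConnectedSpace.joined (r ⟨w, hw.2⟩) (r ⟨v, hv⟩)).map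
      (c.rightMap K k).continuous)).trans (Joined.symm ⟨H₂.evalAt ⟨v, hv⟩⟩)
  have h (v) : Joined w v := (mem_far_or_near (F v)).elim (h₁ v) (h₂ v)
  exact ⟨⟨w⟩, fun u v => (h u).symm.trans (h v)⟩

/-- The radial projection of the base point. -/
noncomputable def farBasePoint (c : DoublePointChart S₁ S₂) : ↥(S₁ ∪ S₂)ᶜ := c.projection c.basePoint

/-- The surgery map is injective on fundamental groups, as it has a left inverse up to homotopy. -/
theorem injective_map_surgeryMap [PathConnectedSpace ↥(S₁ ∪ S₂)ᶜ] (hC : IsClosed (S₁ ∪ S₂))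
    (y₀ : ↥(S₁ ∪ S₂)ᶜ) : Function.Injective (FundamentalGroup.map (c.surgeryMap K k) y₀) := by
  obtain ⟨F, hl, -⟩ := c.exists_collapse K k hC
  refine (injective_iff_map_eq_one _).2 fun g hg => ?_
  induction g using Path.Homotopic.Quotient.ind with
  | mk p =>
  have hp : (p.map (c.surgeryMap K k).continuous).Homotopic (Path.refl _) :=
    Path.Homotopic.Quotient.exact hg
  set ρ := Holonomy.tautological (basePath y₀)
  have h := ρ.val_map_eq c.retractionHomotopy p
  have h1 : ρ.val (p.map (c.exteriorInclusion.comp c.retraction).continuous) = 1 := by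
    refine ((ρ.val_congr _ ((p.map (c.surgeryMap K k).continuous).map F.continuous)
      fun t => (collapse_surgeryMap hl (p t)).symm).trans
        ((ρ.comap F).val_eq_of_homotopic hp)).trans ((ρ.comap F).val_refl _)
  rw [h1, mul_one, mul_inv_cancel] at h
  have h2 : ρ.val p = 1 := (ρ.val_congr _ _ fun _ => rfl).trans h
  rw [Holonomy.tautological_val, inv_eq_one] at h2
  exact h2

/-- If `μ₁` is a power of `μ₁⁻ᵏ μ₂`, the surgery map is surjective on fundamental groups. In the
surgered manifold `μ₁` is the meridian of the knot, and `μ₁⁻ᵏ μ₂` is the factor `S¹` of the product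
of the knot exterior and the circle. So the group of this product has its image
in that of the complement of the configuration. -/
theorem surjective_map_surgeryMap [PathConnectedSpace ↥(S₁ ∪ S₂)ᶜ] (hC : IsClosed (S₁ ∪ S₂))
    (hab : ∀ a b : c.Group, a * b = b * a)
    (h : c.meridian₁ ∈ Subgroup.zpowers (c.meridian₁ ^ (-k) * c.meridian₂)) :
    Function.Surjective (FundamentalGroup.map (c.surgeryMap K k) c.farBasePoint) := by
  have := pathConnectedSpace_surgeredComplement (c := c) (K := K) (k := k) hC
  obtain ⟨F, hl, hr⟩ := c.exists_collapse K k hC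
  obtain ⟨H₁, hH₁⟩ := exists_deformation_far hl hr
  obtain ⟨r, ⟨H₂⟩, hr₂⟩ := c.exists_deformation_near K k hC hl
  set w := c.surgeryMap K k c.farBasePoint
  set ρ := Holonomy.tautological (basePath w)
  set M := (FundamentalGroup.map (c.surgeryMap K k) c.farBasePoint).range
  have hFw : F w = c.farBasePoint := (collapse_surgeryMap hl _).trans (c.projection_projection _)
  have hwfar : w ∈ F ⁻¹' c.farPart := by
    rw [Set.mem_preimage, hFw]
    exact c.mem_farPart_of_mem_ballExterior (c.retraction _).2
  have hnear (m₁ m₂ : Circle) :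
      c.surgeryMap K k (c.torus (m₁, m₂)) ∈ F ⁻¹' Set.range c.polarMap := by
    rw [Set.mem_preimage, collapse_surgeryMap hl, projection_torus]
    exact ⟨_, rfl⟩
  have hwtorus : w = c.surgeryMap K k (c.torus (1, 1)) := c.surgeryMap_projection K k _
  have hwnear : w ∈ F ⁻¹' Set.range c.polarMap := hwtorus ▸ hnear 1 1
  set a := direction (sphereTorus 1 1)
  have hrtorus (m₁ m₂ : Circle) : r ⟨_, hnear m₁ m₂⟩ = (K.boundaryTorus (a, m₁ * m₂ ^ k), m₂) := by
    have h1 := c.surgeryMap_torus K k m₁ m₂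
    have h2 : c.leftMap K k (c.outerMap (sphereTorus m₁ m₂)) ∈ F ⁻¹' Set.range c.polarMap :=
      h1 ▸ hnear m₁ m₂
    exact (congrArg r (Subtype.ext h1)).trans (hr₂ _ h2)
  have hrw : r ⟨w, hwnear⟩ = (K.boundaryTorus (a, 1), 1) := by
    refine (congrArg r (Subtype.ext hwtorus)).trans ((hrtorus 1 1).trans ?_)
    rw [one_zpow, mul_one]
  -- the holonomy along the surgery map, and its values on the meridians
  have hM (p : Path c.farBasePoint c.farBasePoint) :
      ρ.val (p.map (c.surgeryMap K k).continuous) ∈ M := by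
    rw [Holonomy.tautological_val]
    exact M.inv_mem ⟨FundamentalGroup.fromPath (Path.Homotopic.Quotient.mk p), rfl⟩
  let Θ : c.Group →* FundamentalGroup (c.SurgeredComplement K k) w :=
    (FundamentalGroup.map (c.surgeryMap K k) c.farBasePoint).comp
      (FundamentalGroup.map c.projection c.basePoint)
  set b := ρ.val (H₂.evalAt ⟨w, hwnear⟩)
  let κ := (ρ.comap (c.rightMap K k)).mapHom (MulAut.conj b).toMonoidHom
  have hκ (f : C(Circle, Circle × Circle)) (hf : f 1 = (1, 1)) (g : C(Circle, K.exterior × Circle))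
      (hg : ∀ m, g m = (K.boundaryTorus (a, (f m).1 * (f m).2 ^ k), (f m).2))
      (μ : C(Circle, ↥(S₁ ∪ S₂)ᶜ)) (hμ : ∀ m, μ m = c.torus (f m)) :
      (κ.comap g).val stdLoop = ρ.val ((circleLoop μ).map (c.surgeryMap K k).continuous) := by
    let φ : C(Circle, F ⁻¹' Set.range c.polarMap) := ⟨fun m => ⟨c.surgeryMap K k (c.torus (f m)),
      hnear _ _⟩, Continuous.subtype_mk ((c.surgeryMap K k).continuous.comp
        (c.continuous_torus.comp f.continuous)) _⟩
    have hφ : φ 1 = ⟨w, hwnear⟩ := Subtype.ext (by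
      change c.surgeryMap K k (c.torus (f 1)) = w
      rw [hf, hwtorus])
    have h1 := ρ.val_map_eq H₂ (stdLoop.map φ.continuous)
    have h2 : ρ.val (H₂.evalAt (φ 1)) = b := congrArg (fun u => ρ.val (H₂.evalAt u)) hφ
    rw [h2] at h1
    refine Eq.trans ?_ (h1.symm.trans (ρ.val_congr _ _ fun t => ?_))
    · refine congrArg (fun x => b * x * b⁻¹) (ρ.val_congr _ _ fun t => ?_)
      exact congrArg (c.rightMap K k) ((hg _).trans (hrtorus _ _).symm)
    · exact congrArg (c.surgeryMap K k) (hμ _).symm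
  have hx₁ : (κ.comap (K.meridianCircle a)).val stdLoop = (Θ c.meridian₁)⁻¹ := by
    let μ : C(Circle, ↥(S₁ ∪ S₂)ᶜ) := ⟨fun m => c.torus (m, 1), c.continuous_torus.comp (by fun_prop)⟩
    refine (hκ ⟨fun m => (m, 1), by fun_prop⟩ rfl _ (fun m => ?_) μ fun _ => rfl).trans
      (Holonomy.tautological_val_of_eq _ (((circleLoop μ).map c.projection.continuous).map
        (c.surgeryMap K k).continuous) fun t => (c.surgeryMap_projection K k _).symm)
    change (K.boundaryTorus (a, m), (1 : Circle)) = (K.boundaryTorus (a, m * (1 : Circle) ^ k), 1)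
    rw [one_zpow, mul_one]
  have hx₂ : (κ.comap (K.twistedCircle k a)).val stdLoop = (Θ c.meridian₂)⁻¹ := by
    let μ : C(Circle, ↥(S₁ ∪ S₂)ᶜ) := ⟨fun m => c.torus (1, m), c.continuous_torus.comp (by fun_prop)⟩
    refine (hκ ⟨fun m => (1, m), by fun_prop⟩ rfl _ (fun m => ?_) μ fun _ => rfl).trans
      (Holonomy.tautological_val_of_eq _ (((circleLoop μ).map c.projection.continuous).map
        (c.surgeryMap K k).continuous) fun t => (c.surgeryMap_projection K k _).symm)
    change (K.boundaryTorus (a, m ^ k), m) = (K.boundaryTorus (a, 1 * m ^ k), m)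
    rw [one_mul]
  have hy : (Θ c.meridian₁)⁻¹ ^ (-k) * (Θ c.meridian₂)⁻¹ =
      (Θ (c.meridian₁ ^ (-k) * c.meridian₂))⁻¹ := by
    rw [hab, ← map_inv, ← map_inv, ← map_inv, ← map_zpow, ← map_mul, mul_inv_rev, inv_zpow]
  -- hence the holonomies of loops in the product of the knot exterior and the circle are in `M`
  have hprod (p : Path (K.boundaryTorus (a, 1), (1 : Circle)) (K.boundaryTorus (a, 1), 1)) :
      κ.val p ∈ M := by
    have h1 := K.val_mem_zpowers κ k a hx₁ hx₂ (by
      rw [hy, Subgroup.zpowers_inv]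
      obtain ⟨n, hn⟩ := Subgroup.mem_zpowers_iff.1 h
      exact inv_mem ⟨n, by rw [← hn, map_zpow]; simp only [hn]⟩) p
    rw [hy, Subgroup.zpowers_inv] at h1
    exact Subgroup.zpowers_le.2 (⟨_, rfl⟩ : Θ _ ∈ M) h1
  obtain ⟨v₁, hv₁, hv₁'⟩ := (ρ.comap (c.surgeryMap K k)).exists_gauge M c.farBasePoint 1 fun p => by
    rw [inv_one, one_mul, mul_one]
    exact hM p
  obtain ⟨v₂, hv₂, hv₂'⟩ := (ρ.comap (c.rightMap K k)).exists_gauge M (K.boundaryTorus (a, 1), 1) b⁻¹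
    fun p => by
      rw [inv_inv]
      exact hprod p
  have hu₁ : ρ.val (H₁.evalAt ⟨w, hwfar⟩) * v₁ (F w) = 1 := by
    rw [hFw, hv₁, mul_one]
    refine (ρ.val_congr _ (Path.refl w) fun t => hH₁ ⟨w, hwfar⟩ ?_ t).trans (ρ.val_refl w)
    change (F w : X) ∈ _
    rw [hFw]
    exact (c.retraction _).2
  have hu₂ : b * v₂ (r ⟨w, hwnear⟩) = 1 := by rw [hrw, hv₂, mul_inv_cancel]
  intro g
  induction g using Path.Homotopic.Quotient.ind with
  | mk p =>
  have hp := ρ.gauge_of_homotopies (c.isOpen_farPart.preimage F.continuous)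
    (c.isOpenEmbedding_polarMap.isOpen_range.preimage F.continuous)
    (fun y => mem_far_or_near (F y)) M H₁ v₁ hv₁' H₂ v₂ hv₂' (isPathConnected_far_inter_near hl hr)
    hwfar hwnear (by
      change (ρ.val (H₁.evalAt ⟨w, hwfar⟩) * v₁ (F w))⁻¹ * (b * v₂ (r ⟨w, hwnear⟩)) ∈ M
      rw [hu₁, hu₂, inv_one, one_mul]
      exact M.one_mem) p
  change (ρ.val (H₁.evalAt ⟨w, hwfar⟩) * v₁ (F w))⁻¹ * ρ.val p *
    (ρ.val (H₁.evalAt ⟨w, hwfar⟩) * v₁ (F w)) ∈ M at hp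
  rw [hu₁, inv_one, one_mul, mul_one, Holonomy.tautological_val, inv_mem_iff] at hp
  exact hp

/-- The group of the surgered configuration is that of the configuration if the latter is abelian
and `μ₁` is a power of `μ₁⁻ᵏ μ₂`. -/
theorem nonempty_mulEquiv (hS : IsConfiguration S₁ S₂)
    [ChartedSpace (EuclideanSpace ℝ (Fin 4)) X] [SimplyConnectedSpace X]
    (hab : ∀ a b : c.Group, a * b = b * a)
    (h : c.meridian₁ ∈ Subgroup.zpowers (c.meridian₁ ^ (-k) * c.meridian₂))
    {Y : Type*} [TopologicalSpace Y] {S : Set Y} (hY : c.IsTwistedSurgery K k S) (y : ↥Sᶜ) :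
    Nonempty (FundamentalGroup ↥Sᶜ y ≃* c.Group) := by
  have := hS.pathConnectedSpace
  have hC : IsClosed (S₁ ∪ S₂) := hS.isClosed.1.union hS.isClosed.2
  have := pathConnectedSpace_surgeredComplement (c := c) (K := K) (k := k) hC
  obtain ⟨f, rfl⟩ := hY
  let f' : c.SurgeredComplement K k ≃ₜ ↥(f '' c.surgeredSurfaces K k)ᶜ :=
    f.subtype fun w => not_congr (f.injective.mem_set_image).symm
  have := f'.surjective.pathConnectedSpace f'.continuous
  exact ⟨(FundamentalGroup.fundamentalGroupMulEquivOfPathConnected y _).trans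
    ((MulEquiv.ofBijective _ (bijective_map_homeomorph f'
      (c.surgeryMap K k c.farBasePoint))).symm.trans
    ((MulEquiv.ofBijective _ ⟨injective_map_surgeryMap hC _,
      surjective_map_surgeryMap hC hab h⟩).symm.trans
    (FundamentalGroup.fundamentalGroupMulEquivOfPathConnected c.farBasePoint c.basePoint)))⟩

end DoublePointChart

end

section

/-! ### The three cases -/

theorem mem_zpowers_of_isCoprime {A : Type*} [CommGroup A] {x y : A} {p q k : ℤ} (hq : x ^ q = 1)
    (hp : x ^ p * y = 1) (h : IsCoprime (p + k) q) : x ∈ Subgroup.zpowers (x ^ (-k) * y) := by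
  obtain ⟨u, v, huv⟩ := h
  have hy : x ^ (-k) * y = x ^ (-(p + k)) := by
    rw [eq_inv_of_mul_eq_one_right hp, ← zpow_neg, ← zpow_add]
    congr 1
    ring
  refine ⟨-u, ?_⟩
  change (x ^ (-k) * y) ^ (-u) = x
  calc (x ^ (-k) * y) ^ (-u) = x ^ (u * (p + k) + v * q) * (x ^ q) ^ (-v) := by
        rw [hy, ← zpow_mul, ← zpow_mul, ← zpow_add]
        congr 1
        ring
    _ = x := by rw [huv, hq, one_zpow, zpow_one, mul_one]

theorem zmod_zpow_eq_one (m : ℕ) (g : Multiplicative (ZMod m)) : g ^ (m : ℤ) = 1 := by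
  have h : Nat.card (Multiplicative (ZMod m)) = m := Nat.card_zmod m
  have := pow_card_eq_one' (x := g)
  rwa [h, ← zpow_natCast] at this

theorem mem_zpowers_of_isCoprime_prod {A : Type*} [Group A] {m n : ℕ} {k : ℤ}
    (e : A ≃* Multiplicative (ZMod m) × Multiplicative (ZMod n)) {x y : A}
    {g₁ : Multiplicative (ZMod m)} {g₂ : Multiplicative (ZMod n)} (hx : e x = (g₁, 1))
    (hy : e y = (1, g₂)) (h : IsCoprime (m : ℤ) (k * n)) :
    x ∈ Subgroup.zpowers (x ^ (-k) * y) := by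
  obtain ⟨u, v, huv⟩ := h
  refine ⟨-(v * n), e.injective ?_⟩
  change e ((x ^ (-k) * y) ^ (-(v * n))) = e x
  rw [map_zpow, map_mul, map_zpow, hx, hy]
  refine Prod.ext ?_ ?_
  · change (g₁ ^ (-k) * 1) ^ (-(v * n)) = g₁
    calc (g₁ ^ (-k) * 1) ^ (-(v * n)) = g₁ ^ (u * m + v * (k * n)) * (g₁ ^ (m : ℤ)) ^ (-u) := by
          rw [mul_one, ← zpow_mul, ← zpow_mul, ← zpow_add]
          congr 1
          ring
      _ = g₁ := by rw [huv, zmod_zpow_eq_one, one_zpow, zpow_one, mul_one]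
  · change (1 ^ (-k) * g₂) ^ (-(v * n)) = 1
    rw [one_zpow, one_mul, mul_comm v, ← mul_neg, zpow_mul, zmod_zpow_eq_one, one_zpow]

end

end DoublePointSurgery

theorem propositionP {X : Type*} [TopologicalSpace X] [T2Space X]
    [SecondCountableTopology X]
    [ChartedSpace (EuclideanSpace ℝ (Fin 4)) X] [SimplyConnectedSpace X]
    (S₁ S₂ : Set X) (hS : DoublePointSurgery.IsConfiguration S₁ S₂)
    (c : DoublePointSurgery.DoublePointChart S₁ S₂)
    (hab : ∀ a b : c.Group, a * b = b * a) :
    (∀ x : c.thickTorus, Function.Surjective (FundamentalGroup.map c.thickTorusInclusion x)) ∧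
    ∀ (K : DoublePointSurgery.Knot) (k : ℤ) {Y : Type*} [TopologicalSpace Y] (S : Set Y),
      c.IsTwistedSurgery K k S →
      ((Infinite c.Group → Subgroup.zpowers c.meridian₂ = ⊤ → k = 0 →
          ∀ y : ↥Sᶜ,
            Nonempty (FundamentalGroup ↥Sᶜ y ≃* Multiplicative ℤ)) ∧
        (∀ (q : ℕ) (p : ℤ), 0 < q → Nat.card c.Group = q →
          Subgroup.zpowers c.meridian₁ = ⊤ → c.meridian₁ ^ p * c.meridian₂ = 1 →
          IsCoprime (p + k) (q : ℤ) →
          ∀ y : ↥Sᶜ,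
            Nonempty (FundamentalGroup ↥Sᶜ y ≃* Multiplicative (ZMod q))) ∧
        (∀ (m n : ℕ) (e : c.Group ≃* Multiplicative (ZMod m) × Multiplicative (ZMod n))
          (g₁ : Multiplicative (ZMod m)) (g₂ : Multiplicative (ZMod n)),
          Subgroup.zpowers g₁ = ⊤ → Subgroup.zpowers g₂ = ⊤ →
          e c.meridian₁ = (g₁, 1) → e c.meridian₂ = (1, g₂) →
          IsCoprime (m : ℤ) (k * n) →
          ∀ y : ↥Sᶜ,
            Nonempty (FundamentalGroup ↥Sᶜ y ≃*
              Multiplicative (ZMod m) × Multiplicative (ZMod n)))) := by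
  refine ⟨c.surjective_map_thickTorusInclusion hS hab, fun K k Y _ S hY => ⟨?_, ?_, ?_⟩⟩
  · intro hinf htop hk y
    obtain ⟨f⟩ := c.nonempty_mulEquiv hS hab (k := k) (by
      rw [hk, neg_zero, zpow_zero, one_mul, htop]
      exact Subgroup.mem_top _) hY y
    have hcyc : IsCyclic c.Group := ⟨c.meridian₂, fun x => htop.ge (Subgroup.mem_top x)⟩
    have hcard : Nat.card c.Group = 0 := Nat.card_eq_zero_of_infinite
    have g := zmodCyclicMulEquiv hcyc
    -- `ZMod 0` is `ℤ`
    rw [hcard] at g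
    exact ⟨f.trans g.symm⟩
  · intro q p _ hcard htop hp hpk y
    let _ : CommGroup c.Group := CommGroup.mk hab
    obtain ⟨f⟩ := c.nonempty_mulEquiv hS hab (k := k)
      (DoublePointSurgery.mem_zpowers_of_isCoprime (q := q) (by
        rw [zpow_natCast, ← hcard]
        exact pow_card_eq_one') hp hpk) hY y
    have hcyc : IsCyclic c.Group := ⟨c.meridian₁, fun x => htop.ge (Subgroup.mem_top x)⟩
    exact ⟨f.trans (hcard ▸ zmodCyclicMulEquiv hcyc).symm⟩
  · intro m n e g₁ g₂ _ _ h₁ h₂ hmn y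
    obtain ⟨f⟩ := c.nonempty_mulEquiv hS hab (k := k)
      (DoublePointSurgery.mem_zpowers_of_isCoprime_prod e h₁ h₂ hmn) hY y
    exact ⟨f.trans e⟩
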